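/- **Setting.** Fix a full set of roles $U\subseteq\mathbb Z$. We work in the following multi-threaded, call-by-value linear $\lambda$-calculus with multiparty dependent session types, $\lambda^{\pi}_{\forall,\exists}$. *Statics.* Sorts are $int, bool, set$ (sets of integers, used as sets of roles), $stype, type, vtype$ and $\sigma\to\sigma'$. Static terms are the simply typed $\lambda$-terms over integer arithmetic, propositions and set operations, and over - session types $\pi ::= \mathtt{end}(r)\mid \mathtt{msg}(r,\tau)::\pi\mid \mathtt{msg}(r_1,r_2,\hat\tau)::\pi\mid \mathtt{quan}(r,f)$ with $f:\sigma\to stype$; - types $\tau ::= int(s)\mid \mathbf 1\mid\tau\times\tau\mid\hat\tau\to\hat\tau$ and linear types $\hat\tau ::= \tau\mid chan(rs,\pi)\mid\hat\tau\otimes\hat\tau\mid\hat\tau\multimap\hat\tau$, both also closed under $P\supset\cdot$, $P\wedge\cdot$, $\forall a{:}\sigma.\,\cdot$ and $\exists a{:}\sigma.\,\cdot$. Constraints $\vec P\models P$ are read in the standard model of integers, sets of integers and propositions. Type equality is the congruence generated by $\beta$ and by equality of indices in this model. "$r\notin rs$" means $r\in U\setminus rs$. *Dynamics.* Terms are $\lambda$-terms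 with unit, pairs, integer literals and arithmetic, introduction and elimination forms for $\supset,\wedge,\forall,\exists$, endpoints $c^{rs}$ (channel $c$, role set $rs$), thread creation $\mathtt{spawn}:(\mathbf 1\multimap\mathbf 1)\Rightarrow\mathbf 1$, and the session APIs below. Each API is typed for all $\pi,\tau,\hat\tau$, role sets and roles that satisfy the stated condition: - $\mathtt{fork}:(chan(rs_1,\pi)\multimap\mathbf 1)\Rightarrow chan(rs_2,\pi)$ if $rs_1\uplus rs_2=U$; - $\mathtt{cut}:(chan(rs_1,\pi),chan(rs_2,\pi))\Rightarrow chan(rs_1\cap rs_2,\pi)$ if $rs_1\cup rs_2=U$; - $\mathtt{elim}:chan(\varnothing,\pi)\Rightarrow\mathbf 1$; - $\mathtt{split}:(chan(rs_1\uplus rs_2,\pi),chan(rs_1,\pi)\multimap\mathbf 1)\Rightarrow chan(rs_2,\pi)$ if $rs_1\cap rs_2=\varnothing$; - $\mathtt{bsend}:(chan(rs,\mathtt{msg}(r,\tau)::\pi),\tau)\Rightarrow chan(rs,\pi)$ if $r\in rs$, and $\mathtt{brecv}:chan(rs,\mathtt{msg}(r,\tau)::\pi)\Rightarrow chan(rs,\pi)\otimes\tau$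 if $r\notin rs$; - on $chan(rs,\mathtt{msg}(r_1,r_2,\hat\tau)::\pi)$: $\mathtt{send}$ takes in addition a $\hat\tau$ and returns $chan(rs,\pi)$, if $r_1\in rs$ and $r_2\notin rs$; $\mathtt{recv}$ returns $chan(rs,\pi)\otimes\hat\tau$, if $r_1\notin rs$ and $r_2\in rs$; $\mathtt{skip}$ returns $chan(rs,\pi)$, if $r_1,r_2\in rs$ or $r_1,r_2\notin rs$; - on $chan(rs,\mathtt{end}(r))$, with result $\mathbf 1$: $\mathtt{close}$ if $r\in rs$, $\mathtt{wait}$ if $r\notin rs$; - on $chan(rs,\mathtt{quan}(r,f))$: $\mathtt{unify}$ returns $\forall a{:}\sigma.\,chan(rs,f(a))$ if $r\in rs$, $\mathtt{exify}$ returns $\exists a{:}\sigma.\,chan(rs,f(a))$ if $r\notin rs$. A signature $\mathcal S$ assigns closed session types to channels, and $c^{rs}:chan(rs,\mathcal S(c))$. The other typing rules are the usual ones with split linear contexts; a $\lambda$-abstraction of non-linear type $\hat\tau_1\to\hat\tau_2$ contains neither linear variables nor endpoints. *Pools.* A pool $\Pi$ is a finite map from thread identifiers to closed terms; $\vdash\Pi:\hat\tau$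 (under $\mathcal S$) means $\vdash\Pi(0):\hat\tau$ and $\vdash\Pi(t):\mathbf 1$ for $0<t\in\mathrm{dom}(\Pi)$. Let $\rho(\Pi)$ be the multiset of endpoints occurring in $\Pi$. It is *consistent* if, for each channel $c$ in it, the role sets of the endpoints of $c$ form a partition of $U$ (empty blocks allowed). Pool reduction $\Pi\to\Pi'$ is one of the following, where $E,E_i$ are evaluation contexts and $v$ is a value: - an ordinary call-by-value reduction of one thread; removal of a thread $t:\langle\rangle$ with $t>0$; $t:E[\mathtt{spawn}(\lambda x.e)]$ becomes $t:E[\langle\rangle],\ t':e[x\mapsto\langle\rangle]$ with $t'$ new; - $t:E[\mathtt{fork}(\lambda x.e)]$ becomes $t:E[c^{rs_2}],\ t':e[x\mapsto c^{rs_1}]$ with $c,t'$ new and $rs_1\uplus rs_2=U$; - $t:E[\mathtt{cut}(c_1^{rs_1},c_2^{rs_2})]$ becomes $t:E[c^{rs_1\cap rs_2}]$ with $c$ new, and $c_1,c_2$ are renamed to $c$ in the whole pool; - $E[\mathtt{elim}(c^{\varnothing})]$ becomes $E[\langle\rangle]$; $t:E[\mathtt{split}(c^{rs_1\uplus rs_2},\lambda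 x.e)]$ becomes $t:E[c^{rs_2}],\ t':e[x\mapsto c^{rs_1}]$ with $t'$ new; - synchronisation on a channel $c$ whose endpoints in the pool are exactly $c^{rs_1},\dots,c^{rs_n}$ ($n\ge1$), the endpoint $c^{rs_i}$ being the one on which thread $t_i:E_i[\cdot]$ calls an API ($t_1,\dots,t_n$ distinct). The calls are one of: one $\mathtt{bsend}(c^{rs_1},v)$ and otherwise $\mathtt{brecv}$ (reducts $c^{rs_1}$ and $\langle c^{rs_i},v\rangle$); one $\mathtt{close}$ and otherwise $\mathtt{wait}$ (reducts $\langle\rangle$); one $\mathtt{unify}$ and otherwise $\mathtt{exify}$ (reducts $c^{rs_i}$); one $\mathtt{send}(c^{rs_1},v)$, one $\mathtt{recv}(c^{rs_2})$ and otherwise $\mathtt{skip}$ (reducts $c^{rs_1}$, $\langle c^{rs_2},v\rangle$ and $c^{rs_i}$); or only $\mathtt{skip}$ (reducts $c^{rs_i}$). Evaluation of pools is the reflexive-transitive closure of pool reduction and of the equivalence $E[\mathtt{cut}(x,y)]\equiv E[\mathtt{cut}(y,x)]$ in one thread. **Theorem (Progress).** Let $\Pi$ be a pool that is obtained by evaluation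 from some well-typed pool in which no endpoint occurs. Assume that $\vdash\Pi:\hat\tau$ under some signature, that $\rho(\Pi)$ is consistent, and that $\Pi(0)$, if it is a value, contains no endpoints. Then either $\Pi$ is a singleton mapping $0\mapsto v$ for a value $v$, or $\Pi\to\Pi'$ for some pool $\Pi'$. -/

import Mathlib

namespace MPST

/-! ### Statics: sorts and static terms -/

/-- `non` marks the sort *type* of non-linear types, `lin` the sort *vtype* of linear types. -/
inductive Knd
  | non
  | lin

/-- Sorts of the statics. -/
inductive Srt
  | int
  | bool
  | set
  | stype
  | ty (k : Knd)
  | arr (a b : Srt)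

/-- The sort *type*. -/
abbrev Srt.type : Srt := .ty .non

/-- The sort *vtype*. -/
abbrev Srt.vtype : Srt := .ty .lin

/-- Integer operations, shared by the statics and the dynamics. -/
inductive IntOp
  | add
  | sub
  | mul
  | div

/-- Division rounds to the nearest integer. -/
def IntOp.eval : IntOp → ℤ → ℤ → ℤ
  | .add, m, n => m + n
  | .sub, m, n => m - n
  | .mul, m, n => m * n
  | .div, m, n => round ((m : ℚ) / (n : ℚ))

/-- Static variables (de Bruijn) of a given sort in a sorting context. -/
inductive Var : List Srt → Srt → Type
  | z {D : List Srt} {a : Srt} : Var (a :: D) a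
  | s {D : List Srt} {a b : Srt} : Var D a → Var (b :: D) a

/-- Well-sorted static terms: a simply typed lambda calculus over the static constants.
Session types are the terms of sort `stype`, types those of sort `ty k`.  Roles are static
integers, role sets are static terms of sort `set`. -/
inductive STm : List Srt → Srt → Type
  | var {D : List Srt} {a : Srt} : Var D a → STm D a
  | lam {D : List Srt} {a b : Srt} : STm (a :: D) b → STm D (.arr a b)
  | app {D : List Srt} {a b : Srt} : STm D (.arr a b) → STm D a → STm D b
  -- integers
  | intLit {D : List Srt} : ℤ → STm D .int
  | arith {D : List Srt} : IntOp → STm D .int → STm D .int → STm D .int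
  -- propositions
  | tt {D : List Srt} : STm D .bool
  | not {D : List Srt} : STm D .bool → STm D .bool
  | and {D : List Srt} : STm D .bool → STm D .bool → STm D .bool
  | or {D : List Srt} : STm D .bool → STm D .bool → STm D .bool
  | eqInt {D : List Srt} : STm D .int → STm D .int → STm D .bool
  | leInt {D : List Srt} : STm D .int → STm D .int → STm D .bool
  | eqSet {D : List Srt} : STm D .set → STm D .set → STm D .bool
  | mem {D : List Srt} : STm D .int → STm D .set → STm D .bool
  -- role sets
  | setLit {D : List Srt} : Set ℤ → STm D .set
  | single {D : List Srt} : STm D .int → STm D .set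
  | union {D : List Srt} : STm D .set → STm D .set → STm D .set
  | inter {D : List Srt} : STm D .set → STm D .set → STm D .set
  | diff {D : List Srt} : STm D .set → STm D .set → STm D .set
  -- session types: `end(r)`, `msg(r,τ)::π`, `msg(r₁,r₂,τ)::π`, `quan(r,f)`
  | endS {D : List Srt} : STm D .int → STm D .stype
  | bmsg {D : List Srt} : STm D .int → STm D .type → STm D .stype → STm D .stype
  | msg {D : List Srt} : STm D .int → STm D .int → STm D .vtype → STm D .stype → STm D .stype
  | quan {D : List Srt} {a : Srt} : STm D .int → STm D (.arr a .stype) → STm D .stype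
  -- non-linear types: `int(s)`, `unit`, `τ₁ × τ₂`, `τ₁ → τ₂`
  | intT {D : List Srt} : STm D .int → STm D .type
  | unit {D : List Srt} : STm D .type
  | prod {D : List Srt} : STm D .type → STm D .type → STm D .type
  | fn {D : List Srt} : STm D .vtype → STm D .vtype → STm D .type
  -- linear types: a non-linear type, `chan(rs,π)`, `τ₁ ⊗ τ₂`, `τ₁ ⊸ τ₂`
  | lin {D : List Srt} : STm D .type → STm D .vtype
  | chan {D : List Srt} : STm D .set → STm D .stype → STm D .vtype
  | tensor {D : List Srt} : STm D .vtype → STm D .vtype → STm D .vtype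
  | lolli {D : List Srt} : STm D .vtype → STm D .vtype → STm D .vtype
  -- of both kinds: `P ⊃ τ`, `P ∧ τ`, `∀ a:σ. τ`, `∃ a:σ. τ`
  | guard {D : List Srt} {k : Knd} : STm D .bool → STm D (.ty k) → STm D (.ty k)
  | conj {D : List Srt} {k : Knd} : STm D .bool → STm D (.ty k) → STm D (.ty k)
  | all {D : List Srt} {k : Knd} {a : Srt} : STm (a :: D) (.ty k) → STm D (.ty k)
  | ex {D : List Srt} {k : Knd} {a : Srt} : STm (a :: D) (.ty k) → STm D (.ty k)

/-- Static renamings. -/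
abbrev Ren (D D' : List Srt) : Type := ∀ a, Var D a → Var D' a

def Ren.up {D D' : List Srt} (f : Ren D D') (b : Srt) : Ren (b :: D) (b :: D')
  | _, .z => .z
  | _, .s x => .s (f _ x)

def STm.rename : {D D' : List Srt} → {a : Srt} → Ren D D' → STm D a → STm D' a
  | _, _, _, f, .var x => .var (f _ x)
  | _, _, _, f, .lam t => .lam (t.rename (f.up _))
  | _, _, _, f, .app t u => .app (t.rename f) (u.rename f)
  | _, _, _, _, .intLit n => .intLit n
  | _, _, _, f, .arith o t u => .arith o (t.rename f) (u.rename f)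
  | _, _, _, _, .tt => .tt
  | _, _, _, f, .not t => .not (t.rename f)
  | _, _, _, f, .and t u => .and (t.rename f) (u.rename f)
  | _, _, _, f, .or t u => .or (t.rename f) (u.rename f)
  | _, _, _, f, .eqInt t u => .eqInt (t.rename f) (u.rename f)
  | _, _, _, f, .leInt t u => .leInt (t.rename f) (u.rename f)
  | _, _, _, f, .eqSet t u => .eqSet (t.rename f) (u.rename f)
  | _, _, _, f, .mem t u => .mem (t.rename f) (u.rename f)
  | _, _, _, _, .setLit R => .setLit R
  | _, _, _, f, .single t => .single (t.rename f)
  | _, _, _, f, .union t u => .union (t.rename f) (u.rename f)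
  | _, _, _, f, .inter t u => .inter (t.rename f) (u.rename f)
  | _, _, _, f, .diff t u => .diff (t.rename f) (u.rename f)
  | _, _, _, f, .endS r => .endS (r.rename f)
  | _, _, _, f, .bmsg r t p => .bmsg (r.rename f) (t.rename f) (p.rename f)
  | _, _, _, f, .msg r₁ r₂ t p =>
      .msg (r₁.rename f) (r₂.rename f) (t.rename f) (p.rename f)
  | _, _, _, f, .quan r t => .quan (r.rename f) (t.rename f)
  | _, _, _, f, .intT t => .intT (t.rename f)
  | _, _, _, _, .unit => .unit
  | _, _, _, f, .prod t u => .prod (t.rename f) (u.rename f)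
  | _, _, _, f, .fn t u => .fn (t.rename f) (u.rename f)
  | _, _, _, f, .lin t => .lin (t.rename f)
  | _, _, _, f, .chan t u => .chan (t.rename f) (u.rename f)
  | _, _, _, f, .tensor t u => .tensor (t.rename f) (u.rename f)
  | _, _, _, f, .lolli t u => .lolli (t.rename f) (u.rename f)
  | _, _, _, f, .guard t u => .guard (t.rename f) (u.rename f)
  | _, _, _, f, .conj t u => .conj (t.rename f) (u.rename f)
  | _, _, _, f, .all t => .all (t.rename (f.up _))
  | _, _, _, f, .ex t => .ex (t.rename (f.up _))

/-- Weakening by one static variable. -/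
def STm.wk {D : List Srt} {a : Srt} (b : Srt) (t : STm D a) : STm (b :: D) a :=
  t.rename fun _ x => .s x

/-- A closed static term in an arbitrary sorting context. -/
def STm.ofClosed {D : List Srt} {a : Srt} (t : STm [] a) : STm D a :=
  t.rename fun _ x => by cases x

/-- Static substitutions. -/
abbrev Sub (D D' : List Srt) : Type := ∀ a, Var D a → STm D' a

def Sub.up {D D' : List Srt} (f : Sub D D') (b : Srt) : Sub (b :: D) (b :: D')
  | _, .z => .var .z
  | _, .s x => (f _ x).wk b

def STm.subst : {D D' : List Srt} → {a : Srt} → Sub D D' → STm D a → STm D' a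
  | _, _, _, f, .var x => f _ x
  | _, _, _, f, .lam t => .lam (t.subst (f.up _))
  | _, _, _, f, .app t u => .app (t.subst f) (u.subst f)
  | _, _, _, _, .intLit n => .intLit n
  | _, _, _, f, .arith o t u => .arith o (t.subst f) (u.subst f)
  | _, _, _, _, .tt => .tt
  | _, _, _, f, .not t => .not (t.subst f)
  | _, _, _, f, .and t u => .and (t.subst f) (u.subst f)
  | _, _, _, f, .or t u => .or (t.subst f) (u.subst f)
  | _, _, _, f, .eqInt t u => .eqInt (t.subst f) (u.subst f)
  | _, _, _, f, .leInt t u => .leInt (t.subst f) (u.subst f)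
  | _, _, _, f, .eqSet t u => .eqSet (t.subst f) (u.subst f)
  | _, _, _, f, .mem t u => .mem (t.subst f) (u.subst f)
  | _, _, _, _, .setLit R => .setLit R
  | _, _, _, f, .single t => .single (t.subst f)
  | _, _, _, f, .union t u => .union (t.subst f) (u.subst f)
  | _, _, _, f, .inter t u => .inter (t.subst f) (u.subst f)
  | _, _, _, f, .diff t u => .diff (t.subst f) (u.subst f)
  | _, _, _, f, .endS r => .endS (r.subst f)
  | _, _, _, f, .bmsg r t p => .bmsg (r.subst f) (t.subst f) (p.subst f)
  | _, _, _, f, .msg r₁ r₂ t p =>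
      .msg (r₁.subst f) (r₂.subst f) (t.subst f) (p.subst f)
  | _, _, _, f, .quan r t => .quan (r.subst f) (t.subst f)
  | _, _, _, f, .intT t => .intT (t.subst f)
  | _, _, _, _, .unit => .unit
  | _, _, _, f, .prod t u => .prod (t.subst f) (u.subst f)
  | _, _, _, f, .fn t u => .fn (t.subst f) (u.subst f)
  | _, _, _, f, .lin t => .lin (t.subst f)
  | _, _, _, f, .chan t u => .chan (t.subst f) (u.subst f)
  | _, _, _, f, .tensor t u => .tensor (t.subst f) (u.subst f)
  | _, _, _, f, .lolli t u => .lolli (t.subst f) (u.subst f)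
  | _, _, _, f, .guard t u => .guard (t.subst f) (u.subst f)
  | _, _, _, f, .conj t u => .conj (t.subst f) (u.subst f)
  | _, _, _, f, .all t => .all (t.subst (f.up _))
  | _, _, _, f, .ex t => .ex (t.subst (f.up _))

/-- The substitution of `s` for the last static variable. -/
def Sub.one {D : List Srt} {b : Srt} (s : STm D b) : Sub (b :: D) D
  | _, .z => s
  | _, .s x => .var x

/-- `t[a ↦ s]`. -/
def STm.inst {D : List Srt} {a b : Srt} (t : STm (b :: D) a) (s : STm D b) : STm D a :=
  t.subst (Sub.one s)

/-! ### The constraint domain: integers, propositions and integer sets -/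

/-- Standard interpretation of sorts; types and session types carry no index information. -/
@[reducible] def Srt.denote : Srt → Type
  | .int => ℤ
  | .bool => Prop
  | .set => Set ℤ
  | .stype => PUnit
  | .ty _ => PUnit
  | .arr a b => a.denote → b.denote

/-- Environments for a sorting context. -/
abbrev Env (D : List Srt) : Type := ∀ a, Var D a → a.denote

def Env.cons {D : List Srt} {b : Srt} (x : b.denote) (ρ : Env D) : Env (b :: D)
  | _, .z => x
  | _, .s y => ρ _ y

/-- Standard interpretation of static terms. -/
def STm.eval : {D : List Srt} → {a : Srt} → STm D a → Env D → a.denote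
  | _, _, .var x, ρ => ρ _ x
  | _, _, .lam t, ρ => fun x => t.eval (Env.cons x ρ)
  | _, _, .app t u, ρ => (t.eval ρ) (u.eval ρ)
  | _, _, .intLit n, _ => n
  | _, _, .arith o t u, ρ => o.eval (t.eval ρ) (u.eval ρ)
  | _, _, .tt, _ => True
  | _, _, .not t, ρ => ¬ t.eval ρ
  | _, _, .and t u, ρ => t.eval ρ ∧ u.eval ρ
  | _, _, .or t u, ρ => t.eval ρ ∨ u.eval ρ
  | _, _, .eqInt t u, ρ => t.eval ρ = u.eval ρ
  | _, _, .leInt t u, ρ => (show ℤ from t.eval ρ) ≤ (show ℤ from u.eval ρ)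
  | _, _, .eqSet t u, ρ => t.eval ρ = u.eval ρ
  | _, _, .mem t u, ρ => (show ℤ from t.eval ρ) ∈ (show Set ℤ from u.eval ρ)
  | _, _, .setLit R, _ => R
  | _, _, .single t, ρ => ({(show ℤ from t.eval ρ)} : Set ℤ)
  | _, _, .union t u, ρ => (show Set ℤ from t.eval ρ) ∪ (show Set ℤ from u.eval ρ)
  | _, _, .inter t u, ρ => (show Set ℤ from t.eval ρ) ∩ (show Set ℤ from u.eval ρ)
  | _, _, .diff t u, ρ => (show Set ℤ from t.eval ρ) \ (show Set ℤ from u.eval ρ)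
  | _, _, .endS _, _ => ⟨⟩
  | _, _, .bmsg _ _ _, _ => ⟨⟩
  | _, _, .msg _ _ _ _, _ => ⟨⟩
  | _, _, .quan _ _, _ => ⟨⟩
  | _, _, .intT _, _ => ⟨⟩
  | _, _, .unit, _ => ⟨⟩
  | _, _, .prod _ _, _ => ⟨⟩
  | _, _, .fn _ _, _ => ⟨⟩
  | _, _, .lin _, _ => ⟨⟩
  | _, _, .chan _ _, _ => ⟨⟩
  | _, _, .tensor _ _, _ => ⟨⟩
  | _, _, .lolli _ _, _ => ⟨⟩
  | _, _, .guard _ _, _ => ⟨⟩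
  | _, _, .conj _ _, _ => ⟨⟩
  | _, _, .all _, _ => ⟨⟩
  | _, _, .ex _, _ => ⟨⟩

/-- The environment satisfies the hypotheses `P`. -/
def Sat {D : List Srt} (P : List (STm D .bool)) (ρ : Env D) : Prop :=
  ∀ q ∈ P, q.eval ρ

/-- Constraint entailment `Σ; P ⊨ p`. -/
def Entails {D : List Srt} (P : List (STm D .bool)) (p : STm D .bool) : Prop :=
  ∀ ρ : Env D, Sat P ρ → p.eval ρ

/-- Sorts of indices, compared in the constraint domain. -/
inductive Srt.IsIndex : Srt → Prop
  | int : Srt.IsIndex .int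
  | bool : Srt.IsIndex .bool
  | set : Srt.IsIndex .set

/-- Equality of static terms, in particular of types, under the hypotheses `P`: the congruence
generated by `β`, by equality of indices in the constraint domain, and by the identification of
the two readings of `P ⊃ τ`, `P ∧ τ`, `∀ a. τ`, `∃ a. τ` (with `τ` non-linear) as a linear type. -/
inductive Conv : {D : List Srt} → List (STm D .bool) → {a : Srt} → STm D a → STm D a → Prop
  | refl {D : List Srt} {P : List (STm D .bool)} {a : Srt} (t : STm D a) : Conv P t t
  | symm {D : List Srt} {P : List (STm D .bool)} {a : Srt} {t u : STm D a} :
      Conv P t u → Conv P u t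
  | trans {D : List Srt} {P : List (STm D .bool)} {a : Srt} {t u v : STm D a} :
      Conv P t u → Conv P u v → Conv P t v
  | beta {D : List Srt} {P : List (STm D .bool)} {a b : Srt} (t : STm (a :: D) b) (s : STm D a) :
      Conv P (.app (.lam t) s) (t.inst s)
  | index {D : List Srt} {P : List (STm D .bool)} {a : Srt} {t u : STm D a} :
      a.IsIndex → (∀ ρ : Env D, Sat P ρ → t.eval ρ = u.eval ρ) → Conv P t u
  | linGuard {D : List Srt} {P : List (STm D .bool)} (p : STm D .bool) (t : STm D .type) :
      Conv P (.lin (.guard p t)) (.guard p (.lin t))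
  | linConj {D : List Srt} {P : List (STm D .bool)} (p : STm D .bool) (t : STm D .type) :
      Conv P (.lin (.conj p t)) (.conj p (.lin t))
  | linAll {D : List Srt} {P : List (STm D .bool)} {a : Srt} (t : STm (a :: D) .type) :
      Conv P (.lin (.all t)) (.all (.lin t))
  | linEx {D : List Srt} {P : List (STm D .bool)} {a : Srt} (t : STm (a :: D) .type) :
      Conv P (.lin (.ex t)) (.ex (.lin t))
  -- congruence (index constructors are covered by `index`)
  | lam {D : List Srt} {P : List (STm D .bool)} {a b : Srt} {t t' : STm (a :: D) b} :
      Conv (P.map (STm.wk a)) t t' → Conv P (.lam t) (.lam t')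
  | app {D : List Srt} {P : List (STm D .bool)} {a b : Srt} {t t' : STm D (.arr a b)}
      {u u' : STm D a} : Conv P t t' → Conv P u u' → Conv P (.app t u) (.app t' u')
  | endS {D : List Srt} {P : List (STm D .bool)} {r r' : STm D .int} :
      Conv P r r' → Conv P (.endS r) (.endS r')
  | bmsg {D : List Srt} {P : List (STm D .bool)} {r r' : STm D .int} {t t' : STm D .type}
      {p p' : STm D .stype} :
      Conv P r r' → Conv P t t' → Conv P p p' → Conv P (.bmsg r t p) (.bmsg r' t' p')
  | msg {D : List Srt} {P : List (STm D .bool)} {r₁ r₁' r₂ r₂' : STm D .int}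
      {t t' : STm D .vtype} {p p' : STm D .stype} :
      Conv P r₁ r₁' → Conv P r₂ r₂' → Conv P t t' → Conv P p p' →
        Conv P (.msg r₁ r₂ t p) (.msg r₁' r₂' t' p')
  | quan {D : List Srt} {P : List (STm D .bool)} {a : Srt} {r r' : STm D .int}
      {f f' : STm D (.arr a .stype)} :
      Conv P r r' → Conv P f f' → Conv P (.quan r f) (.quan r' f')
  | intT {D : List Srt} {P : List (STm D .bool)} {s s' : STm D .int} :
      Conv P s s' → Conv P (.intT s) (.intT s')
  | prod {D : List Srt} {P : List (STm D .bool)} {t t' u u' : STm D .type} :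
      Conv P t t' → Conv P u u' → Conv P (.prod t u) (.prod t' u')
  | fn {D : List Srt} {P : List (STm D .bool)} {t t' u u' : STm D .vtype} :
      Conv P t t' → Conv P u u' → Conv P (.fn t u) (.fn t' u')
  | lin {D : List Srt} {P : List (STm D .bool)} {t t' : STm D .type} :
      Conv P t t' → Conv P (.lin t) (.lin t')
  | chan {D : List Srt} {P : List (STm D .bool)} {s s' : STm D .set} {p p' : STm D .stype} :
      Conv P s s' → Conv P p p' → Conv P (.chan s p) (.chan s' p')
  | tensor {D : List Srt} {P : List (STm D .bool)} {t t' u u' : STm D .vtype} :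
      Conv P t t' → Conv P u u' → Conv P (.tensor t u) (.tensor t' u')
  | lolli {D : List Srt} {P : List (STm D .bool)} {t t' u u' : STm D .vtype} :
      Conv P t t' → Conv P u u' → Conv P (.lolli t u) (.lolli t' u')
  | guard {D : List Srt} {P : List (STm D .bool)} {k : Knd} {p p' : STm D .bool}
      {t t' : STm D (.ty k)} :
      Conv P p p' → Conv P t t' → Conv P (.guard p t) (.guard p' t')
  | conj {D : List Srt} {P : List (STm D .bool)} {k : Knd} {p p' : STm D .bool}
      {t t' : STm D (.ty k)} :
      Conv P p p' → Conv P t t' → Conv P (.conj p t) (.conj p' t')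
  | all {D : List Srt} {P : List (STm D .bool)} {k : Knd} {a : Srt}
      {t t' : STm (a :: D) (.ty k)} :
      Conv (P.map (STm.wk a)) t t' → Conv P (.all t) (.all t')
  | ex {D : List Srt} {P : List (STm D .bool)} {k : Knd} {a : Srt}
      {t t' : STm (a :: D) (.ty k)} :
      Conv (P.map (STm.wk a)) t t' → Conv P (.ex t) (.ex t')

/-! ### Dynamics: terms, values, resources -/

/-- An endpoint `c^rs`: a channel name with a set of roles. -/
structure Endpoint where
  ch : ℕ
  roles : Set ℤ

/-- Unary dynamic constant functions. `spawn` is thread creation without a channel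
(`(unit ⊸ unit) ⇒ unit`); the others are session APIs. -/
inductive Api1
  | spawn
  | fork
  | elim
  | brecv
  | recv
  | skip
  | close
  | wait
  | unify
  | exify

/-- Binary dynamic constant functions: session APIs and integer arithmetic. -/
inductive Api2
  | cut
  | split
  | bsend
  | send
  | arith (o : IntOp)

/-- Dynamic terms, with de Bruijn indices for term variables. They contain no static terms. -/
inductive Tm
  | var (x : ℕ)
  | res (c : Endpoint)
  | lit (n : ℤ)
  | api1 (f : Api1) (e : Tm)
  | api2 (f : Api2) (e₁ e₂ : Tm)
  | lam (e : Tm)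
  | app (e₁ e₂ : Tm)
  | unit
  | pair (e₁ e₂ : Tm)
  | fst (e : Tm)
  | snd (e : Tm)
  /-- `let ⟨x₁, x₂⟩ = e₁ in e₂`; in `e₂`, `x₁` is index `0` and `x₂` is index `1`. -/
  | letPair (e₁ e₂ : Tm)
  | guardI (e : Tm)
  | guardE (e : Tm)
  | conjI (e : Tm)
  | letConj (e₁ e₂ : Tm)
  | allI (e : Tm)
  | allE (e : Tm)
  | exI (e : Tm)
  | letEx (e₁ e₂ : Tm)

/-- The endpoint `c^R` as a term. -/
abbrev Tm.ep (c : ℕ) (R : Set ℤ) : Tm := .res ⟨c, R⟩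

/-- Values. The bodies of `guardI` and `allI` in well-typed terms are values by the typing
rules. -/
inductive IsValue : Tm → Prop
  | var (x : ℕ) : IsValue (.var x)
  | res (c : Endpoint) : IsValue (.res c)
  | lit (n : ℤ) : IsValue (.lit n)
  | unit : IsValue .unit
  | pair {v₁ v₂ : Tm} : IsValue v₁ → IsValue v₂ → IsValue (.pair v₁ v₂)
  | lam (e : Tm) : IsValue (.lam e)
  | guardI {v : Tm} : IsValue v → IsValue (.guardI v)
  | conjI {v : Tm} : IsValue v → IsValue (.conjI v)
  | allI {v : Tm} : IsValue v → IsValue (.allI v)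
  | exI {v : Tm} : IsValue v → IsValue (.exI v)

def upRen (f : ℕ → ℕ) : ℕ → ℕ
  | 0 => 0
  | n + 1 => f n + 1

def Tm.rename (f : ℕ → ℕ) : Tm → Tm
  | .var x => .var (f x)
  | .res c => .res c
  | .lit n => .lit n
  | .api1 g e => .api1 g (e.rename f)
  | .api2 g e₁ e₂ => .api2 g (e₁.rename f) (e₂.rename f)
  | .lam e => .lam (e.rename (upRen f))
  | .app e₁ e₂ => .app (e₁.rename f) (e₂.rename f)
  | .unit => .unit
  | .pair e₁ e₂ => .pair (e₁.rename f) (e₂.rename f)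
  | .fst e => .fst (e.rename f)
  | .snd e => .snd (e.rename f)
  | .letPair e₁ e₂ => .letPair (e₁.rename f) (e₂.rename (upRen (upRen f)))
  | .guardI e => .guardI (e.rename f)
  | .guardE e => .guardE (e.rename f)
  | .conjI e => .conjI (e.rename f)
  | .letConj e₁ e₂ => .letConj (e₁.rename f) (e₂.rename (upRen f))
  | .allI e => .allI (e.rename f)
  | .allE e => .allE (e.rename f)
  | .exI e => .exI (e.rename f)
  | .letEx e₁ e₂ => .letEx (e₁.rename f) (e₂.rename (upRen f))

def upSub (f : ℕ → Tm) : ℕ → Tm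
  | 0 => .var 0
  | n + 1 => (f n).rename Nat.succ

def Tm.subst (f : ℕ → Tm) : Tm → Tm
  | .var x => f x
  | .res c => .res c
  | .lit n => .lit n
  | .api1 g e => .api1 g (e.subst f)
  | .api2 g e₁ e₂ => .api2 g (e₁.subst f) (e₂.subst f)
  | .lam e => .lam (e.subst (upSub f))
  | .app e₁ e₂ => .app (e₁.subst f) (e₂.subst f)
  | .unit => .unit
  | .pair e₁ e₂ => .pair (e₁.subst f) (e₂.subst f)
  | .fst e => .fst (e.subst f)
  | .snd e => .snd (e.subst f)
  | .letPair e₁ e₂ => .letPair (e₁.subst f) (e₂.subst (upSub (upSub f)))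
  | .guardI e => .guardI (e.subst f)
  | .guardE e => .guardE (e.subst f)
  | .conjI e => .conjI (e.subst f)
  | .letConj e₁ e₂ => .letConj (e₁.subst f) (e₂.subst (upSub f))
  | .allI e => .allI (e.subst f)
  | .allE e => .allE (e.subst f)
  | .exI e => .exI (e.subst f)
  | .letEx e₁ e₂ => .letEx (e₁.subst f) (e₂.subst (upSub f))

def sub1 (v : Tm) : ℕ → Tm
  | 0 => v
  | n + 1 => .var n

def sub2 (v₁ v₂ : Tm) : ℕ → Tm
  | 0 => v₁
  | 1 => v₂
  | n + 2 => .var n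

/-- `e[x ↦ v]`. -/
def Tm.inst1 (e v : Tm) : Tm := e.subst (sub1 v)

/-- `e[x₁ ↦ v₁, x₂ ↦ v₂]`. -/
def Tm.inst2 (e v₁ v₂ : Tm) : Tm := e.subst (sub2 v₁ v₂)

/-- The multiset `ρ(e)` of resources in a term. -/
def Tm.resources : Tm → Multiset Endpoint
  | .var _ => 0
  | .res c => {c}
  | .lit _ => 0
  | .api1 _ e => e.resources
  | .api2 _ e₁ e₂ => e₁.resources + e₂.resources
  | .lam e => e.resources
  | .app e₁ e₂ => e₁.resources + e₂.resources
  | .unit => 0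
  | .pair e₁ e₂ => e₁.resources + e₂.resources
  | .fst e => e.resources
  | .snd e => e.resources
  | .letPair e₁ e₂ => e₁.resources + e₂.resources
  | .guardI e => e.resources
  | .guardE e => e.resources
  | .conjI e => e.resources
  | .letConj e₁ e₂ => e₁.resources + e₂.resources
  | .allI e => e.resources
  | .allE e => e.resources
  | .exI e => e.resources
  | .letEx e₁ e₂ => e₁.resources + e₂.resources

/-- Renaming of channels, `[c₁, c₂ ↦ c, c]`. -/
def Endpoint.renameCh (c₁ c₂ c : ℕ) (x : Endpoint) : Endpoint :=
  ⟨if x.ch = c₁ ∨ x.ch = c₂ then c else x.ch, x.roles⟩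

def Tm.renameCh (c₁ c₂ c : ℕ) : Tm → Tm
  | .var x => .var x
  | .res x => .res (x.renameCh c₁ c₂ c)
  | .lit n => .lit n
  | .api1 g e => .api1 g (e.renameCh c₁ c₂ c)
  | .api2 g e₁ e₂ => .api2 g (e₁.renameCh c₁ c₂ c) (e₂.renameCh c₁ c₂ c)
  | .lam e => .lam (e.renameCh c₁ c₂ c)
  | .app e₁ e₂ => .app (e₁.renameCh c₁ c₂ c) (e₂.renameCh c₁ c₂ c)
  | .unit => .unit
  | .pair e₁ e₂ => .pair (e₁.renameCh c₁ c₂ c) (e₂.renameCh c₁ c₂ c)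
  | .fst e => .fst (e.renameCh c₁ c₂ c)
  | .snd e => .snd (e.renameCh c₁ c₂ c)
  | .letPair e₁ e₂ => .letPair (e₁.renameCh c₁ c₂ c) (e₂.renameCh c₁ c₂ c)
  | .guardI e => .guardI (e.renameCh c₁ c₂ c)
  | .guardE e => .guardE (e.renameCh c₁ c₂ c)
  | .conjI e => .conjI (e.renameCh c₁ c₂ c)
  | .letConj e₁ e₂ => .letConj (e₁.renameCh c₁ c₂ c) (e₂.renameCh c₁ c₂ c)
  | .allI e => .allI (e.renameCh c₁ c₂ c)
  | .allE e => .allE (e.renameCh c₁ c₂ c)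
  | .exI e => .exI (e.renameCh c₁ c₂ c)
  | .letEx e₁ e₂ => .letEx (e₁.renameCh c₁ c₂ c) (e₂.renameCh c₁ c₂ c)

/-! ### Consistency of resources -/

/-- The role sets in `S` form a partition of the full set `U` (empty role sets are allowed). -/
def RolePartition (U : Set ℤ) (S : Multiset (Set ℤ)) : Prop :=
  S.Pairwise Disjoint ∧ {r : ℤ | ∃ R ∈ S, r ∈ R} = U

/-- Consistency of a multiset of resources. -/
inductive Consistent (U : Set ℤ) : Multiset Endpoint → Prop
  | empty : Consistent U 0
  | add {M : Multiset Endpoint} (c : ℕ) (S : Multiset (Set ℤ)) :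
      Consistent U M → (∀ x ∈ M, x.ch ≠ c) → RolePartition U S →
        Consistent U (M + S.map (Endpoint.mk c))

/-! ### Typing -/

/-- An entry of a typing context. A context lists all term variables in scope; it represents the
pair `Γ; Δ`: `un` marks the variables of `Γ`, `li` those of `Δ`, and `used` a linear variable in
scope that is not in `Δ` because it has been given to another subterm. -/
inductive Entry (D : List Srt)
  | un (t : STm D .type)
  | li (A : STm D .vtype)
  | used

abbrev Ctx (D : List Srt) : Type := List (Entry D)

def Entry.wk {D : List Srt} (a : Srt) : Entry D → Entry (a :: D)
  | .un t => .un (t.wk a)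
  | .li A => .li (A.wk a)
  | .used => .used

/-- The entry declares a variable of type `A`: in `Γ` if `A` is non-linear, or in `Δ`. -/
inductive Entry.Binds {D : List Srt} : Entry D → STm D .vtype → Prop
  | un (t : STm D .type) : Entry.Binds (.un t) (.lin t)
  | li (A : STm D .vtype) : Entry.Binds (.li A) A

def Entry.IsLinear {D : List Srt} : Entry D → Prop
  | .li _ => True
  | _ => False

/-- `Δ` is empty. -/
def NoLinear {D : List Srt} (G : Ctx D) : Prop := ∀ h ∈ G, ¬ h.IsLinear

/-- `Split G G₁ G₂`: `Γ` is shared and `Δ` is the disjoint union of `Δ₁` and `Δ₂`. -/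
inductive Split {D : List Srt} : Ctx D → Ctx D → Ctx D → Prop
  | nil : Split [] [] []
  | un {G G₁ G₂ : Ctx D} (t : STm D .type) :
      Split G G₁ G₂ → Split (.un t :: G) (.un t :: G₁) (.un t :: G₂)
  | used {G G₁ G₂ : Ctx D} : Split G G₁ G₂ → Split (.used :: G) (.used :: G₁) (.used :: G₂)
  | left {G G₁ G₂ : Ctx D} (A : STm D .vtype) :
      Split G G₁ G₂ → Split (.li A :: G) (.li A :: G₁) (.used :: G₂)
  | right {G G₁ G₂ : Ctx D} (A : STm D .vtype) :
      Split G G₁ G₂ → Split (.li A :: G) (.used :: G₁) (.li A :: G₂)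

/-- A signature records the global session type of each channel. -/
abbrev Sig : Type := ℕ → Option (STm [] .stype)

/-- `1`, the unit type as a linear type. -/
abbrev STm.one {D : List Srt} : STm D .vtype := .lin .unit

/-- The proposition `rs₁ ∩ rs₂ = ∅`. -/
def STm.disj {D : List Srt} (s t : STm D .set) : STm D .bool :=
  .eqSet (.inter s t) (.setLit ∅)

/-- The proposition that the union of `rs₁` and `rs₂` is the full set `U`. -/
def STm.cover {D : List Srt} (U : Set ℤ) (s t : STm D .set) : STm D .bool :=
  .eqSet (.union s t) (.setLit U)

/-- The proposition `r ∉ rs` for a role `r`, that is, `r` is in the complement of `rs` with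
respect to the full set `U`. -/
def STm.notMem {D : List Srt} (U : Set ℤ) (r : STm D .int) (s : STm D .set) : STm D .bool :=
  .mem r (.diff (.setLit U) s)

/-- The body `chan(rs, f(a))` of the type returned by `unify` and `exify`. -/
def STm.chanAt {D : List Srt} {a : Srt} (s : STm D .set) (f : STm D (.arr a .stype)) :
    STm (a :: D) .vtype :=
  .chan (s.wk a) (.app (f.wk a) (.var .z))

/-- Typing `Σ; P; Γ; Δ ⊢ e : A` for the full set of roles `U` and the signature `S`. -/
inductive HasType (U : Set ℤ) (S : Sig) :
    {D : List Srt} → List (STm D .bool) → Ctx D → Tm → STm D .vtype → Prop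
  | conv {D : List Srt} {P : List (STm D .bool)} {G : Ctx D} {e : Tm} {A B : STm D .vtype} :
      HasType U S P G e A → Conv P A B → HasType U S P G e B
  | varUn {D : List Srt} {P : List (STm D .bool)} {G : Ctx D} {x : ℕ} {t : STm D .type} :
      G[x]? = some (.un t) → NoLinear G → HasType U S P G (.var x) (.lin t)
  | varLi {D : List Srt} {P : List (STm D .bool)} {G : Ctx D} {x : ℕ} {A : STm D .vtype} :
      G[x]? = some (.li A) → NoLinear (G.set x .used) → HasType U S P G (.var x) A
  | res {D : List Srt} {P : List (STm D .bool)} {G : Ctx D} {c : ℕ} {R : Set ℤ}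
      {p : STm [] .stype} :
      S c = some p → NoLinear G →
        HasType U S P G (.ep c R) (.chan (.setLit R) p.ofClosed)
  | lit {D : List Srt} {P : List (STm D .bool)} {G : Ctx D} (n : ℤ) :
      NoLinear G → HasType U S P G (.lit n) (.lin (.intT (.intLit n)))
  | unit {D : List Srt} {P : List (STm D .bool)} {G : Ctx D} :
      NoLinear G → HasType U S P G .unit .one
  -- functions; a non-linear function captures neither linear variables nor resources
  | lamLi {D : List Srt} {P : List (STm D .bool)} {G : Ctx D} {h : Entry D} {e : Tm}
      {A B : STm D .vtype} :
      h.Binds A → HasType U S P (h :: G) e B → HasType U S P G (.lam e) (.lolli A B)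
  | lamUn {D : List Srt} {P : List (STm D .bool)} {G : Ctx D} {h : Entry D} {e : Tm}
      {A B : STm D .vtype} :
      h.Binds A → NoLinear G → e.resources = 0 → HasType U S P (h :: G) e B →
        HasType U S P G (.lam e) (.lin (.fn A B))
  | appLi {D : List Srt} {P : List (STm D .bool)} {G G₁ G₂ : Ctx D} {e₁ e₂ : Tm}
      {A B : STm D .vtype} :
      Split G G₁ G₂ → HasType U S P G₁ e₁ (.lolli A B) → HasType U S P G₂ e₂ A →
        HasType U S P G (.app e₁ e₂) B
  | appUn {D : List Srt} {P : List (STm D .bool)} {G G₁ G₂ : Ctx D} {e₁ e₂ : Tm}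
      {A B : STm D .vtype} :
      Split G G₁ G₂ → HasType U S P G₁ e₁ (.lin (.fn A B)) → HasType U S P G₂ e₂ A →
        HasType U S P G (.app e₁ e₂) B
  -- pairs
  | pairLi {D : List Srt} {P : List (STm D .bool)} {G G₁ G₂ : Ctx D} {e₁ e₂ : Tm}
      {A B : STm D .vtype} :
      Split G G₁ G₂ → HasType U S P G₁ e₁ A → HasType U S P G₂ e₂ B →
        HasType U S P G (.pair e₁ e₂) (.tensor A B)
  | pairUn {D : List Srt} {P : List (STm D .bool)} {G G₁ G₂ : Ctx D} {e₁ e₂ : Tm}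
      {t₁ t₂ : STm D .type} :
      Split G G₁ G₂ → HasType U S P G₁ e₁ (.lin t₁) → HasType U S P G₂ e₂ (.lin t₂) →
        HasType U S P G (.pair e₁ e₂) (.lin (.prod t₁ t₂))
  | fst {D : List Srt} {P : List (STm D .bool)} {G : Ctx D} {e : Tm} {t₁ t₂ : STm D .type} :
      HasType U S P G e (.lin (.prod t₁ t₂)) → HasType U S P G (.fst e) (.lin t₁)
  | snd {D : List Srt} {P : List (STm D .bool)} {G : Ctx D} {e : Tm} {t₁ t₂ : STm D .type} :
      HasType U S P G e (.lin (.prod t₁ t₂)) → HasType U S P G (.snd e) (.lin t₂)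
  | letPair {D : List Srt} {P : List (STm D .bool)} {G G₁ G₂ : Ctx D} {h₁ h₂ : Entry D}
      {e₁ e₂ : Tm} {A₁ A₂ B : STm D .vtype} :
      Split G G₁ G₂ → HasType U S P G₁ e₁ (.tensor A₁ A₂) → h₁.Binds A₁ → h₂.Binds A₂ →
        HasType U S P (h₁ :: h₂ :: G₂) e₂ B → HasType U S P G (.letPair e₁ e₂) B
  -- guarded types `p ⊃ A` and asserting types `p ∧ A`
  | guardI {D : List Srt} {P : List (STm D .bool)} {G : Ctx D} {v : Tm} {p : STm D .bool}
      {A : STm D .vtype} :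
      IsValue v → HasType U S (p :: P) G v A → HasType U S P G (.guardI v) (.guard p A)
  | guardE {D : List Srt} {P : List (STm D .bool)} {G : Ctx D} {e : Tm} {p : STm D .bool}
      {A : STm D .vtype} :
      HasType U S P G e (.guard p A) → Entails P p → HasType U S P G (.guardE e) A
  | conjI {D : List Srt} {P : List (STm D .bool)} {G : Ctx D} {e : Tm} {p : STm D .bool}
      {A : STm D .vtype} :
      HasType U S P G e A → Entails P p → HasType U S P G (.conjI e) (.conj p A)
  | letConj {D : List Srt} {P : List (STm D .bool)} {G G₁ G₂ : Ctx D} {h : Entry D}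
      {e₁ e₂ : Tm} {p : STm D .bool} {A B : STm D .vtype} :
      Split G G₁ G₂ → HasType U S P G₁ e₁ (.conj p A) → h.Binds A →
        HasType U S (p :: P) (h :: G₂) e₂ B → HasType U S P G (.letConj e₁ e₂) B
  -- static quantifiers
  | allI {D : List Srt} {P : List (STm D .bool)} {G : Ctx D} {v : Tm} {a : Srt}
      {A : STm (a :: D) .vtype} :
      IsValue v → HasType U S (P.map (STm.wk a)) (G.map (Entry.wk a)) v A →
        HasType U S P G (.allI v) (.all A)
  | allE {D : List Srt} {P : List (STm D .bool)} {G : Ctx D} {e : Tm} {a : Srt}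
      {A : STm (a :: D) .vtype} (s : STm D a) :
      HasType U S P G e (.all A) → HasType U S P G (.allE e) (A.inst s)
  | exI {D : List Srt} {P : List (STm D .bool)} {G : Ctx D} {e : Tm} {a : Srt}
      {A : STm (a :: D) .vtype} (s : STm D a) :
      HasType U S P G e (A.inst s) → HasType U S P G (.exI e) (.ex A)
  | letEx {D : List Srt} {P : List (STm D .bool)} {G G₁ G₂ : Ctx D} {e₁ e₂ : Tm} {a : Srt}
      {h : Entry (a :: D)} {A : STm (a :: D) .vtype} {B : STm D .vtype} :
      Split G G₁ G₂ → HasType U S P G₁ e₁ (.ex A) → h.Binds A →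
        HasType U S (P.map (STm.wk a)) (h :: G₂.map (Entry.wk a)) e₂ (B.wk a) →
          HasType U S P G (.letEx e₁ e₂) B
  -- integer arithmetic; division requires a non-zero divisor
  | arith {D : List Srt} {P : List (STm D .bool)} {G G₁ G₂ : Ctx D} {e₁ e₂ : Tm}
      {s t : STm D .int} (o : IntOp) :
      Split G G₁ G₂ → HasType U S P G₁ e₁ (.lin (.intT s)) →
        HasType U S P G₂ e₂ (.lin (.intT t)) →
        (o = .div → Entails P (.not (.eqInt t (.intLit 0)))) →
          HasType U S P G (.api2 (.arith o) e₁ e₂) (.lin (.intT (.arith o s t)))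
  -- thread creation and session APIs
  | spawn {D : List Srt} {P : List (STm D .bool)} {G : Ctx D} {e : Tm} :
      HasType U S P G e (.lolli .one .one) → HasType U S P G (.api1 .spawn e) .one
  | fork {D : List Srt} {P : List (STm D .bool)} {G : Ctx D} {e : Tm} {s₁ s₂ : STm D .set}
      {p : STm D .stype} :
      Entails P (.and (.disj s₁ s₂) (.cover U s₁ s₂)) →
        HasType U S P G e (.lolli (.chan s₁ p) .one) →
          HasType U S P G (.api1 .fork e) (.chan s₂ p)
  | cut {D : List Srt} {P : List (STm D .bool)} {G G₁ G₂ : Ctx D} {e₁ e₂ : Tm}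
      {s₁ s₂ : STm D .set} {p : STm D .stype} :
      Split G G₁ G₂ → Entails P (.cover U s₁ s₂) →
        HasType U S P G₁ e₁ (.chan s₁ p) → HasType U S P G₂ e₂ (.chan s₂ p) →
          HasType U S P G (.api2 .cut e₁ e₂) (.chan (.inter s₁ s₂) p)
  | elim {D : List Srt} {P : List (STm D .bool)} {G : Ctx D} {e : Tm} {p : STm D .stype} :
      HasType U S P G e (.chan (.setLit ∅) p) → HasType U S P G (.api1 .elim e) .one
  | split {D : List Srt} {P : List (STm D .bool)} {G G₁ G₂ : Ctx D} {e₁ e₂ : Tm}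
      {s₁ s₂ : STm D .set} {p : STm D .stype} :
      Split G G₁ G₂ → Entails P (.disj s₁ s₂) →
        HasType U S P G₁ e₁ (.chan (.union s₁ s₂) p) →
        HasType U S P G₂ e₂ (.lolli (.chan s₁ p) .one) →
          HasType U S P G (.api2 .split e₁ e₂) (.chan s₂ p)
  | bsend {D : List Srt} {P : List (STm D .bool)} {G G₁ G₂ : Ctx D} {e₁ e₂ : Tm}
      {s : STm D .set} {r : STm D .int} {p : STm D .stype} {t : STm D .type} :
      Split G G₁ G₂ → Entails P (.mem r s) →
        HasType U S P G₁ e₁ (.chan s (.bmsg r t p)) → HasType U S P G₂ e₂ (.lin t) →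
          HasType U S P G (.api2 .bsend e₁ e₂) (.chan s p)
  | brecv {D : List Srt} {P : List (STm D .bool)} {G : Ctx D} {e : Tm}
      {s : STm D .set} {r : STm D .int} {p : STm D .stype} {t : STm D .type} :
      Entails P (.notMem U r s) → HasType U S P G e (.chan s (.bmsg r t p)) →
        HasType U S P G (.api1 .brecv e) (.tensor (.chan s p) (.lin t))
  | send {D : List Srt} {P : List (STm D .bool)} {G G₁ G₂ : Ctx D} {e₁ e₂ : Tm}
      {s : STm D .set} {r₁ r₂ : STm D .int} {p : STm D .stype} {A : STm D .vtype} :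
      Split G G₁ G₂ → Entails P (.and (.mem r₁ s) (.notMem U r₂ s)) →
        HasType U S P G₁ e₁ (.chan s (.msg r₁ r₂ A p)) → HasType U S P G₂ e₂ A →
          HasType U S P G (.api2 .send e₁ e₂) (.chan s p)
  | recv {D : List Srt} {P : List (STm D .bool)} {G : Ctx D} {e : Tm}
      {s : STm D .set} {r₁ r₂ : STm D .int} {p : STm D .stype} {A : STm D .vtype} :
      Entails P (.and (.notMem U r₁ s) (.mem r₂ s)) →
        HasType U S P G e (.chan s (.msg r₁ r₂ A p)) →
          HasType U S P G (.api1 .recv e) (.tensor (.chan s p) A)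
  | skip {D : List Srt} {P : List (STm D .bool)} {G : Ctx D} {e : Tm}
      {s : STm D .set} {r₁ r₂ : STm D .int} {p : STm D .stype} {A : STm D .vtype} :
      Entails P (.or (.and (.mem r₁ s) (.mem r₂ s))
          (.and (.notMem U r₁ s) (.notMem U r₂ s))) →
        HasType U S P G e (.chan s (.msg r₁ r₂ A p)) →
          HasType U S P G (.api1 .skip e) (.chan s p)
  | close {D : List Srt} {P : List (STm D .bool)} {G : Ctx D} {e : Tm}
      {s : STm D .set} {r : STm D .int} :
      Entails P (.mem r s) → HasType U S P G e (.chan s (.endS r)) →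
        HasType U S P G (.api1 .close e) .one
  | wait {D : List Srt} {P : List (STm D .bool)} {G : Ctx D} {e : Tm}
      {s : STm D .set} {r : STm D .int} :
      Entails P (.notMem U r s) → HasType U S P G e (.chan s (.endS r)) →
        HasType U S P G (.api1 .wait e) .one
  | unify {D : List Srt} {P : List (STm D .bool)} {G : Ctx D} {e : Tm}
      {s : STm D .set} {r : STm D .int} {a : Srt} {f : STm D (.arr a .stype)} :
      Entails P (.mem r s) → HasType U S P G e (.chan s (.quan r f)) →
        HasType U S P G (.api1 .unify e) (.all (.chanAt s f))
  | exify {D : List Srt} {P : List (STm D .bool)} {G : Ctx D} {e : Tm}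
      {s : STm D .set} {r : STm D .int} {a : Srt} {f : STm D (.arr a .stype)} :
      Entails P (.notMem U r s) → HasType U S P G e (.chan s (.quan r f)) →
        HasType U S P G (.api1 .exify e) (.ex (.chanAt s f))

/-! ### Term reduction -/

/-- Call-by-value, left-to-right evaluation contexts. -/
inductive ECtx
  | hole
  | api1 (f : Api1) (E : ECtx)
  | api2L (f : Api2) (E : ECtx) (e : Tm)
  | api2R (f : Api2) (v : Tm) (hv : IsValue v) (E : ECtx)
  | appL (E : ECtx) (e : Tm)
  | appR (v : Tm) (hv : IsValue v) (E : ECtx)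
  | pairL (E : ECtx) (e : Tm)
  | pairR (v : Tm) (hv : IsValue v) (E : ECtx)
  | fst (E : ECtx)
  | snd (E : ECtx)
  | letPair (E : ECtx) (e : Tm)
  | guardE (E : ECtx)
  | conjI (E : ECtx)
  | letConj (E : ECtx) (e : Tm)
  | allE (E : ECtx)
  | exI (E : ECtx)
  | letEx (E : ECtx) (e : Tm)

/-- `E[e]`. -/
def ECtx.fill : ECtx → Tm → Tm
  | .hole, x => x
  | .api1 f E, x => .api1 f (E.fill x)
  | .api2L f E e, x => .api2 f (E.fill x) e
  | .api2R f v _ E, x => .api2 f v (E.fill x)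
  | .appL E e, x => .app (E.fill x) e
  | .appR v _ E, x => .app v (E.fill x)
  | .pairL E e, x => .pair (E.fill x) e
  | .pairR v _ E, x => .pair v (E.fill x)
  | .fst E, x => .fst (E.fill x)
  | .snd E, x => .snd (E.fill x)
  | .letPair E e, x => .letPair (E.fill x) e
  | .guardE E, x => .guardE (E.fill x)
  | .conjI E, x => .conjI (E.fill x)
  | .letConj E e, x => .letConj (E.fill x) e
  | .allE E, x => .allE (E.fill x)
  | .exI E, x => .exI (E.fill x)
  | .letEx E e, x => .letEx (E.fill x) e

/-- Contraction of pure redexes and of (total) ad-hoc redexes. -/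
inductive Contract : Tm → Tm → Prop
  | beta {e v : Tm} : IsValue v → Contract (.app (.lam e) v) (e.inst1 v)
  | letPair {v₁ v₂ e : Tm} : IsValue v₁ → IsValue v₂ →
      Contract (.letPair (.pair v₁ v₂) e) (e.inst2 v₁ v₂)
  | fst {v₁ v₂ : Tm} : IsValue v₁ → IsValue v₂ → Contract (.fst (.pair v₁ v₂)) v₁
  | snd {v₁ v₂ : Tm} : IsValue v₁ → IsValue v₂ → Contract (.snd (.pair v₁ v₂)) v₂
  | guard {v : Tm} : IsValue v → Contract (.guardE (.guardI v)) v
  | letConj {v e : Tm} : IsValue v → Contract (.letConj (.conjI v) e) (e.inst1 v)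
  | all {v : Tm} : IsValue v → Contract (.allE (.allI v)) v
  | letEx {v e : Tm} : IsValue v → Contract (.letEx (.exI v) e) (e.inst1 v)
  | arith {o : IntOp} {m n : ℤ} : (o = .div → n ≠ 0) →
      Contract (.api2 (.arith o) (.lit m) (.lit n)) (.lit (o.eval m n))

/-- Reduction of terms. -/
inductive Red : Tm → Tm → Prop
  | ctx (E : ECtx) {e e' : Tm} : Contract e e' → Red (E.fill e) (E.fill e')

/-! ### Pools -/

/-- A pool is a finite mapping from thread identifiers to terms. -/
@[ext] structure Pool where
  get : ℕ → Option Tm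
  dom : Finset ℕ
  mem_dom : ∀ t, t ∈ dom ↔ get t ≠ none

/-- The pool `Π, t:e`, or `Π` with the term of `t` replaced by `e`. -/
def Pool.set (Q : Pool) (t : ℕ) (e : Tm) : Pool where
  get := fun u => if u = t then some e else Q.get u
  dom := insert t Q.dom
  mem_dom := by
    intro u
    by_cases h : u = t
    · simp [h]
    · simp [h, Q.mem_dom]

/-- Removal of a thread. -/
def Pool.erase (Q : Pool) (t : ℕ) : Pool where
  get := fun u => if u = t then none else Q.get u
  dom := Q.dom.erase t
  mem_dom := by
    intro u
    by_cases h : u = t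
    · simp [h]
    · simp [h, Q.mem_dom]

/-- The empty pool. -/
def Pool.empty : Pool where
  get := fun _ => none
  dom := ∅
  mem_dom := by simp

/-- The singleton pool `t ↦ e`. -/
def Pool.single (t : ℕ) (e : Tm) : Pool := Pool.empty.set t e

/-- `Π[c₁, c₂ ↦ c, c]`. -/
def Pool.renameCh (Q : Pool) (c₁ c₂ c : ℕ) : Pool where
  get := fun u => (Q.get u).map (Tm.renameCh c₁ c₂ c)
  dom := Q.dom
  mem_dom := by
    intro u
    simp [Q.mem_dom]

/-- The multiset `ρ(Π)` of resources of a pool. -/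
def Pool.resources (Q : Pool) : Multiset Endpoint :=
  ∑ t ∈ Q.dom, ((Q.get t).elim 0 Tm.resources)

/-- The channel `c` does not occur in the pool. -/
def Pool.Fresh (Q : Pool) (c : ℕ) : Prop := ∀ x ∈ Q.resources, x.ch ≠ c

/-- All endpoints of the channel `c` in the pool. -/
def Pool.endpoints (Q : Pool) (c : ℕ) : Multiset Endpoint :=
  Q.resources.filter fun x => x.ch = c

/-- Typing of pools: the main thread has type `A`, all others have the unit type. -/
def PoolTyped (U : Set ℤ) (S : Sig) (Q : Pool) (A : STm [] .vtype) : Prop :=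
  (∃ e, Q.get 0 = some e ∧ HasType U S (D := []) [] [] e A) ∧
    ∀ t e, 0 < t → Q.get t = some e → HasType U S (D := []) [] [] e .one

/-! ### Pool reduction -/

/-- Simultaneous reduction of matching partial redexes: `endpoints(c) = {c^(R t) | t ∈ T}`, each
thread `t ∈ T` is of the form `E[a t]` and becomes `E[b t]`, the other threads do not change. -/
def Sync (Q Q' : Pool) (c : ℕ) (T : Finset ℕ) (R : ℕ → Set ℤ) (a b : ℕ → Tm) : Prop :=
  Q.endpoints c = T.val.map (fun t => Endpoint.mk c (R t)) ∧
    (∀ t ∈ T, ∃ E : ECtx, Q.get t = some (E.fill (a t)) ∧ Q'.get t = some (E.fill (b t))) ∧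
      ∀ t, t ∉ T → Q'.get t = Q.get t

/-- Pool reduction for the full set of roles `U`. -/
inductive Step (U : Set ℤ) : Pool → Pool → Prop
  | lift {Q : Pool} {t : ℕ} {e e' : Tm} :
      Q.get t = some e → Red e e' → Step U Q (Q.set t e')
  | gc {Q : Pool} {t : ℕ} : 0 < t → Q.get t = some .unit → Step U Q (Q.erase t)
  | spawn {Q : Pool} {t t' : ℕ} {E : ECtx} {e : Tm} :
      Q.get t = some (E.fill (.api1 .spawn (.lam e))) → t' ∉ Q.dom →
        Step U Q ((Q.set t (E.fill .unit)).set t' (e.inst1 .unit))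
  | fork {Q : Pool} {t t' : ℕ} {E : ECtx} {e : Tm} {c : ℕ} {R₁ R₂ : Set ℤ} :
      Q.get t = some (E.fill (.api1 .fork (.lam e))) → t' ∉ Q.dom → Q.Fresh c →
        Disjoint R₁ R₂ → R₁ ∪ R₂ = U →
          Step U Q ((Q.set t (E.fill (.ep c R₂))).set t' (e.inst1 (.ep c R₁)))
  | cut {Q : Pool} {t : ℕ} {E : ECtx} {c₁ c₂ c : ℕ} {R₁ R₂ : Set ℤ} :
      Q.get t = some (E.fill (.api2 .cut (.ep c₁ R₁) (.ep c₂ R₂))) → Q.Fresh c →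
        Step U Q ((Q.set t (E.fill (.ep c (R₁ ∩ R₂)))).renameCh c₁ c₂ c)
  | elim {Q : Pool} {t : ℕ} {E : ECtx} {c : ℕ} :
      Q.get t = some (E.fill (.api1 .elim (.ep c ∅))) → Step U Q (Q.set t (E.fill .unit))
  | split {Q : Pool} {t t' : ℕ} {E : ECtx} {e : Tm} {c : ℕ} {R₁ R₂ : Set ℤ} :
      Q.get t = some (E.fill (.api2 .split (.ep c (R₁ ∪ R₂)) (.lam e))) → t' ∉ Q.dom →
        Disjoint R₁ R₂ →
          Step U Q ((Q.set t (E.fill (.ep c R₂))).set t' (e.inst1 (.ep c R₁)))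
  | bmsg {Q Q' : Pool} {c : ℕ} {T : Finset ℕ} {R : ℕ → Set ℤ} {t₁ : ℕ} {v : Tm} :
      t₁ ∈ T → IsValue v →
        Sync Q Q' c T R
          (fun t => if t = t₁ then .api2 .bsend (.ep c (R t)) v else .api1 .brecv (.ep c (R t)))
          (fun t => if t = t₁ then .ep c (R t) else .pair (.ep c (R t)) v) →
        Step U Q Q'
  | endS {Q Q' : Pool} {c : ℕ} {T : Finset ℕ} {R : ℕ → Set ℤ} {t₁ : ℕ} :
      t₁ ∈ T →
        Sync Q Q' c T R
          (fun t => if t = t₁ then .api1 .close (.ep c (R t)) else .api1 .wait (.ep c (R t)))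
          (fun _ => .unit) →
        Step U Q Q'
  | quan {Q Q' : Pool} {c : ℕ} {T : Finset ℕ} {R : ℕ → Set ℤ} {t₁ : ℕ} :
      t₁ ∈ T →
        Sync Q Q' c T R
          (fun t => if t = t₁ then .api1 .unify (.ep c (R t)) else .api1 .exify (.ep c (R t)))
          (fun t => .ep c (R t)) →
        Step U Q Q'
  | msg {Q Q' : Pool} {c : ℕ} {T : Finset ℕ} {R : ℕ → Set ℤ} {t₁ t₂ : ℕ} {v : Tm} :
      t₁ ∈ T → t₂ ∈ T → t₁ ≠ t₂ → IsValue v →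
        Sync Q Q' c T R
          (fun t => if t = t₁ then .api2 .send (.ep c (R t)) v
            else if t = t₂ then .api1 .recv (.ep c (R t)) else .api1 .skip (.ep c (R t)))
          (fun t => if t = t₂ then .pair (.ep c (R t)) v else .ep c (R t)) →
        Step U Q Q'
  /-- The message has its sending and its receiving role in one and the same endpoint, so that
  every endpoint of the channel skips it. -/
  | skip {Q Q' : Pool} {c : ℕ} {T : Finset ℕ} {R : ℕ → Set ℤ} :
      T.Nonempty →
        Sync Q Q' c T R (fun t => .api1 .skip (.ep c (R t))) (fun t => .ep c (R t)) →
        Step U Q Q'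

/-- The pool equivalence `Π, t:E[cut(x, y)] ≡ Π, t:E[cut(y, x)]`. -/
inductive PoolEquiv : Pool → Pool → Prop
  | cut {Q : Pool} {t : ℕ} {E : ECtx} {v₁ v₂ : Tm} :
      IsValue v₁ → IsValue v₂ → Q.get t = some (E.fill (.api2 .cut v₁ v₂)) →
        PoolEquiv Q (Q.set t (E.fill (.api2 .cut v₂ v₁)))

/-- `Q` evaluates to `Q'` by pool reductions and pool equivalences. -/
def Evaluates (U : Set ℤ) : Pool → Pool → Prop :=
  Relation.ReflTransGen fun Q Q' => Step U Q Q' ∨ PoolEquiv Q Q'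

end MPST

namespace MPST

/-! Consider the bipartite multigraph whose vertices are the threads and the channels, with one edge
between a thread and a channel for every endpoint of the channel that occurs in the thread. It has
no edges in a pool without endpoints, and evaluation keeps it a forest. `fork` divides a thread in
two and joins the halves by a new channel; `split` does the same through a channel that the thread
already holds; `cut` contracts a path `c₁ – t – c₂`; `send` moves edges between two threads that are
adjacent to a common channel; `spawn` divides a thread without joining the halves; all other steps
at most delete edges. `Acyclic` expresses this by counting (every nonempty subgraph has fewer edges
than vertices), which makes each of these cases an arithmetical comparison of two subgraphs.

A forest cannot deadlock. Suppose that no step is possible. By progress of terms, every thread that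
is not a value is stopped at a call on some endpoint, and the threads that are values hold no
endpoints. If every channel waited on had a further endpoint on which nobody waits, the stopped
threads and these channels would span a graph with at least as many edges as vertices
(`Acyclic.exists_channel`). Hence all endpoints of some channel are waited on. By consistency their
role sets partition `U`, and all calls are typed by the same session type, so the owner of the
active role makes the active call, the others make the matching calls, and the channel synchronises
(`Step.of_waits`).

That the graph changes only in this way rests on linearity: a reduction must not duplicate
endpoints. `HasType` cannot be carried along an evaluation, because `fork` may choose any partition
of `U` and because the reducts of `unify` and `exify` are bare endpoints of quantified type. A
coarser typing `LType`, blind to indices and role sets, is preserved instead. Under it a value of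
non-linear type contains no endpoints (`LType.value_resources`), so that pure reduction preserves
the multiset of endpoints (`LType.contract`). This needs type constructors to be injective and
distinct up to conversion, which follows from confluence of a parallel reduction (`Par.diamond`).

In the final pool, by contrast, the exact role sets matter. There `HasType` is available by
hypothesis, and a model of the statics that records the outermost constructor of a type together
with its indices yields canonical forms (`HasType.valOf`). -/

/-! ### Renaming and substitution of static terms -/

theorem Ren.up_id {D : List Srt} (b : Srt) :
    Ren.up (fun _ x => x : Ren D D) b = fun _ x => x := by
  funext a x; cases x <;> rfl

theorem Ren.up_comp {D D' D'' : List Srt} (f : Ren D D') (g : Ren D' D'') (b : Srt) :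
    (fun a x => g.up b a (f.up b a x)) = Ren.up (fun a x => g a (f a x)) b := by
  funext a x; cases x <;> rfl

theorem STm.rename_id {D : List Srt} {a : Srt} (t : STm D a) :
    t.rename (fun _ x => x) = t := by
  induction t <;> simp only [*, STm.rename, Ren.up_id]

theorem STm.rename_rename {D : List Srt} {a : Srt} (t : STm D a) :
    ∀ {D' D'' : List Srt} (f : Ren D D') (g : Ren D' D''),
      (t.rename f).rename g = t.rename fun a x => g a (f a x) := by
  induction t <;> intros <;> simp only [*, STm.rename, Ren.up_comp]

theorem Sub.up_ren {D D' D'' : List Srt} (f : Ren D D') (g : Sub D' D'') (b : Srt) :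
    (fun a x => g.up b a (f.up b a x)) = Sub.up (fun a x => g a (f a x)) b := by
  funext a x; cases x <;> rfl

theorem STm.subst_rename {D : List Srt} {a : Srt} (t : STm D a) :
    ∀ {D' D'' : List Srt} (f : Ren D D') (g : Sub D' D''),
      (t.rename f).subst g = t.subst fun a x => g a (f a x) := by
  induction t <;> intros <;> simp only [*, STm.rename, STm.subst, Sub.up_ren]

theorem STm.wk_rename {D D' : List Srt} {a : Srt} (t : STm D a) (f : Ren D D') (b : Srt) :
    (t.wk b).rename (f.up b) = (t.rename f).wk b := by
  simp only [STm.wk, STm.rename_rename]; rfl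

theorem Sub.ren_up {D D' D'' : List Srt} (f : Sub D D') (g : Ren D' D'') (b : Srt) :
    (fun a x => (f.up b a x).rename (g.up b)) = Sub.up (fun a x => (f a x).rename g) b := by
  funext a x
  cases x with
  | z => rfl
  | s x => exact STm.wk_rename _ _ _

theorem STm.rename_subst {D : List Srt} {a : Srt} (t : STm D a) :
    ∀ {D' D'' : List Srt} (f : Sub D D') (g : Ren D' D''),
      (t.subst f).rename g = t.subst fun a x => (f a x).rename g := by
  induction t <;> intros <;> simp only [*, STm.rename, STm.subst, Sub.ren_up]

theorem STm.wk_subst {D D' : List Srt} {a : Srt} (t : STm D a) (f : Sub D D') (b : Srt) :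
    (t.wk b).subst (f.up b) = (t.subst f).wk b := by
  simp only [STm.wk, STm.rename_subst, STm.subst_rename]; rfl

theorem Sub.up_comp {D D' D'' : List Srt} (f : Sub D D') (g : Sub D' D'') (b : Srt) :
    (fun a x => (f.up b a x).subst (g.up b)) = Sub.up (fun a x => (f a x).subst g) b := by
  funext a x
  cases x with
  | z => rfl
  | s x => exact STm.wk_subst _ _ _

theorem STm.subst_subst {D : List Srt} {a : Srt} (t : STm D a) :
    ∀ {D' D'' : List Srt} (f : Sub D D') (g : Sub D' D''),
      (t.subst f).subst g = t.subst fun a x => (f a x).subst g := by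
  induction t <;> intros <;> simp only [*, STm.subst, Sub.up_comp]

theorem Sub.up_var {D : List Srt} (b : Srt) :
    Sub.up (fun _ x => .var x : Sub D D) b = fun _ x => .var x := by
  funext a x; cases x <;> rfl

theorem STm.subst_var {D : List Srt} {a : Srt} (t : STm D a) :
    t.subst (fun _ x => .var x) = t := by
  induction t <;> simp only [*, STm.subst, Sub.up_var]

theorem STm.wk_inst {D : List Srt} {a b : Srt} (t : STm D a) (s : STm D b) :
    (t.wk b).inst s = t := by
  simp only [STm.wk, STm.inst, STm.subst_rename]
  exact t.subst_var

theorem STm.inst_subst {D D' : List Srt} {a b : Srt} (t : STm (b :: D) a) (s : STm D b)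
    (f : Sub D D') : (t.inst s).subst f = (t.subst (f.up b)).inst (s.subst f) := by
  simp only [STm.inst, STm.subst_subst]
  congr 1
  funext a x
  cases x with
  | z => rfl
  | s x => exact ((f _ x).wk_inst _).symm

theorem STm.inst_rename {D D' : List Srt} {a b : Srt} (t : STm (b :: D) a) (s : STm D b)
    (f : Ren D D') : (t.inst s).rename f = (t.rename (f.up b)).inst (s.rename f) := by
  simp only [STm.inst, STm.rename_subst, STm.subst_rename]
  congr 1
  funext a x
  cases x <;> rfl

theorem STm.ofClosed_eq {D : List Srt} {a : Srt} (t : STm [] a) (f : Ren [] D) :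
    t.ofClosed = t.rename f := by
  rw [STm.ofClosed]
  congr 1; funext a x; cases x

theorem STm.ofClosed_subst {D D' : List Srt} {a : Srt} (t : STm [] a) (f : Sub D D') :
    (t.ofClosed).subst f = t.ofClosed := by
  rw [t.ofClosed_eq (fun _ x => nomatch x : Ren [] D), STm.subst_rename,
    t.ofClosed_eq (fun _ x => nomatch x : Ren [] D'), ← STm.subst_var (STm.rename _ t),
    STm.subst_rename]
  congr 1; funext a x; cases x

theorem STm.ofClosed_nil {a : Srt} (t : STm [] a) : t.ofClosed = t := by
  rw [t.ofClosed_eq fun _ x => x, t.rename_id]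

theorem STm.chanAt_subst {D D' : List Srt} {a : Srt} (s : STm D .set)
    (f : STm D (.arr a .stype)) (g : Sub D D') :
    (s.chanAt f).subst (g.up a) = (s.subst g).chanAt (f.subst g) := by
  simp only [STm.chanAt, STm.subst, STm.wk_subst]
  rfl

/-! ### Confluence of the statics -/

/-- Parallel reduction of static terms. All index terms of one sort are identified. -/
inductive Par : {D : List Srt} → {a : Srt} → STm D a → STm D a → Prop
  | var {D : List Srt} {a : Srt} (x : Var D a) : Par (.var x) (.var x)
  | lam {D : List Srt} {a b : Srt} {t t' : STm (a :: D) b} : Par t t' → Par (.lam t) (.lam t')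
  | app {D : List Srt} {a b : Srt} {t t' : STm D (.arr a b)} {u u' : STm D a} :
      Par t t' → Par u u' → Par (.app t u) (.app t' u')
  | beta {D : List Srt} {a b : Srt} {t t' : STm (a :: D) b} {u u' : STm D a} :
      Par t t' → Par u u' → Par (.app (.lam t) u) (t'.inst u')
  | endS {D : List Srt} {r r' : STm D .int} : Par (.endS r) (.endS r')
  | bmsg {D : List Srt} {r r' : STm D .int} {t t' : STm D .type} {p p' : STm D .stype} :
      Par t t' → Par p p' → Par (.bmsg r t p) (.bmsg r' t' p')
  | msg {D : List Srt} {r₁ r₁' r₂ r₂' : STm D .int} {t t' : STm D .vtype}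
      {p p' : STm D .stype} : Par t t' → Par p p' → Par (.msg r₁ r₂ t p) (.msg r₁' r₂' t' p')
  | quan {D : List Srt} {a : Srt} {r r' : STm D .int} {f f' : STm D (.arr a .stype)} :
      Par f f' → Par (.quan r f) (.quan r' f')
  | intT {D : List Srt} {s s' : STm D .int} : Par (.intT s) (.intT s')
  | unit {D : List Srt} : Par (.unit : STm D .type) .unit
  | prod {D : List Srt} {t t' u u' : STm D .type} :
      Par t t' → Par u u' → Par (.prod t u) (.prod t' u')
  | fn {D : List Srt} {t t' u u' : STm D .vtype} :
      Par t t' → Par u u' → Par (.fn t u) (.fn t' u')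
  | lin {D : List Srt} {t t' : STm D .type} : Par t t' → Par (.lin t) (.lin t')
  | chan {D : List Srt} {s s' : STm D .set} {p p' : STm D .stype} :
      Par p p' → Par (.chan s p) (.chan s' p')
  | tensor {D : List Srt} {t t' u u' : STm D .vtype} :
      Par t t' → Par u u' → Par (.tensor t u) (.tensor t' u')
  | lolli {D : List Srt} {t t' u u' : STm D .vtype} :
      Par t t' → Par u u' → Par (.lolli t u) (.lolli t' u')
  | guard {D : List Srt} {k : Knd} {p p' : STm D .bool} {t t' : STm D (.ty k)} :
      Par t t' → Par (.guard p t) (.guard p' t')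
  | conj {D : List Srt} {k : Knd} {p p' : STm D .bool} {t t' : STm D (.ty k)} :
      Par t t' → Par (.conj p t) (.conj p' t')
  | all {D : List Srt} {k : Knd} {a : Srt} {t t' : STm (a :: D) (.ty k)} :
      Par t t' → Par (.all t) (.all t')
  | ex {D : List Srt} {k : Knd} {a : Srt} {t t' : STm (a :: D) (.ty k)} :
      Par t t' → Par (.ex t) (.ex t')
  | linGuard {D : List Srt} {p p' : STm D .bool} {t t' : STm D .type} :
      Par t t' → Par (.lin (.guard p t)) (.guard p' (.lin t'))
  | linConj {D : List Srt} {p p' : STm D .bool} {t t' : STm D .type} :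
      Par t t' → Par (.lin (.conj p t)) (.conj p' (.lin t'))
  | linAll {D : List Srt} {a : Srt} {t t' : STm (a :: D) .type} :
      Par t t' → Par (.lin (.all t)) (.all (.lin t'))
  | linEx {D : List Srt} {a : Srt} {t t' : STm (a :: D) .type} :
      Par t t' → Par (.lin (.ex t)) (.ex (.lin t'))
  | idx {D : List Srt} {a : Srt} {t u : STm D a} : a.IsIndex → Par t u

@[simp] theorem Par.refl {D : List Srt} {a : Srt} (t : STm D a) : Par t t := by
  induction t <;> first
    | exact .idx .int
    | exact .idx .bool
    | exact .idx .set
    | constructor <;> assumption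

theorem Par.rename {D : List Srt} {a : Srt} {t t' : STm D a} (h : Par t t') :
    ∀ {D' : List Srt} (f : Ren D D'), Par (t.rename f) (t'.rename f) := by
  induction h <;> intro D' f
  case beta ih₁ ih₂ =>
    rw [STm.inst_rename]
    exact .beta (ih₁ _) (ih₂ _)
  all_goals first
    | (apply Par.idx; assumption)
    | (constructor <;> solve_by_elim)

theorem Par.subst {D : List Srt} {a : Srt} {t t' : STm D a} (h : Par t t') :
    ∀ {D' : List Srt} {f f' : Sub D D'}, (∀ a x, Par (f a x) (f' a x)) →
      Par (t.subst f) (t'.subst f') := by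
  have up : ∀ {D D' : List Srt} {f f' : Sub D D'} (b : Srt), (∀ a x, Par (f a x) (f' a x)) →
      ∀ a x, Par (f.up b a x) (f'.up b a x) := by
    intro D D' f f' b hf a x
    cases x with
    | z => exact .var _
    | s x => exact (hf _ x).rename _
  induction h <;> intro D' f f' hf
  case beta ih₁ ih₂ =>
    rw [STm.inst_subst]
    exact .beta (ih₁ (up _ hf)) (ih₂ hf)
  case var x => exact hf _ x
  all_goals first
    | (apply Par.idx; assumption)
    | (constructor <;> rename_i ih <;> first | exact ih hf | exact ih (up _ hf))
    | (constructor <;> rename_i ih₁ ih₂ <;> first | exact ih₁ hf | exact ih₂ hf)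

theorem Par.inst {D : List Srt} {a b : Srt} {t t' : STm (b :: D) a} {s s' : STm D b}
    (h : Par t t') (hs : Par s s') : Par (t.inst s) (t'.inst s') := by
  refine h.subst fun a x => ?_
  cases x with
  | z => exact hs
  | s x => exact .var x


/-- Local confluence of parallel reduction. -/
theorem Par.diamond {D : List Srt} {a : Srt} {t u : STm D a} (h : Par t u) :
    ∀ {u' : STm D a}, Par t u' → ∃ w, Par u w ∧ Par u' w := by
  induction h with
  -- At an index sort any two terms reduce to each other, so the second reduct closes the diagram.
  | idx hi => exact fun {u'} _ => ⟨u', .idx hi, .refl _⟩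
  | var x =>
    intro u' h'
    cases h' with
    | idx hi => exact ⟨_, .idx hi, .refl _⟩
    | var => exact ⟨_, .refl _, .refl _⟩
  | app h₁ h₂ ih₁ ih₂ =>
    intro u' h'
    cases h' with
    | idx hi => exact ⟨_, .idx hi, .refl _⟩
    | app k₁ k₂ =>
      obtain ⟨w₁, a₁, b₁⟩ := ih₁ k₁
      obtain ⟨w₂, a₂, b₂⟩ := ih₂ k₂
      exact ⟨_, .app a₁ a₂, .app b₁ b₂⟩
    | beta k₁ k₂ =>
      -- The induction hypothesis is about the whole abstraction. An abstraction reduces only to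
      -- abstractions, so inverting both sides gives reductions of the bodies.
      obtain ⟨w₁, a₁, b₁⟩ := ih₁ (.lam k₁)
      obtain ⟨w₂, a₂, b₂⟩ := ih₂ k₂
      cases b₁ with
      | idx hi => cases hi
      | lam b₁ =>
        cases h₁ with
        | idx hi => cases hi
        | lam h₁ =>
          cases a₁ with
          | idx hi => cases hi
          | lam a₁ => exact ⟨_, .beta a₁ a₂, b₁.inst b₂⟩
  | beta h₁ h₂ ih₁ ih₂ =>
    intro u' h'
    cases h' with
    | idx hi => exact ⟨_, .idx hi, .refl _⟩
    | app k₁ k₂ =>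
      cases k₁ with
      | idx hi => cases hi
      | lam k₁ =>
        obtain ⟨w₁, a₁, b₁⟩ := ih₁ k₁
        obtain ⟨w₂, a₂, b₂⟩ := ih₂ k₂
        exact ⟨_, a₁.inst a₂, .beta b₁ b₂⟩
    | beta k₁ k₂ =>
      obtain ⟨w₁, a₁, b₁⟩ := ih₁ k₁
      obtain ⟨w₂, a₂, b₂⟩ := ih₂ k₂
      exact ⟨_, a₁.inst a₂, b₁.inst b₂⟩
  | lin h₁ ih₁ =>
    intro u' h'
    cases h' with
    | idx hi => cases hi
    | lin k₁ =>
      obtain ⟨w₁, a₁, b₁⟩ := ih₁ k₁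
      exact ⟨_, .lin a₁, .lin b₁⟩
    | linGuard k₁ =>
      -- The proposition `.tt` is an arbitrary choice, as reduction leaves index arguments
      -- unconstrained. The same holds for the literals chosen as index arguments below.
      obtain ⟨w₁, a₁, b₁⟩ := ih₁ (.guard (p' := .tt) k₁)
      cases h₁ with
      | idx hi => cases hi
      | guard h₁ =>
        cases a₁ with
        | idx hi => cases hi
        | guard a₁ =>
          cases b₁ with
          | idx hi => cases hi
          | guard b₁ => exact ⟨.guard .tt _, .linGuard a₁, .guard (.lin b₁)⟩
    | linConj k₁ =>
      obtain ⟨w₁, a₁, b₁⟩ := ih₁ (.conj (p' := .tt) k₁)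
      cases h₁ with
      | idx hi => cases hi
      | conj h₁ =>
        cases a₁ with
        | idx hi => cases hi
        | conj a₁ =>
          cases b₁ with
          | idx hi => cases hi
          | conj b₁ => exact ⟨.conj .tt _, .linConj a₁, .conj (.lin b₁)⟩
    | linAll k₁ =>
      obtain ⟨w₁, a₁, b₁⟩ := ih₁ (.all k₁)
      cases h₁ with
      | idx hi => cases hi
      | all h₁ =>
        cases a₁ with
        | idx hi => cases hi
        | all a₁ =>
          cases b₁ with
          | idx hi => cases hi
          | all b₁ => exact ⟨_, .linAll a₁, .all (.lin b₁)⟩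
    | linEx k₁ =>
      obtain ⟨w₁, a₁, b₁⟩ := ih₁ (.ex k₁)
      cases h₁ with
      | idx hi => cases hi
      | ex h₁ =>
        cases a₁ with
        | idx hi => cases hi
        | ex a₁ =>
          cases b₁ with
          | idx hi => cases hi
          | ex b₁ => exact ⟨_, .linEx a₁, .ex (.lin b₁)⟩
  | linGuard h₁ ih₁ =>
    intro u' h'
    cases h' with
    | idx hi => cases hi
    | lin k₁ =>
      cases k₁ with
      | idx hi => cases hi
      | guard k₁ =>
        obtain ⟨w₁, a₁, b₁⟩ := ih₁ k₁
        exact ⟨.guard .tt _, .guard (.lin a₁), .linGuard b₁⟩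
    | linGuard k₁ =>
      obtain ⟨w₁, a₁, b₁⟩ := ih₁ k₁
      exact ⟨.guard .tt _, .guard (.lin a₁), .guard (.lin b₁)⟩
  | linConj h₁ ih₁ =>
    intro u' h'
    cases h' with
    | idx hi => cases hi
    | lin k₁ =>
      cases k₁ with
      | idx hi => cases hi
      | conj k₁ =>
        obtain ⟨w₁, a₁, b₁⟩ := ih₁ k₁
        exact ⟨.conj .tt _, .conj (.lin a₁), .linConj b₁⟩
    | linConj k₁ =>
      obtain ⟨w₁, a₁, b₁⟩ := ih₁ k₁
      exact ⟨.conj .tt _, .conj (.lin a₁), .conj (.lin b₁)⟩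
  | linAll h₁ ih₁ =>
    intro u' h'
    cases h' with
    | idx hi => cases hi
    | lin k₁ =>
      cases k₁ with
      | idx hi => cases hi
      | all k₁ =>
        obtain ⟨w₁, a₁, b₁⟩ := ih₁ k₁
        exact ⟨_, .all (.lin a₁), .linAll b₁⟩
    | linAll k₁ =>
      obtain ⟨w₁, a₁, b₁⟩ := ih₁ k₁
      exact ⟨_, .all (.lin a₁), .all (.lin b₁)⟩
  | linEx h₁ ih₁ =>
    intro u' h'
    cases h' with
    | idx hi => cases hi
    | lin k₁ =>
      cases k₁ with
      | idx hi => cases hi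
      | ex k₁ =>
        obtain ⟨w₁, a₁, b₁⟩ := ih₁ k₁
        exact ⟨_, .ex (.lin a₁), .linEx b₁⟩
    | linEx k₁ =>
      obtain ⟨w₁, a₁, b₁⟩ := ih₁ k₁
      exact ⟨_, .ex (.lin a₁), .ex (.lin b₁)⟩
  | endS => intro u' h'; cases h' with
    | idx hi => cases hi
    | endS => exact ⟨_, .refl _, .endS⟩
  | intT => intro u' h'; cases h' with
    | idx hi => cases hi
    | intT => exact ⟨_, .refl _, .intT⟩
  | unit => intro u' h'; cases h' with
    | idx hi => cases hi
    | unit => exact ⟨_, .refl _, .unit⟩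
  | bmsg h₁ h₂ ih₁ ih₂ => intro u' h'; cases h' with
    | idx hi => cases hi
    | bmsg k₁ k₂ =>
      obtain ⟨w₁, a₁, b₁⟩ := ih₁ k₁
      obtain ⟨w₂, a₂, b₂⟩ := ih₂ k₂
      exact ⟨.bmsg (.intLit 0) _ _, .bmsg a₁ a₂, .bmsg b₁ b₂⟩
  | msg h₁ h₂ ih₁ ih₂ => intro u' h'; cases h' with
    | idx hi => cases hi
    | msg k₁ k₂ =>
      obtain ⟨w₁, a₁, b₁⟩ := ih₁ k₁
      obtain ⟨w₂, a₂, b₂⟩ := ih₂ k₂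
      exact ⟨.msg (.intLit 0) (.intLit 0) _ _, .msg a₁ a₂, .msg b₁ b₂⟩
  | prod h₁ h₂ ih₁ ih₂ => intro u' h'; cases h' with
    | idx hi => cases hi
    | prod k₁ k₂ =>
      obtain ⟨w₁, a₁, b₁⟩ := ih₁ k₁
      obtain ⟨w₂, a₂, b₂⟩ := ih₂ k₂
      exact ⟨_, .prod a₁ a₂, .prod b₁ b₂⟩
  | fn h₁ h₂ ih₁ ih₂ => intro u' h'; cases h' with
    | idx hi => cases hi
    | fn k₁ k₂ =>
      obtain ⟨w₁, a₁, b₁⟩ := ih₁ k₁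
      obtain ⟨w₂, a₂, b₂⟩ := ih₂ k₂
      exact ⟨_, .fn a₁ a₂, .fn b₁ b₂⟩
  | tensor h₁ h₂ ih₁ ih₂ => intro u' h'; cases h' with
    | idx hi => cases hi
    | tensor k₁ k₂ =>
      obtain ⟨w₁, a₁, b₁⟩ := ih₁ k₁
      obtain ⟨w₂, a₂, b₂⟩ := ih₂ k₂
      exact ⟨_, .tensor a₁ a₂, .tensor b₁ b₂⟩
  | lolli h₁ h₂ ih₁ ih₂ => intro u' h'; cases h' with
    | idx hi => cases hi
    | lolli k₁ k₂ =>
      obtain ⟨w₁, a₁, b₁⟩ := ih₁ k₁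
      obtain ⟨w₂, a₂, b₂⟩ := ih₂ k₂
      exact ⟨_, .lolli a₁ a₂, .lolli b₁ b₂⟩
  | quan h₁ ih₁ => intro u' h'; cases h' with
    | idx hi => cases hi
    | quan k₁ =>
      obtain ⟨w₁, a₁, b₁⟩ := ih₁ k₁
      exact ⟨.quan (.intLit 0) _, .quan a₁, .quan b₁⟩
  | chan h₁ ih₁ => intro u' h'; cases h' with
    | idx hi => cases hi
    | chan k₁ =>
      obtain ⟨w₁, a₁, b₁⟩ := ih₁ k₁
      exact ⟨.chan (.setLit ∅) _, .chan a₁, .chan b₁⟩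
  | guard h₁ ih₁ => intro u' h'; cases h' with
    | idx hi => cases hi
    | guard k₁ =>
      obtain ⟨w₁, a₁, b₁⟩ := ih₁ k₁
      exact ⟨.guard .tt _, .guard a₁, .guard b₁⟩
  | conj h₁ ih₁ => intro u' h'; cases h' with
    | idx hi => cases hi
    | conj k₁ =>
      obtain ⟨w₁, a₁, b₁⟩ := ih₁ k₁
      exact ⟨.conj .tt _, .conj a₁, .conj b₁⟩
  | all h₁ ih₁ => intro u' h'; cases h' with
    | idx hi => cases hi
    | all k₁ =>
      obtain ⟨w₁, a₁, b₁⟩ := ih₁ k₁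
      exact ⟨_, .all a₁, .all b₁⟩
  | ex h₁ ih₁ => intro u' h'; cases h' with
    | idx hi => cases hi
    | ex k₁ =>
      obtain ⟨w₁, a₁, b₁⟩ := ih₁ k₁
      exact ⟨_, .ex a₁, .ex b₁⟩
  | lam h₁ ih₁ => intro u' h'; cases h' with
    | idx hi => cases hi
    | lam k₁ =>
      obtain ⟨w₁, a₁, b₁⟩ := ih₁ k₁
      exact ⟨_, .lam a₁, .lam b₁⟩

/-! ### Conversion as joinability -/

/-- Reflexive transitive closure of parallel reduction. -/
abbrev Pars {D : List Srt} {a : Srt} : STm D a → STm D a → Prop := Relation.ReflTransGen Par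

/-- Convertibility of static terms: having a common reduct. -/
def Cv {D : List Srt} {a : Srt} (t u : STm D a) : Prop := ∃ w, Pars t w ∧ Pars u w

theorem Cv.equivalence {D : List Srt} {a : Srt} : Equivalence (Cv (D := D) (a := a)) :=
  Relation.equivalence_join_reflTransGen fun _ _ _ h h' =>
    let ⟨w, k, k'⟩ := Par.diamond h h'
    ⟨w, .single k, .single k'⟩

theorem Cv.refl {D : List Srt} {a : Srt} (t : STm D a) : Cv t t := Cv.equivalence.refl t

theorem Cv.symm {D : List Srt} {a : Srt} {t u : STm D a} (h : Cv t u) : Cv u t :=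
  Cv.equivalence.symm h

theorem Cv.trans {D : List Srt} {a : Srt} {t u v : STm D a} (h : Cv t u) (h' : Cv u v) :
    Cv t v := Cv.equivalence.trans h h'

theorem Par.cv {D : List Srt} {a : Srt} {t u : STm D a} (h : Par t u) : Cv t u :=
  ⟨u, .single h, .refl⟩

theorem Cv.map {D D' : List Srt} {a b : Srt} {F : STm D a → STm D' b}
    (hF : ∀ {t t'}, Par t t' → Par (F t) (F t')) {t t' : STm D a} (h : Cv t t') :
    Cv (F t) (F t') :=
  let ⟨w, h, h'⟩ := h
  ⟨F w, h.lift F fun _ _ => hF, h'.lift F fun _ _ => hF⟩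

theorem Cv.map₂ {D D₁ D₂ : List Srt} {a b c : Srt} {F : STm D₁ a → STm D₂ b → STm D c}
    (hF : ∀ {t t' u u'}, Par t t' → Par u u' → Par (F t u) (F t' u')) {t t' : STm D₁ a}
    {u u' : STm D₂ b} (h : Cv t t') (h' : Cv u u') : Cv (F t u) (F t' u') :=
  (h.map (F := (F · u)) fun k => hF k (.refl _)).trans
    (h'.map (F := (F t' ·)) fun k => hF (.refl _) k)

theorem Cv.subst {D D' : List Srt} {a : Srt} {t t' : STm D a} (h : Cv t t') (f : Sub D D') :
    Cv (t.subst f) (t'.subst f) :=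
  h.map fun k => k.subst fun _ _ => .refl _

theorem Cv.rename {D D' : List Srt} {a : Srt} {t t' : STm D a} (h : Cv t t') (f : Ren D D') :
    Cv (t.rename f) (t'.rename f) :=
  h.map fun k => k.rename f

theorem Cv.ofClosed {D : List Srt} {a : Srt} {t t' : STm [] a} (h : Cv t t') :
    Cv (t.ofClosed : STm D a) t'.ofClosed :=
  h.rename _

theorem Cv.inst {D : List Srt} {a b : Srt} {t t' : STm (b :: D) a} (h : Cv t t')
    (s : STm D b) : Cv (t.inst s) (t'.inst s) :=
  h.subst _

/-- `Conv` has symmetry and transitivity as rules and cannot be inverted directly; joinability can.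
The hypotheses `P` disappear because they only serve to compare indices, and these are all
identified here. -/
theorem Conv.cv {D : List Srt} {P : List (STm D .bool)} {a : Srt} {t u : STm D a}
    (h : Conv P t u) : Cv t u := by
  induction h with
  | refl => exact .refl _
  | symm _ ih => exact ih.symm
  | trans _ _ ih ih' => exact ih.trans ih'
  | beta t s => exact (Par.beta (.refl _) (.refl _)).cv
  | index hi => exact (Par.idx hi).cv
  | linGuard => exact (Par.linGuard (.refl _)).cv
  | linConj => exact (Par.linConj (.refl _)).cv
  | linAll => exact (Par.linAll (.refl _)).cv
  | linEx => exact (Par.linEx (.refl _)).cv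
  | lam _ ih => exact ih.map .lam
  | app _ _ ih ih' => exact ih.map₂ .app ih'
  | endS => exact Par.endS.cv
  | bmsg _ _ _ _ ih ih' =>
    exact (Par.bmsg (.refl _) (.refl _)).cv.trans (ih.map₂ .bmsg ih')
  | msg _ _ _ _ _ _ ih ih' =>
    exact (Par.msg (.refl _) (.refl _)).cv.trans (ih.map₂ .msg ih')
  | quan _ _ _ ih => exact (Par.quan (.refl _)).cv.trans (ih.map .quan)
  | intT => exact Par.intT.cv
  | prod _ _ ih ih' => exact ih.map₂ .prod ih'
  | fn _ _ ih ih' => exact ih.map₂ .fn ih'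
  | lin _ ih => exact ih.map .lin
  | chan _ _ _ ih => exact (Par.chan (.refl _)).cv.trans (ih.map .chan)
  | tensor _ _ ih ih' => exact ih.map₂ .tensor ih'
  | lolli _ _ ih ih' => exact ih.map₂ .lolli ih'
  | guard _ _ _ ih => exact (Par.guard (.refl _)).cv.trans (ih.map .guard)
  | conj _ _ _ ih => exact (Par.conj (.refl _)).cv.trans (ih.map .conj)
  | all _ ih => exact ih.map .all
  | ex _ ih => exact ih.map .ex

/-! ### Injectivity of the type constructors -/

/-- No reduction rule has a redex at a constructor of this kind, so the head survives and only the
arguments move. The inversions below hold for the same reason; joined at a common reduct they give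
injectivity up to conversion. -/
theorem Pars.lolli_inv {D : List Srt} {t u : STm D .vtype} {w : STm D (.vtype)}
    (h : Pars (.lolli t u) w) :
    ∃ t' u', w = .lolli t' u' ∧ Pars t t' ∧ Pars u u' := by
  induction h with
  | refl => exact ⟨_, _, rfl, .refl, .refl⟩
  | tail _ h ih =>
    obtain ⟨_, _, rfl, h0, h1⟩ := ih
    cases h with
    | idx hi => cases hi
    | lolli k0 k1 => exact ⟨_, _, rfl, h0.tail k0, h1.tail k1⟩

theorem Pars.tensor_inv {D : List Srt} {t u : STm D .vtype} {w : STm D (.vtype)}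
    (h : Pars (.tensor t u) w) :
    ∃ t' u', w = .tensor t' u' ∧ Pars t t' ∧ Pars u u' := by
  induction h with
  | refl => exact ⟨_, _, rfl, .refl, .refl⟩
  | tail _ h ih =>
    obtain ⟨_, _, rfl, h0, h1⟩ := ih
    cases h with
    | idx hi => cases hi
    | tensor k0 k1 => exact ⟨_, _, rfl, h0.tail k0, h1.tail k1⟩

/-- `lin` is permuted only with `guard`, `conj`, `all` and `ex`; above `fn` and `prod` it stays in
place. -/
theorem Pars.fn_inv {D : List Srt} {t u : STm D .vtype} {w : STm D (.vtype)}
    (h : Pars (.lin (.fn t u)) w) :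
    ∃ t' u', w = .lin (.fn t' u') ∧ Pars t t' ∧ Pars u u' := by
  induction h with
  | refl => exact ⟨_, _, rfl, .refl, .refl⟩
  | tail _ h ih =>
    obtain ⟨_, _, rfl, h0, h1⟩ := ih
    cases h with
    | idx hi => cases hi
    | lin h =>
      cases h with
      | idx hi => cases hi
      | fn k0 k1 => exact ⟨_, _, rfl, h0.tail k0, h1.tail k1⟩

theorem Pars.prod_inv {D : List Srt} {t u : STm D .type} {w : STm D (.vtype)}
    (h : Pars (.lin (.prod t u)) w) :
    ∃ t' u', w = .lin (.prod t' u') ∧ Pars t t' ∧ Pars u u' := by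
  induction h with
  | refl => exact ⟨_, _, rfl, .refl, .refl⟩
  | tail _ h ih =>
    obtain ⟨_, _, rfl, h0, h1⟩ := ih
    cases h with
    | idx hi => cases hi
    | lin h =>
      cases h with
      | idx hi => cases hi
      | prod k0 k1 => exact ⟨_, _, rfl, h0.tail k0, h1.tail k1⟩

theorem Pars.chan_inv {D : List Srt} {s : STm D .set} {p : STm D .stype} {w : STm D (.vtype)}
    (h : Pars (.chan s p) w) :
    ∃ s' p', w = .chan s' p' ∧ Pars p p' := by
  induction h with
  | refl => exact ⟨_, _, rfl, .refl⟩
  | tail _ h ih =>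
    obtain ⟨_, _, rfl, h0⟩ := ih
    cases h with
    | idx hi => cases hi
    | chan k0 => exact ⟨_, _, rfl, h0.tail k0⟩

theorem Pars.bmsg_inv {D : List Srt} {r : STm D .int} {t : STm D .type} {p : STm D .stype}
    {w : STm D (.stype)} (h : Pars (.bmsg r t p) w) :
    ∃ r' t' p', w = .bmsg r' t' p' ∧ Pars t t' ∧ Pars p p' := by
  induction h with
  | refl => exact ⟨_, _, _, rfl, .refl, .refl⟩
  | tail _ h ih =>
    obtain ⟨_, _, _, rfl, h0, h1⟩ := ih
    cases h with
    | idx hi => cases hi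
    | bmsg k0 k1 => exact ⟨_, _, _, rfl, h0.tail k0, h1.tail k1⟩

theorem Pars.msg_inv {D : List Srt} {r₁ r₂ : STm D .int} {t : STm D .vtype} {p : STm D .stype}
    {w : STm D (.stype)} (h : Pars (.msg r₁ r₂ t p) w) :
    ∃ r₁' r₂' t' p', w = .msg r₁' r₂' t' p' ∧ Pars t t' ∧ Pars p p' := by
  induction h with
  | refl => exact ⟨_, _, _, _, rfl, .refl, .refl⟩
  | tail _ h ih =>
    obtain ⟨_, _, _, _, rfl, h0, h1⟩ := ih
    cases h with
    | idx hi => cases hi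
    | msg k0 k1 => exact ⟨_, _, _, _, rfl, h0.tail k0, h1.tail k1⟩

theorem Pars.quan_inv {D : List Srt} {a : Srt} {r : STm D .int} {f : STm D (.arr a .stype)}
    {w : STm D (.stype)} (h : Pars (.quan r f) w) :
    ∃ r' f', w = .quan r' f' ∧ Pars f f' := by
  induction h with
  | refl => exact ⟨_, _, rfl, .refl⟩
  | tail _ h ih =>
    obtain ⟨_, _, rfl, h0⟩ := ih
    cases h with
    | idx hi => cases hi
    | quan k0 => exact ⟨_, _, rfl, h0.tail k0⟩

theorem Pars.guard_inv {D : List Srt} {k : Knd} {p : STm D .bool} {t : STm D (.ty k)}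
    {w : STm D (.ty k)} (h : Pars (.guard p t) w) :
    ∃ p' t', w = .guard p' t' ∧ Pars t t' := by
  induction h with
  | refl => exact ⟨_, _, rfl, .refl⟩
  | tail _ h ih =>
    obtain ⟨_, _, rfl, h0⟩ := ih
    cases h with
    | idx hi => cases hi
    | guard k0 => exact ⟨_, _, rfl, h0.tail k0⟩

theorem Pars.conj_inv {D : List Srt} {k : Knd} {p : STm D .bool} {t : STm D (.ty k)}
    {w : STm D (.ty k)} (h : Pars (.conj p t) w) :
    ∃ p' t', w = .conj p' t' ∧ Pars t t' := by
  induction h with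
  | refl => exact ⟨_, _, rfl, .refl⟩
  | tail _ h ih =>
    obtain ⟨_, _, rfl, h0⟩ := ih
    cases h with
    | idx hi => cases hi
    | conj k0 => exact ⟨_, _, rfl, h0.tail k0⟩

theorem Pars.all_inv {D : List Srt} {k : Knd} {a : Srt} {t : STm (a :: D) (.ty k)}
    {w : STm D (.ty k)} (h : Pars (.all t) w) :
    ∃ t', w = .all t' ∧ Pars t t' := by
  induction h with
  | refl => exact ⟨_, rfl, .refl⟩
  | tail _ h ih =>
    obtain ⟨_, rfl, h0⟩ := ih
    cases h with
    | idx hi => cases hi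
    | all k0 => exact ⟨_, rfl, h0.tail k0⟩

theorem Pars.ex_inv {D : List Srt} {k : Knd} {a : Srt} {t : STm (a :: D) (.ty k)}
    {w : STm D (.ty k)} (h : Pars (.ex t) w) :
    ∃ t', w = .ex t' ∧ Pars t t' := by
  induction h with
  | refl => exact ⟨_, rfl, .refl⟩
  | tail _ h ih =>
    obtain ⟨_, rfl, h0⟩ := ih
    cases h with
    | idx hi => cases hi
    | ex k0 => exact ⟨_, rfl, h0.tail k0⟩

theorem Cv.lolli_inv {D : List Srt} {t u t' u' : STm D .vtype} (h : Cv (.lolli t u) (.lolli t' u'))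
    :
    Cv t t' ∧ Cv u u' := by
  obtain ⟨w, h, h'⟩ := h
  obtain ⟨_, _, e, h0, h1⟩ := Pars.lolli_inv h
  obtain ⟨_, _, e', k0, k1⟩ := Pars.lolli_inv h'
  subst e
  cases e'
  exact ⟨⟨_, h0, k0⟩, ⟨_, h1, k1⟩⟩

theorem Cv.tensor_inv {D : List Srt} {t u t' u' : STm D .vtype}
    (h : Cv (.tensor t u) (.tensor t' u')) :
    Cv t t' ∧ Cv u u' := by
  obtain ⟨w, h, h'⟩ := h
  obtain ⟨_, _, e, h0, h1⟩ := Pars.tensor_inv h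
  obtain ⟨_, _, e', k0, k1⟩ := Pars.tensor_inv h'
  subst e
  cases e'
  exact ⟨⟨_, h0, k0⟩, ⟨_, h1, k1⟩⟩

theorem Cv.fn_inv {D : List Srt} {t u t' u' : STm D .vtype}
    (h : Cv (.lin (.fn t u)) (.lin (.fn t' u'))) :
    Cv t t' ∧ Cv u u' := by
  obtain ⟨w, h, h'⟩ := h
  obtain ⟨_, _, e, h0, h1⟩ := Pars.fn_inv h
  obtain ⟨_, _, e', k0, k1⟩ := Pars.fn_inv h'
  subst e
  cases e'
  exact ⟨⟨_, h0, k0⟩, ⟨_, h1, k1⟩⟩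

theorem Cv.prod_inv {D : List Srt} {t u t' u' : STm D .type}
    (h : Cv (.lin (.prod t u)) (.lin (.prod t' u'))) :
    Cv t t' ∧ Cv u u' := by
  obtain ⟨w, h, h'⟩ := h
  obtain ⟨_, _, e, h0, h1⟩ := Pars.prod_inv h
  obtain ⟨_, _, e', k0, k1⟩ := Pars.prod_inv h'
  subst e
  cases e'
  exact ⟨⟨_, h0, k0⟩, ⟨_, h1, k1⟩⟩

theorem Cv.chan_inv {D : List Srt} {s s' : STm D .set} {p p' : STm D .stype}
    (h : Cv (.chan s p) (.chan s' p')) :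
    Cv p p' := by
  obtain ⟨w, h, h'⟩ := h
  obtain ⟨_, _, e, h0⟩ := Pars.chan_inv h
  obtain ⟨_, _, e', k0⟩ := Pars.chan_inv h'
  subst e
  cases e'
  exact ⟨_, h0, k0⟩

theorem Cv.bmsg_inv {D : List Srt} {r r' : STm D .int} {t t' : STm D .type} {p p' : STm D .stype}
    (h : Cv (.bmsg r t p) (.bmsg r' t' p')) :
    Cv t t' ∧ Cv p p' := by
  obtain ⟨w, h, h'⟩ := h
  obtain ⟨_, _, _, e, h0, h1⟩ := Pars.bmsg_inv h
  obtain ⟨_, _, _, e', k0, k1⟩ := Pars.bmsg_inv h'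
  subst e
  cases e'
  exact ⟨⟨_, h0, k0⟩, ⟨_, h1, k1⟩⟩

theorem Cv.msg_inv {D : List Srt} {r₁ r₂ r₁' r₂' : STm D .int} {t t' : STm D .vtype}
    {p p' : STm D .stype} (h : Cv (.msg r₁ r₂ t p) (.msg r₁' r₂' t' p')) :
    Cv t t' ∧ Cv p p' := by
  obtain ⟨w, h, h'⟩ := h
  obtain ⟨_, _, _, _, e, h0, h1⟩ := Pars.msg_inv h
  obtain ⟨_, _, _, _, e', k0, k1⟩ := Pars.msg_inv h'
  subst e
  cases e'
  exact ⟨⟨_, h0, k0⟩, ⟨_, h1, k1⟩⟩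

theorem Cv.quan_inv {D : List Srt} {a : Srt} {r r' : STm D .int} {f f' : STm D (.arr a .stype)}
    (h : Cv (.quan r f) (.quan r' f')) :
    Cv f f' := by
  obtain ⟨w, h, h'⟩ := h
  obtain ⟨_, _, e, h0⟩ := Pars.quan_inv h
  obtain ⟨_, _, e', k0⟩ := Pars.quan_inv h'
  subst e
  cases e'
  exact ⟨_, h0, k0⟩

theorem Cv.guard_inv {D : List Srt} {k : Knd} {p p' : STm D .bool} {t t' : STm D (.ty k)}
    (h : Cv (.guard p t) (.guard p' t')) :
    Cv t t' := by
  obtain ⟨w, h, h'⟩ := h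
  obtain ⟨_, _, e, h0⟩ := Pars.guard_inv h
  obtain ⟨_, _, e', k0⟩ := Pars.guard_inv h'
  subst e
  cases e'
  exact ⟨_, h0, k0⟩

theorem Cv.conj_inv {D : List Srt} {k : Knd} {p p' : STm D .bool} {t t' : STm D (.ty k)}
    (h : Cv (.conj p t) (.conj p' t')) :
    Cv t t' := by
  obtain ⟨w, h, h'⟩ := h
  obtain ⟨_, _, e, h0⟩ := Pars.conj_inv h
  obtain ⟨_, _, e', k0⟩ := Pars.conj_inv h'
  subst e
  cases e'
  exact ⟨_, h0, k0⟩

/-! ### Distinctness of the type constructors -/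

/-- Heads of static terms, up to the identifications of types and linear types. -/
inductive Hd
  | neutral
  | endS
  | bmsg
  | msg
  | quan
  | intT
  | unit
  | prod
  | fn
  | chan
  | tensor
  | lolli
  | guard
  | conj
  | all
  | ex

def STm.hd : {D : List Srt} → {a : Srt} → STm D a → Hd
  | _, _, .endS _ => .endS
  | _, _, .bmsg _ _ _ => .bmsg
  | _, _, .msg _ _ _ _ => .msg
  | _, _, .quan _ _ => .quan
  | _, _, .intT _ => .intT
  | _, _, .unit => .unit
  | _, _, .prod _ _ => .prod
  | _, _, .fn _ _ => .fn
  | _, _, .lin t => t.hd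
  | _, _, .chan _ _ => .chan
  | _, _, .tensor _ _ => .tensor
  | _, _, .lolli _ _ => .lolli
  | _, _, .guard _ _ => .guard
  | _, _, .conj _ _ => .conj
  | _, _, .all _ => .all
  | _, _, .ex _ => .ex
  | _, _, _ => .neutral

theorem STm.hd_of_isIndex {D : List Srt} {a : Srt} (h : a.IsIndex) (t : STm D a) :
    t.hd = .neutral := by
  cases h <;> cases t <;> rfl

/-- `hd` looks through `lin`, so permuting `lin` with a connective leaves the head unchanged.
Redexes and index terms are neutral and are excluded by hypothesis. -/
theorem Par.hd {D : List Srt} {a : Srt} {t u : STm D a} (h : Par t u) (ht : t.hd ≠ .neutral) :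
    u.hd = t.hd := by
  induction h <;> simp_all [STm.hd, STm.hd_of_isIndex]

theorem Pars.hd {D : List Srt} {a : Srt} {t u : STm D a} (h : Pars t u)
    (ht : t.hd ≠ .neutral) : u.hd = t.hd := by
  induction h with
  | refl => rfl
  | tail _ h ih => rw [h.hd (ih ▸ ht), ih]

theorem Cv.hd {D : List Srt} {a : Srt} {t u : STm D a} (h : Cv t u) (ht : t.hd ≠ .neutral)
    (hu : u.hd ≠ .neutral) : t.hd = u.hd := by
  obtain ⟨w, h, h'⟩ := h
  rw [← h.hd ht, ← h'.hd hu]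

/-! ### Non-linear types up to conversion -/

/-- The linear types that are in effect non-linear. -/
inductive NonLin : {D : List Srt} → STm D .vtype → Prop
  | lin {D : List Srt} (t : STm D .type) : NonLin (.lin t)
  | guard {D : List Srt} {p : STm D .bool} {A : STm D .vtype} : NonLin A → NonLin (.guard p A)
  | conj {D : List Srt} {p : STm D .bool} {A : STm D .vtype} : NonLin A → NonLin (.conj p A)
  | all {D : List Srt} {a : Srt} {A : STm (a :: D) .vtype} : NonLin A → NonLin (.all A)
  | ex {D : List Srt} {a : Srt} {A : STm (a :: D) .vtype} : NonLin A → NonLin (.ex A)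

/-- Reduction may push `lin` below a connective but never removes it, and `NonLin` looks for it
below any number of connectives. -/
theorem NonLin.par {D : List Srt} {A : STm D .vtype} (h : NonLin A) :
    ∀ {B : STm D .vtype}, Par A B → NonLin B := by
  induction h with
  | lin t =>
    intro B k
    cases k with
    | idx hi => cases hi
    | lin k => exact .lin _
    | linGuard => exact .guard (.lin _)
    | linConj => exact .conj (.lin _)
    | linAll => exact .all (.lin _)
    | linEx => exact .ex (.lin _)
  | guard _ ih =>
    intro B k
    cases k with
    | idx hi => cases hi
    | guard k => exact .guard (ih k)
  | conj _ ih =>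
    intro B k
    cases k with
    | idx hi => cases hi
    | conj k => exact .conj (ih k)
  | all _ ih =>
    intro B k
    cases k with
    | idx hi => cases hi
    | all k => exact .all (ih k)
  | ex _ ih =>
    intro B k
    cases k with
    | idx hi => cases hi
    | ex k => exact .ex (ih k)

theorem NonLin.pars {D : List Srt} {A B : STm D .vtype} (h : NonLin A) (k : Pars A B) :
    NonLin B := by
  induction k with
  | refl => exact h
  | tail _ k ih => exact ih.par k

theorem NonLin.subst {D : List Srt} {A : STm D .vtype} (h : NonLin A) :
    ∀ {D' : List Srt} (f : Sub D D'), NonLin (A.subst f) := by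
  induction h with
  | lin t => exact fun f => .lin _
  | guard _ ih => exact fun f => .guard (ih f)
  | conj _ ih => exact fun f => .conj (ih f)
  | all _ ih => exact fun f => .all (ih _)
  | ex _ ih => exact fun f => .ex (ih _)

/-- The type is convertible to a non-linear one. -/
def Copyable {D : List Srt} (A : STm D .vtype) : Prop := ∃ B, NonLin B ∧ Pars A B

/-- By confluence the non-linear reduct of `A` and the type `B` have a common reduct, which is still
non-linear. -/
theorem Copyable.cv {D : List Srt} {A B : STm D .vtype} (h : Copyable A) (k : Cv A B) :
    Copyable B := by
  obtain ⟨A', h, l⟩ := h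
  obtain ⟨w, l₁, l₂⟩ := Cv.trans ⟨A', .refl, l⟩ k
  exact ⟨w, h.pars l₁, l₂⟩

theorem Copyable.lin {D : List Srt} (t : STm D .type) : Copyable (.lin t) :=
  ⟨_, .lin t, .refl⟩

theorem Copyable.not_lolli {D : List Srt} {A B : STm D .vtype} : ¬ Copyable (.lolli A B) := by
  rintro ⟨_, h, k⟩
  obtain ⟨_, _, rfl, _⟩ := k.lolli_inv
  cases h

theorem Copyable.not_tensor {D : List Srt} {A B : STm D .vtype} :
    ¬ Copyable (.tensor A B) := by
  rintro ⟨_, h, k⟩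
  obtain ⟨_, _, rfl, _⟩ := k.tensor_inv
  cases h

theorem Copyable.not_chan {D : List Srt} {s : STm D .set} {p : STm D .stype} :
    ¬ Copyable (.chan s p) := by
  rintro ⟨_, h, k⟩
  obtain ⟨_, _, rfl, _⟩ := k.chan_inv
  cases h

theorem Copyable.of_guard {D : List Srt} {p : STm D .bool} {A : STm D .vtype}
    (h : Copyable (.guard p A)) : Copyable A := by
  obtain ⟨_, h, k⟩ := h
  obtain ⟨_, _, rfl, l⟩ := k.guard_inv
  cases h with
  | guard h => exact ⟨_, h, l⟩

theorem Copyable.of_conj {D : List Srt} {p : STm D .bool} {A : STm D .vtype}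
    (h : Copyable (.conj p A)) : Copyable A := by
  obtain ⟨_, h, k⟩ := h
  obtain ⟨_, _, rfl, l⟩ := k.conj_inv
  cases h with
  | conj h => exact ⟨_, h, l⟩

theorem Copyable.of_all {D : List Srt} {a : Srt} {A : STm (a :: D) .vtype}
    (h : Copyable (.all A)) : Copyable A := by
  obtain ⟨_, h, k⟩ := h
  obtain ⟨_, rfl, l⟩ := k.all_inv
  cases h with
  | all h => exact ⟨_, h, l⟩

theorem Copyable.of_ex {D : List Srt} {a : Srt} {A : STm (a :: D) .vtype}
    (h : Copyable (.ex A)) : Copyable A := by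
  obtain ⟨_, h, k⟩ := h
  obtain ⟨_, rfl, l⟩ := k.ex_inv
  cases h with
  | ex h => exact ⟨_, h, l⟩

theorem Copyable.subst {D D' : List Srt} {A : STm D .vtype} (h : Copyable A) (f : Sub D D') :
    Copyable (A.subst f) := by
  obtain ⟨B, h, k⟩ := h
  exact ⟨_, h.subst f, k.lift _ fun _ _ k => k.subst fun _ _ => .refl _⟩

/-! ### Run-time typing

The role sets chosen by `fork` and `split` and the endpoints returned by `unify` and `exify` are
not those of the typing rules. The run-time typing forgets indices and role sets, and has a state
for the channels on which quantification has been performed; it is preserved by evaluation and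
suffices for linearity. -/

/-- State of a channel at run time: with a session type, or after a quantification. -/
inductive ChState
  | live (p : STm [] .stype)
  | quantified {a : Srt} (f : STm [] (.arr a .stype))

abbrev RSig : Type := ℕ → Option ChState

/-- The types of the endpoints of a channel. -/
inductive EpTy : Option ChState → {D : List Srt} → STm D .vtype → Prop
  | chan {p : STm [] .stype} {D : List Srt} {C : STm D .vtype} (s : STm D .set) :
      Cv (.chan s p.ofClosed) C → EpTy (some (.live p)) C
  | all {a : Srt} {f : STm [] (.arr a .stype)} {D : List Srt} {C : STm D .vtype}
      (s : STm D .set) : Cv (.all (s.chanAt f.ofClosed)) C → EpTy (some (.quantified f)) C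
  | ex {a : Srt} {f : STm [] (.arr a .stype)} {D : List Srt} {C : STm D .vtype}
      (s : STm D .set) : Cv (.ex (s.chanAt f.ofClosed)) C → EpTy (some (.quantified f)) C

/-- Argument and result types of unary constant functions, without role conditions. -/
inductive Api1Ty : {D : List Srt} → Api1 → STm D .vtype → STm D .vtype → Prop
  | spawn {D : List Srt} : Api1Ty (D := D) .spawn (.lolli .one .one) .one
  | fork {D : List Srt} {s s' : STm D .set} {p : STm D .stype} :
      Api1Ty .fork (.lolli (.chan s p) .one) (.chan s' p)
  | elim {D : List Srt} {s : STm D .set} {p : STm D .stype} : Api1Ty .elim (.chan s p) .one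
  | brecv {D : List Srt} {s : STm D .set} {r : STm D .int} {t : STm D .type}
      {p : STm D .stype} :
      Api1Ty .brecv (.chan s (.bmsg r t p)) (.tensor (.chan s p) (.lin t))
  | recv {D : List Srt} {s : STm D .set} {r₁ r₂ : STm D .int} {A : STm D .vtype}
      {p : STm D .stype} :
      Api1Ty .recv (.chan s (.msg r₁ r₂ A p)) (.tensor (.chan s p) A)
  | skip {D : List Srt} {s : STm D .set} {r₁ r₂ : STm D .int} {A : STm D .vtype}
      {p : STm D .stype} : Api1Ty .skip (.chan s (.msg r₁ r₂ A p)) (.chan s p)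
  | close {D : List Srt} {s : STm D .set} {r : STm D .int} :
      Api1Ty .close (.chan s (.endS r)) .one
  | wait {D : List Srt} {s : STm D .set} {r : STm D .int} :
      Api1Ty .wait (.chan s (.endS r)) .one
  | unify {D : List Srt} {s : STm D .set} {r : STm D .int} {a : Srt}
      {f : STm D (.arr a .stype)} : Api1Ty .unify (.chan s (.quan r f)) (.all (s.chanAt f))
  | exify {D : List Srt} {s : STm D .set} {r : STm D .int} {a : Srt}
      {f : STm D (.arr a .stype)} : Api1Ty .exify (.chan s (.quan r f)) (.ex (s.chanAt f))

/-- Argument and result types of binary constant functions, without role conditions. -/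
inductive Api2Ty : {D : List Srt} → Api2 → STm D .vtype → STm D .vtype → STm D .vtype → Prop
  | arith {D : List Srt} {o : IntOp} {s t u : STm D .int} :
      Api2Ty (.arith o) (.lin (.intT s)) (.lin (.intT t)) (.lin (.intT u))
  | cut {D : List Srt} {s s' s'' : STm D .set} {p : STm D .stype} :
      Api2Ty .cut (.chan s p) (.chan s' p) (.chan s'' p)
  | split {D : List Srt} {s s' s'' : STm D .set} {p : STm D .stype} :
      Api2Ty .split (.chan s p) (.lolli (.chan s' p) .one) (.chan s'' p)
  | bsend {D : List Srt} {s : STm D .set} {r : STm D .int} {t : STm D .type}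
      {p : STm D .stype} : Api2Ty .bsend (.chan s (.bmsg r t p)) (.lin t) (.chan s p)
  | send {D : List Srt} {s : STm D .set} {r₁ r₂ : STm D .int} {A : STm D .vtype}
      {p : STm D .stype} : Api2Ty .send (.chan s (.msg r₁ r₂ A p)) A (.chan s p)

/-- Run-time typing. Conversion is built into every rule. -/
inductive LType (S : RSig) : {D : List Srt} → Ctx D → Tm → STm D .vtype → Prop
  | varUn {D : List Srt} {G : Ctx D} {x : ℕ} {t : STm D .type} {C : STm D .vtype} :
      G[x]? = some (.un t) → NoLinear G → Cv (.lin t) C → LType S G (.var x) C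
  | varLi {D : List Srt} {G : Ctx D} {x : ℕ} {A C : STm D .vtype} :
      G[x]? = some (.li A) → NoLinear (G.set x .used) → Cv A C → LType S G (.var x) C
  | res {D : List Srt} {G : Ctx D} {x : Endpoint} {C : STm D .vtype} :
      NoLinear G → EpTy (S x.ch) C → LType S G (.res x) C
  | lit {D : List Srt} {G : Ctx D} {n : ℤ} {s : STm D .int} {C : STm D .vtype} :
      NoLinear G → Cv (.lin (.intT s)) C → LType S G (.lit n) C
  | unit {D : List Srt} {G : Ctx D} {C : STm D .vtype} :
      NoLinear G → Cv .one C → LType S G .unit C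
  | lamLi {D : List Srt} {G : Ctx D} {h : Entry D} {e : Tm} {A B C : STm D .vtype} :
      h.Binds A → LType S (h :: G) e B → Cv (.lolli A B) C → LType S G (.lam e) C
  | lamUn {D : List Srt} {G : Ctx D} {h : Entry D} {e : Tm} {A B C : STm D .vtype} :
      h.Binds A → NoLinear G → e.resources = 0 → LType S (h :: G) e B →
        Cv (.lin (.fn A B)) C → LType S G (.lam e) C
  | appLi {D : List Srt} {G G₁ G₂ : Ctx D} {e₁ e₂ : Tm} {A B C : STm D .vtype} :
      Split G G₁ G₂ → LType S G₁ e₁ (.lolli A B) → LType S G₂ e₂ A → Cv B C →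
        LType S G (.app e₁ e₂) C
  | appUn {D : List Srt} {G G₁ G₂ : Ctx D} {e₁ e₂ : Tm} {A B C : STm D .vtype} :
      Split G G₁ G₂ → LType S G₁ e₁ (.lin (.fn A B)) → LType S G₂ e₂ A → Cv B C →
        LType S G (.app e₁ e₂) C
  | pairLi {D : List Srt} {G G₁ G₂ : Ctx D} {e₁ e₂ : Tm} {A B C : STm D .vtype} :
      Split G G₁ G₂ → LType S G₁ e₁ A → LType S G₂ e₂ B → Cv (.tensor A B) C →
        LType S G (.pair e₁ e₂) C
  | pairUn {D : List Srt} {G G₁ G₂ : Ctx D} {e₁ e₂ : Tm} {t u : STm D .type}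
      {C : STm D .vtype} :
      Split G G₁ G₂ → LType S G₁ e₁ (.lin t) → LType S G₂ e₂ (.lin u) →
        Cv (.lin (.prod t u)) C → LType S G (.pair e₁ e₂) C
  | fst {D : List Srt} {G : Ctx D} {e : Tm} {t u : STm D .type} {C : STm D .vtype} :
      LType S G e (.lin (.prod t u)) → Cv (.lin t) C → LType S G (.fst e) C
  | snd {D : List Srt} {G : Ctx D} {e : Tm} {t u : STm D .type} {C : STm D .vtype} :
      LType S G e (.lin (.prod t u)) → Cv (.lin u) C → LType S G (.snd e) C
  | letPair {D : List Srt} {G G₁ G₂ : Ctx D} {h₁ h₂ : Entry D} {e₁ e₂ : Tm}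
      {A₁ A₂ B C : STm D .vtype} :
      Split G G₁ G₂ → LType S G₁ e₁ (.tensor A₁ A₂) → h₁.Binds A₁ → h₂.Binds A₂ →
        LType S (h₁ :: h₂ :: G₂) e₂ B → Cv B C → LType S G (.letPair e₁ e₂) C
  | guardI {D : List Srt} {G : Ctx D} {v : Tm} {p : STm D .bool} {A C : STm D .vtype} :
      LType S G v A → Cv (.guard p A) C → LType S G (.guardI v) C
  | guardE {D : List Srt} {G : Ctx D} {e : Tm} {p : STm D .bool} {A C : STm D .vtype} :
      LType S G e (.guard p A) → Cv A C → LType S G (.guardE e) C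
  | conjI {D : List Srt} {G : Ctx D} {e : Tm} {p : STm D .bool} {A C : STm D .vtype} :
      LType S G e A → Cv (.conj p A) C → LType S G (.conjI e) C
  | letConj {D : List Srt} {G G₁ G₂ : Ctx D} {h : Entry D} {e₁ e₂ : Tm} {p : STm D .bool}
      {A B C : STm D .vtype} :
      Split G G₁ G₂ → LType S G₁ e₁ (.conj p A) → h.Binds A → LType S (h :: G₂) e₂ B →
        Cv B C → LType S G (.letConj e₁ e₂) C
  | allI {D : List Srt} {G : Ctx D} {v : Tm} {a : Srt} {A : STm (a :: D) .vtype}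
      {C : STm D .vtype} :
      LType S (G.map (Entry.wk a)) v A → Cv (.all A) C → LType S G (.allI v) C
  | allE {D : List Srt} {G : Ctx D} {e : Tm} {a : Srt} {A : STm (a :: D) .vtype}
      {C : STm D .vtype} (s : STm D a) :
      LType S G e (.all A) → Cv (A.inst s) C → LType S G (.allE e) C
  | exI {D : List Srt} {G : Ctx D} {e : Tm} {a : Srt} {A : STm (a :: D) .vtype}
      {C : STm D .vtype} (s : STm D a) :
      LType S G e (A.inst s) → Cv (.ex A) C → LType S G (.exI e) C
  | letEx {D : List Srt} {G G₁ G₂ : Ctx D} {e₁ e₂ : Tm} {a : Srt} {h : Entry (a :: D)}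
      {A : STm (a :: D) .vtype} {B C : STm D .vtype} :
      Split G G₁ G₂ → LType S G₁ e₁ (.ex A) → h.Binds A →
        LType S (h :: G₂.map (Entry.wk a)) e₂ (B.wk a) → Cv B C →
          LType S G (.letEx e₁ e₂) C
  | api1 {D : List Srt} {G : Ctx D} {e : Tm} {f : Api1} {A B C : STm D .vtype} :
      Api1Ty f A B → LType S G e A → Cv B C → LType S G (.api1 f e) C
  | api2 {D : List Srt} {G G₁ G₂ : Ctx D} {e₁ e₂ : Tm} {f : Api2}
      {A₁ A₂ B C : STm D .vtype} :
      Api2Ty f A₁ A₂ B → Split G G₁ G₂ → LType S G₁ e₁ A₁ → LType S G₂ e₂ A₂ → Cv B C →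
        LType S G (.api2 f e₁ e₂) C

theorem EpTy.conv {s : Option ChState} {D : List Srt} {A B : STm D .vtype} (h : EpTy s A)
    (k : Cv A B) : EpTy s B := by
  cases h with
  | chan s h => exact .chan s (h.trans k)
  | all s h => exact .all s (h.trans k)
  | ex s h => exact .ex s (h.trans k)

theorem LType.conv {S : RSig} {D : List Srt} {G : Ctx D} {e : Tm} {A B : STm D .vtype}
    (h : LType S G e A) (k : Cv A B) : LType S G e B := by
  cases h with
  | res h₁ h₂ => exact .res h₁ (h₂.conv k)
  | varUn h₁ h₂ h => exact .varUn h₁ h₂ (h.trans k)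
  | varLi h₁ h₂ h => exact .varLi h₁ h₂ (h.trans k)
  | lit h₁ h => exact .lit h₁ (h.trans k)
  | unit h₁ h => exact .unit h₁ (h.trans k)
  | lamLi h₁ h₂ h => exact .lamLi h₁ h₂ (h.trans k)
  | lamUn h₁ h₂ h₃ h₄ h => exact .lamUn h₁ h₂ h₃ h₄ (h.trans k)
  | appLi h₁ h₂ h₃ h => exact .appLi h₁ h₂ h₃ (h.trans k)
  | appUn h₁ h₂ h₃ h => exact .appUn h₁ h₂ h₃ (h.trans k)
  | pairLi h₁ h₂ h₃ h => exact .pairLi h₁ h₂ h₃ (h.trans k)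
  | pairUn h₁ h₂ h₃ h => exact .pairUn h₁ h₂ h₃ (h.trans k)
  | fst h₁ h => exact .fst h₁ (h.trans k)
  | snd h₁ h => exact .snd h₁ (h.trans k)
  | letPair h₁ h₂ h₃ h₄ h₅ h => exact .letPair h₁ h₂ h₃ h₄ h₅ (h.trans k)
  | guardI h₁ h => exact .guardI h₁ (h.trans k)
  | guardE h₁ h => exact .guardE h₁ (h.trans k)
  | conjI h₁ h => exact .conjI h₁ (h.trans k)
  | letConj h₁ h₂ h₃ h₄ h => exact .letConj h₁ h₂ h₃ h₄ (h.trans k)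
  | allI h₁ h => exact .allI h₁ (h.trans k)
  | allE s h₁ h => exact .allE s h₁ (h.trans k)
  | exI s h₁ h => exact .exI s h₁ (h.trans k)
  | letEx h₁ h₂ h₃ h₄ h => exact .letEx h₁ h₂ h₃ h₄ (h.trans k)
  | api1 h₁ h₂ h => exact .api1 h₁ h₂ (h.trans k)
  | api2 h₁ h₂ h₃ h₄ h => exact .api2 h₁ h₂ h₃ h₄ (h.trans k)

/-- The run-time signature of a signature. -/
def Sig.run (S : Sig) : RSig := fun c => (S c).map .live

/-- The entry point of the run-time typing: it is applied to the initial pool, and from there on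
only `LType` is preserved. -/
theorem HasType.run {U : Set ℤ} {S : Sig} {D : List Srt} {P : List (STm D .bool)} {G : Ctx D}
    {e : Tm} {A : STm D .vtype} (h : HasType U S P G e A) : LType S.run G e A := by
  induction h with
  | conv _ k ih => exact ih.conv k.cv
  | varUn h₁ h₂ => exact .varUn h₁ h₂ (.refl _)
  | varLi h₁ h₂ => exact .varLi h₁ h₂ (.refl _)
  | res h₁ h₂ =>
    refine .res h₂ ?_
    simp only [Sig.run, h₁]
    exact .chan _ (.refl _)
  | lit _ h => exact .lit h (.refl _)
  | unit h => exact .unit h (.refl _)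
  | lamLi h₁ _ ih => exact .lamLi h₁ ih (.refl _)
  | lamUn h₁ h₂ h₃ _ ih => exact .lamUn h₁ h₂ h₃ ih (.refl _)
  | appLi h _ _ ih₁ ih₂ => exact .appLi h ih₁ ih₂ (.refl _)
  | appUn h _ _ ih₁ ih₂ => exact .appUn h ih₁ ih₂ (.refl _)
  | pairLi h _ _ ih₁ ih₂ => exact .pairLi h ih₁ ih₂ (.refl _)
  | pairUn h _ _ ih₁ ih₂ => exact .pairUn h ih₁ ih₂ (.refl _)
  | fst _ ih => exact .fst ih (.refl _)
  | snd _ ih => exact .snd ih (.refl _)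
  | letPair h _ h₁ h₂ _ ih₁ ih₂ => exact .letPair h ih₁ h₁ h₂ ih₂ (.refl _)
  | guardI _ _ ih => exact .guardI ih (.refl _)
  | guardE _ _ ih => exact .guardE ih (.refl _)
  | conjI _ _ ih => exact .conjI ih (.refl _)
  | letConj h _ h₁ _ ih₁ ih₂ => exact .letConj h ih₁ h₁ ih₂ (.refl _)
  | allI _ _ ih => exact .allI ih (.refl _)
  | allE s _ ih => exact .allE s ih (.refl _)
  | exI s _ ih => exact .exI s ih (.refl _)
  | letEx h _ h₁ _ ih₁ ih₂ => exact .letEx h ih₁ h₁ ih₂ (.refl _)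
  | arith o h _ _ _ ih₁ ih₂ => exact .api2 .arith h ih₁ ih₂ (.refl _)
  | spawn _ ih => exact .api1 .spawn ih (.refl _)
  | fork _ _ ih => exact .api1 .fork ih (.refl _)
  | cut h _ _ _ ih₁ ih₂ => exact .api2 .cut h ih₁ ih₂ (.refl _)
  | elim _ ih => exact .api1 .elim ih (.refl _)
  | split h _ _ _ ih₁ ih₂ => exact .api2 .split h ih₁ ih₂ (.refl _)
  | bsend h _ _ _ ih₁ ih₂ => exact .api2 .bsend h ih₁ ih₂ (.refl _)
  | brecv _ _ ih => exact .api1 .brecv ih (.refl _)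
  | send h _ _ _ ih₁ ih₂ => exact .api2 .send h ih₁ ih₂ (.refl _)
  | recv _ _ ih => exact .api1 .recv ih (.refl _)
  | skip _ _ ih => exact .api1 .skip ih (.refl _)
  | close _ _ ih => exact .api1 .close ih (.refl _)
  | wait _ _ ih => exact .api1 .wait ih (.refl _)
  | unify _ _ ih => exact .api1 .unify ih (.refl _)
  | exify _ _ ih => exact .api1 .exify ih (.refl _)

/-! #### Contexts -/

def Entry.subst {D D' : List Srt} (f : Sub D D') : Entry D → Entry D'
  | .un t => .un (t.subst f)
  | .li A => .li (A.subst f)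
  | .used => .used

theorem STm.rename_eq_subst {D D' : List Srt} {a : Srt} (t : STm D a) (f : Ren D D') :
    t.rename f = t.subst fun a x => .var (f a x) := by
  rw [← (t.rename f).subst_var, STm.subst_rename]

theorem Entry.wk_eq_subst {D : List Srt} (b : Srt) :
    (Entry.wk b : Entry D → _) = Entry.subst fun _ x => .var x.s := by
  funext h
  cases h <;> simp only [Entry.wk, Entry.subst, STm.wk, STm.rename_eq_subst]

theorem Entry.wk_subst {D D' : List Srt} (G : Ctx D) (f : Sub D D') (b : Srt) :
    (G.map (Entry.wk b)).map (Entry.subst (f.up b)) =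
      (G.map (Entry.subst f)).map (Entry.wk b) := by
  simp only [List.map_map]
  congr 1
  funext h
  cases h <;> simp only [Function.comp, Entry.wk, Entry.subst, STm.wk_subst]

theorem Entry.Binds.subst {D D' : List Srt} {h : Entry D} {A : STm D .vtype} (k : h.Binds A)
    (f : Sub D D') : (h.subst f).Binds (A.subst f) := by
  cases k with
  | un t => exact .un _
  | li A => exact .li _

@[simp] theorem noLinear_nil {D : List Srt} : NoLinear ([] : Ctx D) := by
  intro h hh; cases hh

@[simp] theorem noLinear_cons {D : List Srt} {h : Entry D} {G : Ctx D} :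
    NoLinear (h :: G) ↔ ¬ h.IsLinear ∧ NoLinear G := by
  simp [NoLinear]

theorem NoLinear.subst {D D' : List Srt} {G : Ctx D} (k : NoLinear G) (f : Sub D D') :
    NoLinear (G.map (Entry.subst f)) := by
  intro h hh
  obtain ⟨h, hG, rfl⟩ := List.mem_map.1 hh
  have := k h hG
  cases h <;> simp_all [Entry.subst, Entry.IsLinear]

theorem NoLinear.append {D : List Srt} {G G' : Ctx D} (h : NoLinear G) (h' : NoLinear G') :
    NoLinear (G ++ G') := by
  intro x hx
  rcases List.mem_append.1 hx with hx | hx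
  exacts [h x hx, h' x hx]

theorem Split.subst {D D' : List Srt} {G G₁ G₂ : Ctx D} (h : Split G G₁ G₂) (f : Sub D D') :
    Split (G.map (Entry.subst f)) (G₁.map (Entry.subst f)) (G₂.map (Entry.subst f)) := by
  induction h with
  | nil => exact .nil
  | un t _ ih => exact .un _ ih
  | used _ ih => exact .used ih
  | left A _ ih => exact .left _ ih
  | right A _ ih => exact .right _ ih

theorem Split.of_noLinear {D : List Srt} {G : Ctx D} (h : NoLinear G) : Split G G G := by
  induction G with
  | nil => exact .nil
  | cons k G ih =>
    rw [noLinear_cons] at h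
    cases k with
    | un t => exact .un t (ih h.2)
    | li A => exact (h.1 trivial).elim
    | used => exact .used (ih h.2)

theorem Split.append {D : List Srt} {G G₁ G₂ G' : Ctx D} (h : Split G G₁ G₂)
    (h' : NoLinear G') : Split (G ++ G') (G₁ ++ G') (G₂ ++ G') := by
  induction h with
  | nil => exact .of_noLinear h'
  | un t _ ih => exact .un _ ih
  | used _ ih => exact .used ih
  | left A _ ih => exact .left _ ih
  | right A _ ih => exact .right _ ih

theorem Split.length {D : List Srt} {G G₁ G₂ : Ctx D} (h : Split G G₁ G₂) :
    G₁.length = G.length ∧ G₂.length = G.length := by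
  induction h <;> simp_all

theorem Split.nil_inv {D : List Srt} {G₁ G₂ : Ctx D} (h : Split [] G₁ G₂) :
    G₁ = [] ∧ G₂ = [] := by
  cases h; exact ⟨rfl, rfl⟩

/-! #### Static substitution and weakening -/

theorem EpTy.subst {s : Option ChState} {D D' : List Srt} {A : STm D .vtype} (h : EpTy s A)
    (f : Sub D D') : EpTy s (A.subst f) := by
  cases h with
  | chan s h =>
    have := h.subst f
    simp only [STm.subst, STm.ofClosed_subst] at this
    exact .chan _ this
  | all s h =>
    have := h.subst f
    simp only [STm.subst, STm.chanAt_subst, STm.ofClosed_subst] at this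
    exact .all _ this
  | ex s h =>
    have := h.subst f
    simp only [STm.subst, STm.chanAt_subst, STm.ofClosed_subst] at this
    exact .ex _ this

theorem Api1Ty.subst {g : Api1} {D D' : List Srt} {A B : STm D .vtype} (h : Api1Ty g A B)
    (f : Sub D D') : Api1Ty g (A.subst f) (B.subst f) := by
  cases h <;> simp only [STm.subst, STm.chanAt_subst] <;> constructor

theorem Api2Ty.subst {g : Api2} {D D' : List Srt} {A A' B : STm D .vtype}
    (h : Api2Ty g A A' B) (f : Sub D D') :
    Api2Ty g (A.subst f) (A'.subst f) (B.subst f) := by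
  cases h <;> simp only [STm.subst] <;> constructor

/-- Used when `allE` meets `allI` and when `letEx` opens a package: the type is instantiated while
the term, which contains no static terms, remains as it is. No constraint has to be rechecked, since
the run-time typing has none. -/
theorem LType.staticSubst {S : RSig} {D : List Srt} {G : Ctx D} {e : Tm} {A : STm D .vtype}
    (h : LType S G e A) : ∀ {D' : List Srt} (f : Sub D D'),
      LType S (G.map (Entry.subst f)) e (A.subst f) := by
  induction h with
  | varUn h₁ h₂ h₃ =>
    intro D' f
    exact .varUn (by rw [List.getElem?_map, h₁]; rfl) (h₂.subst f) (h₃.subst f)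
  | varLi h₁ h₂ h₃ =>
    intro D' f
    refine .varLi (by rw [List.getElem?_map, h₁]; rfl) ?_ (h₃.subst f)
    have := h₂.subst f
    rwa [List.map_set] at this
  | res h₁ h₂ => exact fun f => .res (h₁.subst f) (h₂.subst f)
  | lit h₁ h₂ => exact fun f => .lit (h₁.subst f) (h₂.subst f)
  | unit h₁ h₂ => exact fun f => .unit (h₁.subst f) (h₂.subst f)
  | lamLi h₁ _ h₃ ih => exact fun f => .lamLi (h₁.subst f) (ih f) (h₃.subst f)
  | lamUn h₁ h₂ h₃ _ h₄ ih =>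
    exact fun f => .lamUn (h₁.subst f) (h₂.subst f) h₃ (ih f) (h₄.subst f)
  | appLi h₁ _ _ h₂ ih₁ ih₂ => exact fun f => .appLi (h₁.subst f) (ih₁ f) (ih₂ f) (h₂.subst f)
  | appUn h₁ _ _ h₂ ih₁ ih₂ => exact fun f => .appUn (h₁.subst f) (ih₁ f) (ih₂ f) (h₂.subst f)
  | pairLi h₁ _ _ h₂ ih₁ ih₂ =>
    exact fun f => .pairLi (h₁.subst f) (ih₁ f) (ih₂ f) (h₂.subst f)
  | pairUn h₁ _ _ h₂ ih₁ ih₂ =>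
    exact fun f => .pairUn (h₁.subst f) (ih₁ f) (ih₂ f) (h₂.subst f)
  | fst _ h₂ ih => exact fun f => .fst (ih f) (h₂.subst f)
  | snd _ h₂ ih => exact fun f => .snd (ih f) (h₂.subst f)
  | letPair h₁ _ h₂ h₃ _ h₄ ih₁ ih₂ =>
    exact fun f => .letPair (h₁.subst f) (ih₁ f) (h₂.subst f) (h₃.subst f) (ih₂ f) (h₄.subst f)
  | guardI _ h₂ ih => exact fun f => .guardI (ih f) (h₂.subst f)
  | guardE _ h₂ ih => exact fun f => .guardE (ih f) (h₂.subst f)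
  | conjI _ h₂ ih => exact fun f => .conjI (ih f) (h₂.subst f)
  | letConj h₁ _ h₂ _ h₃ ih₁ ih₂ =>
    exact fun f => .letConj (h₁.subst f) (ih₁ f) (h₂.subst f) (ih₂ f) (h₃.subst f)
  | allI _ h₂ ih =>
    intro D' f
    refine .allI ?_ (h₂.subst f)
    rw [← Entry.wk_subst]
    exact ih _
  | allE s _ h₂ ih =>
    intro D' f
    refine .allE (s.subst f) (ih f) ?_
    have := h₂.subst f
    rwa [STm.inst_subst] at this
  | exI s _ h₂ ih =>
    intro D' f
    refine .exI (s.subst f) ?_ (h₂.subst f)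
    have := ih f
    rwa [STm.inst_subst] at this
  | letEx h₁ _ h₂ _ h₃ ih₁ ih₂ =>
    intro D' f
    refine .letEx (h₁.subst f) (ih₁ f) (h₂.subst _) ?_ (h₃.subst f)
    have := ih₂ (f.up _)
    rwa [List.map_cons, Entry.wk_subst, STm.wk_subst] at this
  | api1 h₁ _ h₂ ih => exact fun f => .api1 (h₁.subst f) (ih f) (h₂.subst f)
  | api2 h₀ h₁ _ _ h₂ ih₁ ih₂ =>
    exact fun f => .api2 (h₀.subst f) (h₁.subst f) (ih₁ f) (ih₂ f) (h₂.subst f)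

/-- A closed value replacing a variable must be retyped in the surrounding context. Adding that
context at the far end leaves all de Bruijn indices unchanged, so this form of weakening suffices.
-/
theorem LType.append {S : RSig} {D : List Srt} {G : Ctx D} {e : Tm} {A : STm D .vtype}
    (h : LType S G e A) : ∀ {G' : Ctx D}, NoLinear G' → LType S (G ++ G') e A := by
  induction h with
  | varUn h₁ h₂ h₃ =>
    intro G' k
    refine .varUn ?_ (h₂.append k) h₃
    rw [List.getElem?_append_left (List.getElem?_eq_some_iff.1 h₁).1, h₁]
  | varLi h₁ h₂ h₃ =>
    intro G' k
    have hl := (List.getElem?_eq_some_iff.1 h₁).1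
    refine .varLi ?_ ?_ h₃
    · rw [List.getElem?_append_left hl, h₁]
    · rw [List.set_append_left _ _ hl]
      exact h₂.append k
  | res h₁ h₂ => exact fun k => .res (h₁.append k) h₂
  | lit h₁ h₂ => exact fun k => .lit (h₁.append k) h₂
  | unit h₁ h₂ => exact fun k => .unit (h₁.append k) h₂
  | lamLi h₁ _ h₃ ih => exact fun k => .lamLi h₁ (ih k) h₃
  | lamUn h₁ h₂ h₃ _ h₄ ih => exact fun k => .lamUn h₁ (h₂.append k) h₃ (ih k) h₄
  | appLi h₁ _ _ h₂ ih₁ ih₂ => exact fun k => .appLi (h₁.append k) (ih₁ k) (ih₂ k) h₂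
  | appUn h₁ _ _ h₂ ih₁ ih₂ => exact fun k => .appUn (h₁.append k) (ih₁ k) (ih₂ k) h₂
  | pairLi h₁ _ _ h₂ ih₁ ih₂ => exact fun k => .pairLi (h₁.append k) (ih₁ k) (ih₂ k) h₂
  | pairUn h₁ _ _ h₂ ih₁ ih₂ => exact fun k => .pairUn (h₁.append k) (ih₁ k) (ih₂ k) h₂
  | fst _ h₂ ih => exact fun k => .fst (ih k) h₂
  | snd _ h₂ ih => exact fun k => .snd (ih k) h₂
  | letPair h₁ _ h₂ h₃ _ h₄ ih₁ ih₂ =>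
    exact fun k => .letPair (h₁.append k) (ih₁ k) h₂ h₃ (ih₂ k) h₄
  | guardI _ h₂ ih => exact fun k => .guardI (ih k) h₂
  | guardE _ h₂ ih => exact fun k => .guardE (ih k) h₂
  | conjI _ h₂ ih => exact fun k => .conjI (ih k) h₂
  | letConj h₁ _ h₂ _ h₃ ih₁ ih₂ => exact fun k => .letConj (h₁.append k) (ih₁ k) h₂ (ih₂ k) h₃
  | allI _ h₂ ih =>
    intro G' k
    refine .allI ?_ h₂
    rw [List.map_append]
    exact ih (by rw [Entry.wk_eq_subst]; exact k.subst _)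
  | allE s _ h₂ ih => exact fun k => .allE s (ih k) h₂
  | exI s _ h₂ ih => exact fun k => .exI s (ih k) h₂
  | letEx h₁ _ h₂ _ h₃ ih₁ ih₂ =>
    intro G' k
    refine .letEx (h₁.append k) (ih₁ k) h₂ ?_ h₃
    rw [List.map_append]
    exact ih₂ (by rw [Entry.wk_eq_subst]; exact k.subst _)
  | api1 h₁ _ h₂ ih => exact fun k => .api1 h₁ (ih k) h₂
  | api2 h₀ h₁ _ _ h₂ ih₁ ih₂ =>
    exact fun k => .api2 h₀ (h₁.append k) (ih₁ k) (ih₂ k) h₂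

theorem upRen_eq {f : ℕ → ℕ} {n : ℕ} (hf : ∀ x < n, f x = x) : ∀ x < n + 1, upRen f x = x := by
  intro x hx
  cases x with
  | zero => rfl
  | succ x => simp only [upRen, hf x (by omega)]

/-- All free variables lie below the length of the context. In the empty context this shows that a
closed value is untouched by the shifts that `upSub` performs under binders. -/
theorem LType.rename_eq {S : RSig} {D : List Srt} {G : Ctx D} {e : Tm} {A : STm D .vtype}
    (h : LType S G e A) : ∀ {f : ℕ → ℕ}, (∀ x < G.length, f x = x) → e.rename f = e := by
  induction h with
  | varUn h₁ =>
    intro f hf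
    simp only [Tm.rename, hf _ (List.getElem?_eq_some_iff.1 h₁).1]
  | varLi h₁ =>
    intro f hf
    simp only [Tm.rename, hf _ (List.getElem?_eq_some_iff.1 h₁).1]
  | res | lit | unit => intros; rfl
  | lamLi _ _ _ ih => intro f hf; simp only [Tm.rename, ih (upRen_eq hf)]
  | lamUn _ _ _ _ _ ih => intro f hf; simp only [Tm.rename, ih (upRen_eq hf)]
  | appLi h _ _ _ ih₁ ih₂ | appUn h _ _ _ ih₁ ih₂ | pairLi h _ _ _ ih₁ ih₂
  | pairUn h _ _ _ ih₁ ih₂ | api2 _ h _ _ _ ih₁ ih₂ =>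
    intro f hf
    simp only [Tm.rename, ih₁ (by rwa [h.length.1]), ih₂ (by rwa [h.length.2])]
  | fst _ _ ih | snd _ _ ih | guardI _ _ ih | guardE _ _ ih | conjI _ _ ih | allE _ _ _ ih
  | exI _ _ _ ih | api1 _ _ _ ih => intro f hf; simp only [Tm.rename, ih hf]
  | allI _ _ ih => intro f hf; simp only [Tm.rename, ih (by simpa using hf)]
  | letPair h _ _ _ _ _ ih₁ ih₂ =>
    intro f hf
    simp only [Tm.rename, ih₁ (by rwa [h.length.1]),
      ih₂ (upRen_eq (upRen_eq (by rwa [h.length.2])))]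
  | letConj h _ _ _ _ ih₁ ih₂ =>
    intro f hf
    simp only [Tm.rename, ih₁ (by rwa [h.length.1]), ih₂ (upRen_eq (by rwa [h.length.2]))]
  | letEx h _ _ _ _ ih₁ ih₂ =>
    intro f hf
    simp only [Tm.rename, ih₁ (by rwa [h.length.1]),
      ih₂ (upRen_eq (by rwa [List.length_map, h.length.2]))]

/-! #### Substitution of closed values -/

def consSub (v : Tm) (σ : ℕ → Tm) : ℕ → Tm
  | 0 => v
  | n + 1 => σ n

theorem sub1_eq (v : Tm) : sub1 v = consSub v .var := by
  funext n; cases n <;> rfl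

theorem sub2_eq (v₁ v₂ : Tm) : sub2 v₁ v₂ = consSub v₁ (consSub v₂ .var) := by
  funext n; rcases n with _ | _ | n <;> rfl

/-- `Inst S G σ G' M`: the substitution `σ` maps some variables of `G` to closed values, the
others to those of `G'`; `M` are the resources substituted for linear variables. -/
inductive Inst (S : RSig) {D : List Srt} : Ctx D → (ℕ → Tm) → Ctx D → Multiset Endpoint → Prop
  | nil (σ : ℕ → Tm) : Inst S [] σ [] 0
  | keep {G G' : Ctx D} {σ : ℕ → Tm} {M : Multiset Endpoint} (h : Entry D) :
      Inst S G σ G' M → Inst S (h :: G) (upSub σ) (h :: G') M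
  | un {G G' : Ctx D} {σ : ℕ → Tm} {M : Multiset Endpoint} {v : Tm} {t : STm D .type} :
      LType S ([] : Ctx D) v (.lin t) → v.resources = 0 → Inst S G σ G' M →
        Inst S (.un t :: G) (consSub v σ) G' M
  | li {G G' : Ctx D} {σ : ℕ → Tm} {M : Multiset Endpoint} {v : Tm} {A : STm D .vtype} :
      LType S ([] : Ctx D) v A → Inst S G σ G' M →
        Inst S (.li A :: G) (consSub v σ) G' (v.resources + M)
  | used {G G' : Ctx D} {σ : ℕ → Tm} {M : Multiset Endpoint} {v : Tm} :
      Inst S G σ G' M → Inst S (.used :: G) (consSub v σ) G' M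

theorem Inst.noLinear {S : RSig} {D : List Srt} {G G' : Ctx D} {σ : ℕ → Tm}
    {M : Multiset Endpoint} (h : Inst S G σ G' M) (hG : NoLinear G) : NoLinear G' ∧ M = 0 := by
  induction h with
  | nil => exact ⟨noLinear_nil, rfl⟩
  | keep h _ ih =>
    rw [noLinear_cons] at hG ⊢
    exact ⟨⟨hG.1, (ih hG.2).1⟩, (ih hG.2).2⟩
  | un _ _ _ ih => exact ih (noLinear_cons.1 hG).2
  | li _ _ ih => exact ((noLinear_cons.1 hG).1 trivial).elim
  | used _ ih => exact ih (noLinear_cons.1 hG).2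

/-- A value for an unrestricted variable goes to both sides, which costs nothing because it has no
resources. A value for a linear variable is counted on the side that owns the variable; on the other
side the entry is `used`, where the substituted value is neither typed nor counted. -/
theorem Inst.split {S : RSig} {D : List Srt} {G G' : Ctx D} {σ : ℕ → Tm}
    {M : Multiset Endpoint} (h : Inst S G σ G' M) : ∀ {G₁ G₂ : Ctx D}, Split G G₁ G₂ →
      ∃ G₁' G₂' M₁ M₂, Split G' G₁' G₂' ∧ Inst S G₁ σ G₁' M₁ ∧ Inst S G₂ σ G₂' M₂ ∧
        M = M₁ + M₂ := by
  induction h with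
  | nil =>
    intro G₁ G₂ k
    cases k
    exact ⟨_, _, _, _, .nil, .nil _, .nil _, rfl⟩
  | keep h _ ih =>
    intro G₁ G₂ k
    cases k with
    | un t k =>
      obtain ⟨_, _, _, _, h₁, h₂, h₃, rfl⟩ := ih k
      exact ⟨_, _, _, _, .un _ h₁, .keep _ h₂, .keep _ h₃, rfl⟩
    | used k =>
      obtain ⟨_, _, _, _, h₁, h₂, h₃, rfl⟩ := ih k
      exact ⟨_, _, _, _, .used h₁, .keep _ h₂, .keep _ h₃, rfl⟩
    | left A k =>
      obtain ⟨_, _, _, _, h₁, h₂, h₃, rfl⟩ := ih k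
      exact ⟨_, _, _, _, .left _ h₁, .keep _ h₂, .keep _ h₃, rfl⟩
    | right A k =>
      obtain ⟨_, _, _, _, h₁, h₂, h₃, rfl⟩ := ih k
      exact ⟨_, _, _, _, .right _ h₁, .keep _ h₂, .keep _ h₃, rfl⟩
  | un hv hr _ ih =>
    intro G₁ G₂ k
    cases k with
    | un t k =>
      obtain ⟨_, _, _, _, h₁, h₂, h₃, rfl⟩ := ih k
      exact ⟨_, _, _, _, h₁, .un hv hr h₂, .un hv hr h₃, rfl⟩
  | li hv _ ih =>
    intro G₁ G₂ k
    cases k with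
    | left A k =>
      obtain ⟨_, _, _, _, h₁, h₂, h₃, rfl⟩ := ih k
      exact ⟨_, _, _, _, h₁, .li hv h₂, .used h₃, (add_assoc _ _ _).symm⟩
    | right A k =>
      obtain ⟨_, _, _, _, h₁, h₂, h₃, rfl⟩ := ih k
      exact ⟨_, _, _, _, h₁, .used h₂, .li hv h₃, add_left_comm _ _ _⟩
  | used _ ih =>
    intro G₁ G₂ k
    cases k with
    | used k =>
      obtain ⟨_, _, _, _, h₁, h₂, h₃, rfl⟩ := ih k
      exact ⟨_, _, _, _, h₁, .used h₂, .used h₃, rfl⟩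

theorem Inst.wk {S : RSig} {D : List Srt} {G G' : Ctx D} {σ : ℕ → Tm}
    {M : Multiset Endpoint} (h : Inst S G σ G' M) (a : Srt) :
    Inst S (G.map (Entry.wk a)) σ (G'.map (Entry.wk a)) M := by
  induction h with
  | nil => exact .nil _
  | keep h _ ih => exact .keep _ ih
  | un hv hr _ ih =>
    refine .un ?_ hr ih
    rw [STm.wk, STm.rename_eq_subst]
    exact hv.staticSubst _
  | li hv _ ih =>
    refine .li ?_ ih
    rw [STm.wk, STm.rename_eq_subst]
    exact hv.staticSubst _
  | used _ ih => exact .used ih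

theorem LType.rename_closed {S : RSig} {D : List Srt} {e : Tm} {A : STm D .vtype}
    (h : LType S [] e A) (f : ℕ → ℕ) : e.rename f = e :=
  h.rename_eq fun _ hx => absurd hx (Nat.not_lt_zero _)

theorem Inst.un_lookup {S : RSig} {D : List Srt} {G G' : Ctx D} {σ : ℕ → Tm}
    {M : Multiset Endpoint} (h : Inst S G σ G' M) : ∀ {x : ℕ} {t : STm D .type},
      G[x]? = some (.un t) →
        (∃ y, σ x = .var y ∧ G'[y]? = some (.un t)) ∨
          LType S ([] : Ctx D) (σ x) (.lin t) ∧ (σ x).resources = 0 := by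
  induction h with
  | nil => intro x t hx; simp at hx
  | keep h _ ih =>
    intro x t hx
    cases x with
    | zero => exact .inl ⟨0, rfl, hx⟩
    | succ x =>
      rcases ih (x := x) hx with ⟨y, h₁, h₂⟩ | ⟨h₁, h₂⟩
      · exact .inl ⟨y + 1, by simp only [upSub, h₁, Tm.rename], h₂⟩
      · right
        simp only [upSub, h₁.rename_closed]
        exact ⟨h₁, h₂⟩
  | un hv hr _ ih =>
    intro x t hx
    cases x with
    | zero => cases hx; exact .inr ⟨hv, hr⟩
    | succ x => exact ih (x := x) hx
  | li hv _ ih =>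
    intro x t hx
    cases x with
    | zero => cases hx
    | succ x => exact ih (x := x) hx
  | used _ ih =>
    intro x t hx
    cases x with
    | zero => cases hx
    | succ x => exact ih (x := x) hx

/-- Here `x` is the only linear variable of `G`. Either it is kept, and then nothing linear has been
substituted, or it is replaced, and then `M` consists of the resources of its value alone. -/
theorem Inst.li_lookup {S : RSig} {D : List Srt} {G G' : Ctx D} {σ : ℕ → Tm}
    {M : Multiset Endpoint} (h : Inst S G σ G' M) : ∀ {x : ℕ} {A : STm D .vtype},
      G[x]? = some (.li A) → NoLinear (G.set x .used) →
        (∃ y, σ x = .var y ∧ G'[y]? = some (.li A) ∧ NoLinear (G'.set y .used) ∧ M = 0) ∨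
          LType S ([] : Ctx D) (σ x) A ∧ NoLinear G' ∧ M = (σ x).resources := by
  induction h with
  | nil => intro x t hx; simp at hx
  | keep h k ih =>
    intro x A hx hG
    cases x with
    | zero =>
      rw [List.set_cons_zero, noLinear_cons] at hG
      refine .inl ⟨0, rfl, hx, ?_, (k.noLinear hG.2).2⟩
      rw [List.set_cons_zero, noLinear_cons]
      exact ⟨hG.1, (k.noLinear hG.2).1⟩
    | succ x =>
      rw [List.set_cons_succ, noLinear_cons] at hG
      rcases ih (x := x) hx hG.2 with ⟨y, h₁, h₂, h₃, h₄⟩ | ⟨h₁, h₂, h₃⟩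
      · refine .inl ⟨y + 1, by simp only [upSub, h₁, Tm.rename], h₂, ?_, h₄⟩
        rw [List.set_cons_succ, noLinear_cons]
        exact ⟨hG.1, h₃⟩
      · right
        simp only [upSub, h₁.rename_closed]
        exact ⟨h₁, noLinear_cons.2 ⟨hG.1, h₂⟩, h₃⟩
  | un hv hr _ ih =>
    intro x A hx hG
    cases x with
    | zero => cases hx
    | succ x =>
      rw [List.set_cons_succ, noLinear_cons] at hG
      exact ih (x := x) hx hG.2
  | li hv k ih =>
    intro x A hx hG
    cases x with
    | zero =>
      cases hx
      rw [List.set_cons_zero, noLinear_cons] at hG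
      obtain ⟨h₁, rfl⟩ := k.noLinear hG.2
      exact .inr ⟨hv, h₁, add_zero _⟩
    | succ x =>
      rw [List.set_cons_succ, noLinear_cons] at hG
      exact (hG.1 trivial).elim
  | used _ ih =>
    intro x A hx hG
    cases x with
    | zero => cases hx
    | succ x =>
      rw [List.set_cons_succ, noLinear_cons] at hG
      exact ih (x := x) hx hG.2

/-- The substitution lemma with exact accounting: linear variables occur once and unrestricted ones
receive values without endpoints, so resources simply add up. -/
theorem LType.subst {S : RSig} {D : List Srt} {G : Ctx D} {e : Tm} {A : STm D .vtype}
    (h : LType S G e A) : ∀ {σ : ℕ → Tm} {G' : Ctx D} {M : Multiset Endpoint},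
      Inst S G σ G' M →
        LType S G' (e.subst σ) A ∧ (e.subst σ).resources = e.resources + M := by
  induction h with
  | varUn h₁ h₂ h₃ =>
    intro σ G' M k
    obtain ⟨k₁, rfl⟩ := k.noLinear h₂
    rcases k.un_lookup h₁ with ⟨y, hy, h⟩ | ⟨h, h'⟩
    · simp only [Tm.subst, hy, Tm.resources]
      exact ⟨.varUn h k₁ h₃, rfl⟩
    · exact ⟨(h.append k₁).conv h₃, h'⟩
  | varLi h₁ h₂ h₃ =>
    intro σ G' M k
    rcases k.li_lookup h₁ h₂ with ⟨y, hy, h, h', rfl⟩ | ⟨h, h', rfl⟩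
    · simp only [Tm.subst, hy, Tm.resources]
      exact ⟨.varLi h h' h₃, rfl⟩
    · exact ⟨(h.append h').conv h₃, (zero_add _).symm⟩
  | res h₁ h₂ =>
    intro σ G' M k
    obtain ⟨k₁, rfl⟩ := k.noLinear h₁
    exact ⟨.res k₁ h₂, rfl⟩
  | lit h₁ h₂ =>
    intro σ G' M k
    obtain ⟨k₁, rfl⟩ := k.noLinear h₁
    exact ⟨.lit k₁ h₂, rfl⟩
  | unit h₁ h₂ =>
    intro σ G' M k
    obtain ⟨k₁, rfl⟩ := k.noLinear h₁
    exact ⟨.unit k₁ h₂, rfl⟩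
  | lamLi h₁ _ h₃ ih =>
    intro σ G' M k
    obtain ⟨a, b⟩ := ih (.keep _ k)
    exact ⟨.lamLi h₁ a h₃, b⟩
  | lamUn h₁ h₂ h₃ _ h₄ ih =>
    intro σ G' M k
    obtain ⟨k₁, rfl⟩ := k.noLinear h₂
    obtain ⟨a, b⟩ := ih (.keep _ k)
    exact ⟨.lamUn h₁ k₁ (by rw [b, h₃, zero_add]) a h₄, b⟩
  | appLi h₁ _ _ h₂ ih₁ ih₂ =>
    intro σ G' M k
    obtain ⟨_, _, _, _, s, k₁, k₂, rfl⟩ := k.split h₁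
    obtain ⟨a₁, b₁⟩ := ih₁ k₁
    obtain ⟨a₂, b₂⟩ := ih₂ k₂
    exact ⟨.appLi s a₁ a₂ h₂, by simp only [Tm.subst, Tm.resources, b₁, b₂]; abel⟩
  | appUn h₁ _ _ h₂ ih₁ ih₂ =>
    intro σ G' M k
    obtain ⟨_, _, _, _, s, k₁, k₂, rfl⟩ := k.split h₁
    obtain ⟨a₁, b₁⟩ := ih₁ k₁
    obtain ⟨a₂, b₂⟩ := ih₂ k₂
    exact ⟨.appUn s a₁ a₂ h₂, by simp only [Tm.subst, Tm.resources, b₁, b₂]; abel⟩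
  | pairLi h₁ _ _ h₂ ih₁ ih₂ =>
    intro σ G' M k
    obtain ⟨_, _, _, _, s, k₁, k₂, rfl⟩ := k.split h₁
    obtain ⟨a₁, b₁⟩ := ih₁ k₁
    obtain ⟨a₂, b₂⟩ := ih₂ k₂
    exact ⟨.pairLi s a₁ a₂ h₂, by simp only [Tm.subst, Tm.resources, b₁, b₂]; abel⟩
  | pairUn h₁ _ _ h₂ ih₁ ih₂ =>
    intro σ G' M k
    obtain ⟨_, _, _, _, s, k₁, k₂, rfl⟩ := k.split h₁
    obtain ⟨a₁, b₁⟩ := ih₁ k₁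
    obtain ⟨a₂, b₂⟩ := ih₂ k₂
    exact ⟨.pairUn s a₁ a₂ h₂, by simp only [Tm.subst, Tm.resources, b₁, b₂]; abel⟩
  | fst _ h₂ ih => exact fun k => ⟨.fst (ih k).1 h₂, (ih k).2⟩
  | snd _ h₂ ih => exact fun k => ⟨.snd (ih k).1 h₂, (ih k).2⟩
  | letPair h₁ _ h₂ h₃ _ h₄ ih₁ ih₂ =>
    intro σ G' M k
    obtain ⟨_, _, _, _, s, k₁, k₂, rfl⟩ := k.split h₁
    obtain ⟨a₁, b₁⟩ := ih₁ k₁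
    obtain ⟨a₂, b₂⟩ := ih₂ (.keep _ (.keep _ k₂))
    exact ⟨.letPair s a₁ h₂ h₃ a₂ h₄, by simp only [Tm.subst, Tm.resources, b₁, b₂]; abel⟩
  | guardI _ h₂ ih => exact fun k => ⟨.guardI (ih k).1 h₂, (ih k).2⟩
  | guardE _ h₂ ih => exact fun k => ⟨.guardE (ih k).1 h₂, (ih k).2⟩
  | conjI _ h₂ ih => exact fun k => ⟨.conjI (ih k).1 h₂, (ih k).2⟩
  | letConj h₁ _ h₂ _ h₃ ih₁ ih₂ =>
    intro σ G' M k
    obtain ⟨_, _, _, _, s, k₁, k₂, rfl⟩ := k.split h₁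
    obtain ⟨a₁, b₁⟩ := ih₁ k₁
    obtain ⟨a₂, b₂⟩ := ih₂ (.keep _ k₂)
    exact ⟨.letConj s a₁ h₂ a₂ h₃, by simp only [Tm.subst, Tm.resources, b₁, b₂]; abel⟩
  | allI _ h₂ ih => exact fun k => ⟨.allI (ih (k.wk _)).1 h₂, (ih (k.wk _)).2⟩
  | allE s _ h₂ ih => exact fun k => ⟨.allE s (ih k).1 h₂, (ih k).2⟩
  | exI s _ h₂ ih => exact fun k => ⟨.exI s (ih k).1 h₂, (ih k).2⟩
  | letEx h₁ _ h₂ _ h₃ ih₁ ih₂ =>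
    intro σ G' M k
    obtain ⟨_, _, _, _, s, k₁, k₂, rfl⟩ := k.split h₁
    obtain ⟨a₁, b₁⟩ := ih₁ k₁
    obtain ⟨a₂, b₂⟩ := ih₂ (.keep _ (k₂.wk _))
    exact ⟨.letEx s a₁ h₂ a₂ h₃, by simp only [Tm.subst, Tm.resources, b₁, b₂]; abel⟩
  | api1 h₁ _ h₂ ih => exact fun k => ⟨.api1 h₁ (ih k).1 h₂, (ih k).2⟩
  | api2 h₀ h₁ _ _ h₂ ih₁ ih₂ =>
    intro σ G' M k
    obtain ⟨_, _, _, _, s, k₁, k₂, rfl⟩ := k.split h₁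
    obtain ⟨a₁, b₁⟩ := ih₁ k₁
    obtain ⟨a₂, b₂⟩ := ih₂ k₂
    exact ⟨.api2 h₀ s a₁ a₂ h₂, by simp only [Tm.subst, Tm.resources, b₁, b₂]; abel⟩

/-! #### Values and contraction -/

/-- Even after a quantification the type of an endpoint has `chan` below its quantifier, and `chan`
is never non-linear. -/
theorem EpTy.not_copyable {s : Option ChState} {D : List Srt} {A : STm D .vtype}
    (h : EpTy s A) : ¬ Copyable A := by
  intro hA
  cases h with
  | chan s h => exact Copyable.not_chan (hA.cv h.symm)
  | all s h => exact Copyable.not_chan (hA.cv h.symm).of_all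
  | ex s h => exact Copyable.not_chan (hA.cv h.symm).of_ex

/-- This is what makes copying and discarding harmless. Endpoints never have a copyable type, a pair
or abstraction of copyable type must have been typed by its non-linear rule, and the non-linear rule
for abstractions demands that the body has no endpoints. -/
theorem LType.value_resources {S : RSig} {v : Tm} (hv : IsValue v) :
    ∀ {D : List Srt} {A : STm D .vtype}, LType S [] v A → Copyable A → v.resources = 0 := by
  induction hv with
  | var x => intros; rfl
  | lit n => intros; rfl
  | unit => intros; rfl
  | res c =>
    intro D A h hA
    cases h with
    | res _ h => exact (h.not_copyable hA).elim
  | pair _ _ ih₁ ih₂ =>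
    intro D A h hA
    cases h with
    | pairLi _ _ _ h => exact (Copyable.not_tensor (hA.cv h.symm)).elim
    | pairUn s h₁ h₂ _ =>
      obtain ⟨rfl, rfl⟩ := s.nil_inv
      simp only [Tm.resources, ih₁ h₁ (.lin _), ih₂ h₂ (.lin _), add_zero]
  | lam e =>
    intro D A h hA
    cases h with
    | lamLi _ _ h => exact (Copyable.not_lolli (hA.cv h.symm)).elim
    | lamUn _ _ h => exact h
  | guardI _ ih =>
    intro D A h hA
    cases h with
    | guardI h k => exact ih h (hA.cv k.symm).of_guard
  | conjI _ ih =>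
    intro D A h hA
    cases h with
    | conjI h k => exact ih h (hA.cv k.symm).of_conj
  | allI _ ih =>
    intro D A h hA
    cases h with
    | allI h k => exact ih h (hA.cv k.symm).of_all
  | exI _ ih =>
    intro D A h hA
    cases h with
    -- The packed value is typed at an instance of the body, so non-linearity has to be transported
    -- along the substitution.
    | exI s h k => exact ih h ((hA.cv k.symm).of_ex.subst _)

theorem Inst.value {S : RSig} {D : List Srt} {G : Ctx D} {σ : ℕ → Tm} {M : Multiset Endpoint}
    {h : Entry D} {A B : STm D .vtype} {v : Tm} (k : Inst S G σ [] M) (hv : IsValue v)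
    (ht : LType S [] v A) (hA : Cv A B) (hh : h.Binds B) :
    Inst S (h :: G) (consSub v σ) [] (v.resources + M) := by
  cases hh with
  | un t =>
    have hr := ht.value_resources hv ((Copyable.lin t).cv hA.symm)
    rw [hr, zero_add]
    exact .un (ht.conv hA) hr k
  | li => exact .li (ht.conv hA) k

theorem LType.inst1 {S : RSig} {D : List Srt} {h : Entry D} {A A' B : STm D .vtype} {e v : Tm}
    (he : LType S [h] e B) (hh : h.Binds A') (hv : IsValue v) (ht : LType S [] v A)
    (hA : Cv A A') :
    LType S [] (e.inst1 v) B ∧ (e.inst1 v).resources = e.resources + v.resources := by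
  have := he.subst ((Inst.nil .var).value hv ht hA hh)
  rwa [← sub1_eq, add_zero] at this

theorem LType.inst2 {S : RSig} {D : List Srt} {h₁ h₂ : Entry D} {A₁ A₁' A₂ A₂' B : STm D .vtype}
    {e v₁ v₂ : Tm} (he : LType S [h₁, h₂] e B) (hh₁ : h₁.Binds A₁') (hh₂ : h₂.Binds A₂')
    (hv₁ : IsValue v₁) (hv₂ : IsValue v₂) (ht₁ : LType S [] v₁ A₁) (ht₂ : LType S [] v₂ A₂)
    (hA₁ : Cv A₁ A₁') (hA₂ : Cv A₂ A₂') :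
    LType S [] (e.inst2 v₁ v₂) B ∧
      (e.inst2 v₁ v₂).resources = e.resources + (v₁.resources + v₂.resources) := by
  have := he.subst (((Inst.nil .var).value hv₂ ht₂ hA₂ hh₂).value hv₁ ht₁ hA₁ hh₁)
  rwa [← sub2_eq, add_zero] at this

/-- The side conditions are computations of `hd`, discharged by default, so that an impossible
typing rule is dismissed from its conversion premise alone. -/
theorem Cv.false_of_hd {D : List Srt} {a : Srt} {t u : STm D a} {C : Prop} (h : Cv t u)
    (ht : t.hd ≠ .neutral := by simp [STm.hd]) (hu : u.hd ≠ .neutral := by simp [STm.hd])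
    (htu : t.hd ≠ u.hd := by simp [STm.hd]) : C :=
  (htu (h.hd ht hu)).elim

theorem LType.lolli_lam {S : RSig} {D : List Srt} {e v : Tm} {A B : STm D .vtype}
    (h : LType S [] (.lam e) (.lolli A B)) (hv : IsValue v) (ht : LType S [] v A) :
    LType S [] (e.inst1 v) B ∧ (e.inst1 v).resources = e.resources + v.resources := by
  cases h with
  | lamLi h₁ h₂ h₃ =>
    obtain ⟨k₁, k₂⟩ := h₃.lolli_inv
    obtain ⟨a, b⟩ := h₂.inst1 h₁ hv ht k₁.symm
    exact ⟨a.conv k₂, b⟩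
  | lamUn _ _ _ _ h => exact h.false_of_hd

theorem LType.fn_lam {S : RSig} {D : List Srt} {e v : Tm} {A B : STm D .vtype}
    (h : LType S [] (.lam e) (.lin (.fn A B))) (hv : IsValue v) (ht : LType S [] v A) :
    LType S [] (e.inst1 v) B ∧ (e.inst1 v).resources = e.resources + v.resources := by
  cases h with
  | lamLi _ _ h => exact h.false_of_hd
  | lamUn h₁ _ _ h₂ h₃ =>
    obtain ⟨k₁, k₂⟩ := h₃.fn_inv
    obtain ⟨a, b⟩ := h₂.inst1 h₁ hv ht k₁.symm
    exact ⟨a.conv k₂, b⟩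

theorem LType.lin_pair {S : RSig} {D : List Srt} {v₁ v₂ : Tm} {t u : STm D .type}
    (h : LType S [] (.pair v₁ v₂) (.lin (.prod t u))) (hv₁ : IsValue v₁) (hv₂ : IsValue v₂) :
    (LType S [] v₁ (.lin t) ∧ v₁.resources = 0) ∧ LType S [] v₂ (.lin u) ∧ v₂.resources = 0 := by
  cases h with
  | pairLi _ _ _ h => exact h.false_of_hd
  | pairUn s h₁ h₂ h =>
    obtain ⟨rfl, rfl⟩ := s.nil_inv
    obtain ⟨k₁, k₂⟩ := h.prod_inv
    exact ⟨⟨h₁.conv (k₁.map .lin), h₁.value_resources hv₁ (.lin _)⟩,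
      h₂.conv (k₂.map .lin), h₂.value_resources hv₂ (.lin _)⟩

/-- Subject reduction with equality of resources. The equality also holds for projections, because
the discarded component has a non-linear type and hence no endpoints. -/
theorem LType.contract {S : RSig} {D : List Srt} {e e' : Tm} {A : STm D .vtype}
    (h : LType S [] e A) (k : Contract e e') :
    LType S [] e' A ∧ e'.resources = e.resources := by
  cases k with
  | beta hv =>
    cases h with
    | appLi s h₁ h₂ h =>
      obtain ⟨rfl, rfl⟩ := s.nil_inv
      exact ⟨(h₁.lolli_lam hv h₂).1.conv h, (h₁.lolli_lam hv h₂).2⟩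
    | appUn s h₁ h₂ h =>
      obtain ⟨rfl, rfl⟩ := s.nil_inv
      exact ⟨(h₁.fn_lam hv h₂).1.conv h, (h₁.fn_lam hv h₂).2⟩
  | letPair hv₁ hv₂ =>
    cases h with
    | letPair s h₁ b₁ b₂ h₂ h =>
      obtain ⟨rfl, rfl⟩ := s.nil_inv
      cases h₁ with
      | pairLi s k₁ k₂ k =>
        obtain ⟨rfl, rfl⟩ := s.nil_inv
        obtain ⟨l₁, l₂⟩ := k.tensor_inv
        obtain ⟨a, b⟩ := h₂.inst2 b₁ b₂ hv₁ hv₂ k₁ k₂ l₁ l₂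
        exact ⟨a.conv h, b.trans (add_comm _ _)⟩
      | pairUn _ _ _ k => exact k.false_of_hd
  | fst hv₁ hv₂ =>
    cases h with
    | fst h k =>
      obtain ⟨⟨a₁, b₁⟩, a₂, b₂⟩ := h.lin_pair hv₁ hv₂
      exact ⟨a₁.conv k, by simp only [Tm.resources, b₁, b₂, add_zero]⟩
  | snd hv₁ hv₂ =>
    cases h with
    | snd h k =>
      obtain ⟨⟨a₁, b₁⟩, a₂, b₂⟩ := h.lin_pair hv₁ hv₂
      exact ⟨a₂.conv k, by simp only [Tm.resources, b₁, b₂, add_zero]⟩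
  | guard hv =>
    cases h with
    | guardE h k =>
      cases h with
      | guardI h l => exact ⟨h.conv (l.guard_inv.trans k), rfl⟩
  | letConj hv =>
    cases h with
    | letConj s h₁ b h₂ h =>
      obtain ⟨rfl, rfl⟩ := s.nil_inv
      cases h₁ with
      | conjI h₁ k =>
        obtain ⟨a, b⟩ := h₂.inst1 b hv h₁ k.conj_inv
        exact ⟨a.conv h, b.trans (add_comm _ _)⟩
  | all hv =>
    cases h with
    | allE s h k =>
      cases h with
      | allI h l =>
        -- The two quantifiers might range over different sorts. Inverting both reductions to the
        -- common reduct `w` identifies the sorts before the bodies are compared.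
        obtain ⟨w, l₁, l₂⟩ := l
        obtain ⟨_, rfl, m₁⟩ := l₁.all_inv
        obtain ⟨_, e, m₂⟩ := l₂.all_inv
        cases e
        have l := Cv.inst ⟨_, m₁, m₂⟩ s
        exact ⟨(h.staticSubst (Sub.one s)).conv (l.trans k), rfl⟩
  | letEx hv =>
    cases h with
    | letEx s h₁ b h₂ h =>
      obtain ⟨rfl, rfl⟩ := s.nil_inv
      cases h₁ with
      | exI s h₁ l =>
        obtain ⟨w, l₁, l₂⟩ := l
        obtain ⟨_, rfl, m₁⟩ := l₁.ex_inv
        obtain ⟨_, e, m₂⟩ := l₂.ex_inv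
        cases e
        have l := Cv.inst ⟨_, m₁, m₂⟩ s
        have h₂ := h₂.staticSubst (Sub.one s)
        obtain ⟨a, b⟩ := h₂.inst1 (b.subst _) hv h₁ l
        refine ⟨a.conv ?_, b.trans (add_comm _ _)⟩
        -- The result type of `letEx` does not mention the opened variable, so instantiating its
        -- weakening gives it back.
        exact (congrArg (Cv · A) (STm.wk_inst _ s)).mpr h
  | arith hn =>
    cases h with
    | api2 h₀ s _ _ h =>
      obtain ⟨rfl, rfl⟩ := s.nil_inv
      cases h₀
      -- A literal may have any `intT` type at run time, so the computed integer need not be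
      -- compared with its index.
      exact ⟨.lit noLinear_nil h, rfl⟩

/-! #### Evaluation contexts and signatures -/

def ECtx.resources : ECtx → Multiset Endpoint
  | .hole => 0
  | .api1 _ E => E.resources
  | .api2L _ E e => E.resources + e.resources
  | .api2R _ v _ E => v.resources + E.resources
  | .appL E e => E.resources + e.resources
  | .appR v _ E => v.resources + E.resources
  | .pairL E e => E.resources + e.resources
  | .pairR v _ E => v.resources + E.resources
  | .fst E => E.resources
  | .snd E => E.resources
  | .letPair E e => E.resources + e.resources
  | .guardE E => E.resources
  | .conjI E => E.resources
  | .letConj E e => E.resources + e.resources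
  | .allE E => E.resources
  | .exI E => E.resources
  | .letEx E e => E.resources + e.resources

theorem ECtx.fill_resources (E : ECtx) (e : Tm) :
    (E.fill e).resources = E.resources + e.resources := by
  induction E <;> simp only [ECtx.fill, Tm.resources, ECtx.resources, *] <;> abel

theorem Tm.renameCh_resources (e : Tm) (c₁ c₂ c : ℕ) :
    (e.renameCh c₁ c₂ c).resources = e.resources.map (Endpoint.renameCh c₁ c₂ c) := by
  induction e <;> simp only [Tm.renameCh, Tm.resources, Multiset.map_add, Multiset.map_zero,
    Multiset.map_singleton, *]

theorem Endpoint.renameCh_self (c : ℕ) (x : Endpoint) : x.renameCh c c c = x := by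
  cases x with
  | mk d R =>
    simp only [Endpoint.renameCh, or_self]
    split_ifs with h <;> simp_all

theorem Tm.renameCh_self (c : ℕ) (e : Tm) : e.renameCh c c c = e := by
  induction e <;> simp only [Tm.renameCh, Endpoint.renameCh_self, *]

/-- Only the channels that occur in `e` matter, and they need inclusion of endpoint types rather
than equal signatures. One statement thus covers the channel renaming of `cut` and, with a trivial
renaming, every change of signature (`LType.mono`). -/
theorem LType.renameCh {S S' : RSig} {D : List Srt} {G : Ctx D} {e : Tm} {A : STm D .vtype}
    {c₁ c₂ c : ℕ} (h : LType S G e A) :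
      (∀ x ∈ e.resources, ∀ {D : List Srt} {B : STm D .vtype}, EpTy (S x.ch) B →
        EpTy (S' (x.renameCh c₁ c₂ c).ch) B) → LType S' G (e.renameCh c₁ c₂ c) A := by
  induction h with
  | varUn h₁ h₂ h₃ => exact fun _ => .varUn h₁ h₂ h₃
  | varLi h₁ h₂ h₃ => exact fun _ => .varLi h₁ h₂ h₃
  | res h₁ h₂ => exact fun k => .res h₁ (k _ (Multiset.mem_singleton_self _) h₂)
  | lit h₁ h₂ => exact fun _ => .lit h₁ h₂
  | unit h₁ h₂ => exact fun _ => .unit h₁ h₂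
  | lamLi h₁ _ h₃ ih => exact fun k => .lamLi h₁ (ih k) h₃
  | lamUn h₁ h₂ h₃ _ h₄ ih =>
    refine fun k => .lamUn h₁ h₂ ?_ (ih k) h₄
    rw [Tm.renameCh_resources, h₃, Multiset.map_zero]
  | appLi h₁ _ _ h₂ ih₁ ih₂ =>
    exact fun k => .appLi h₁ (ih₁ fun x hx => k x (Multiset.mem_add.2 (.inl hx)))
      (ih₂ fun x hx => k x (Multiset.mem_add.2 (.inr hx))) h₂
  | appUn h₁ _ _ h₂ ih₁ ih₂ =>
    exact fun k => .appUn h₁ (ih₁ fun x hx => k x (Multiset.mem_add.2 (.inl hx)))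
      (ih₂ fun x hx => k x (Multiset.mem_add.2 (.inr hx))) h₂
  | pairLi h₁ _ _ h₂ ih₁ ih₂ =>
    exact fun k => .pairLi h₁ (ih₁ fun x hx => k x (Multiset.mem_add.2 (.inl hx)))
      (ih₂ fun x hx => k x (Multiset.mem_add.2 (.inr hx))) h₂
  | pairUn h₁ _ _ h₂ ih₁ ih₂ =>
    exact fun k => .pairUn h₁ (ih₁ fun x hx => k x (Multiset.mem_add.2 (.inl hx)))
      (ih₂ fun x hx => k x (Multiset.mem_add.2 (.inr hx))) h₂
  | fst _ h₂ ih => exact fun k => .fst (ih k) h₂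
  | snd _ h₂ ih => exact fun k => .snd (ih k) h₂
  | letPair h₁ _ h₂ h₃ _ h₄ ih₁ ih₂ =>
    exact fun k => .letPair h₁ (ih₁ fun x hx => k x (Multiset.mem_add.2 (.inl hx))) h₂ h₃
      (ih₂ fun x hx => k x (Multiset.mem_add.2 (.inr hx))) h₄
  | guardI _ h₂ ih => exact fun k => .guardI (ih k) h₂
  | guardE _ h₂ ih => exact fun k => .guardE (ih k) h₂
  | conjI _ h₂ ih => exact fun k => .conjI (ih k) h₂
  | letConj h₁ _ h₂ _ h₃ ih₁ ih₂ =>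
    exact fun k => .letConj h₁ (ih₁ fun x hx => k x (Multiset.mem_add.2 (.inl hx))) h₂
      (ih₂ fun x hx => k x (Multiset.mem_add.2 (.inr hx))) h₃
  | allI _ h₂ ih => exact fun k => .allI (ih k) h₂
  | allE s _ h₂ ih => exact fun k => .allE s (ih k) h₂
  | exI s _ h₂ ih => exact fun k => .exI s (ih k) h₂
  | letEx h₁ _ h₂ _ h₃ ih₁ ih₂ =>
    exact fun k => .letEx h₁ (ih₁ fun x hx => k x (Multiset.mem_add.2 (.inl hx))) h₂
      (ih₂ fun x hx => k x (Multiset.mem_add.2 (.inr hx))) h₃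
  | api1 h₁ _ h₂ ih => exact fun k => .api1 h₁ (ih k) h₂
  | api2 h₀ h₁ _ _ h₂ ih₁ ih₂ =>
    exact fun k => .api2 h₀ h₁ (ih₁ fun x hx => k x (Multiset.mem_add.2 (.inl hx)))
      (ih₂ fun x hx => k x (Multiset.mem_add.2 (.inr hx))) h₂

/-- On the channels of `M`, every type under `S` is one under `S'`. -/
def SigLe (S S' : RSig) (M : Multiset Endpoint) : Prop :=
  ∀ x ∈ M, ∀ {D : List Srt} {B : STm D .vtype}, EpTy (S x.ch) B → EpTy (S' x.ch) B

theorem SigLe.of_eq {S S' : RSig} {M : Multiset Endpoint} (h : ∀ x ∈ M, S' x.ch = S x.ch) :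
    SigLe S S' M := by
  intro x hx D B k
  rwa [h x hx]

theorem SigLe.refl (S : RSig) (M : Multiset Endpoint) : SigLe S S M := .of_eq fun _ _ => rfl

theorem SigLe.left {S S' : RSig} {M N : Multiset Endpoint} (h : SigLe S S' (M + N)) :
    SigLe S S' M := fun x hx => h x (Multiset.mem_add.2 (.inl hx))

theorem SigLe.right {S S' : RSig} {M N : Multiset Endpoint} (h : SigLe S S' (M + N)) :
    SigLe S S' N := fun x hx => h x (Multiset.mem_add.2 (.inr hx))

theorem LType.mono {S S' : RSig} {D : List Srt} {G : Ctx D} {e : Tm} {A : STm D .vtype}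
    (h : LType S G e A) (k : SigLe S S' e.resources) : LType S' G e A := by
  have := h.renameCh (S' := S') (c₁ := 0) (c₂ := 0) (c := 0) fun x hx {D B} => by
    rw [Endpoint.renameCh_self]
    exact k x hx
  rwa [Tm.renameCh_self] at this

/-- The replacement may be typed under a different signature, because a synchronisation changes the
state of its channel. The evaluation context only asks that its own endpoints are not affected. -/
theorem LType.fill_inv {S : RSig} {D : List Srt} (E : ECtx) {e : Tm} :
    ∀ {A : STm D .vtype}, LType S [] (E.fill e) A → ∃ B : STm D .vtype, LType S [] e B ∧
      ∀ {S' : RSig} {e' : Tm}, SigLe S S' E.resources → LType S' [] e' B →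
        LType S' [] (E.fill e') A := by
  induction E with
  | hole => exact fun h => ⟨_, h, fun _ k => k⟩
  | api1 f E ih =>
    intro A h
    cases h with
    | api1 h₁ h₂ h₃ =>
      obtain ⟨B, hB, k⟩ := ih h₂
      exact ⟨B, hB, fun l m => .api1 h₁ (k l m) h₃⟩
  | api2L f E e ih =>
    intro A h
    cases h with
    | api2 h₀ s h₁ h₂ h₃ =>
      obtain ⟨rfl, rfl⟩ := s.nil_inv
      obtain ⟨B, hB, k⟩ := ih h₁
      exact ⟨B, hB, fun l m => .api2 h₀ s (k l.left m) (h₂.mono l.right) h₃⟩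
  | api2R f v hv E ih =>
    intro A h
    cases h with
    | api2 h₀ s h₁ h₂ h₃ =>
      obtain ⟨rfl, rfl⟩ := s.nil_inv
      obtain ⟨B, hB, k⟩ := ih h₂
      exact ⟨B, hB, fun l m => .api2 h₀ s (h₁.mono l.left) (k l.right m) h₃⟩
  | appL E e ih =>
    intro A h
    cases h with
    | appLi s h₁ h₂ h₃ =>
      obtain ⟨rfl, rfl⟩ := s.nil_inv
      obtain ⟨B, hB, k⟩ := ih h₁
      exact ⟨B, hB, fun l m => .appLi s (k l.left m) (h₂.mono l.right) h₃⟩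
    | appUn s h₁ h₂ h₃ =>
      obtain ⟨rfl, rfl⟩ := s.nil_inv
      obtain ⟨B, hB, k⟩ := ih h₁
      exact ⟨B, hB, fun l m => .appUn s (k l.left m) (h₂.mono l.right) h₃⟩
  | appR v hv E ih =>
    intro A h
    cases h with
    | appLi s h₁ h₂ h₃ =>
      obtain ⟨rfl, rfl⟩ := s.nil_inv
      obtain ⟨B, hB, k⟩ := ih h₂
      exact ⟨B, hB, fun l m => .appLi s (h₁.mono l.left) (k l.right m) h₃⟩
    | appUn s h₁ h₂ h₃ =>
      obtain ⟨rfl, rfl⟩ := s.nil_inv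
      obtain ⟨B, hB, k⟩ := ih h₂
      exact ⟨B, hB, fun l m => .appUn s (h₁.mono l.left) (k l.right m) h₃⟩
  | pairL E e ih =>
    intro A h
    cases h with
    | pairLi s h₁ h₂ h₃ =>
      obtain ⟨rfl, rfl⟩ := s.nil_inv
      obtain ⟨B, hB, k⟩ := ih h₁
      exact ⟨B, hB, fun l m => .pairLi s (k l.left m) (h₂.mono l.right) h₃⟩
    | pairUn s h₁ h₂ h₃ =>
      obtain ⟨rfl, rfl⟩ := s.nil_inv
      obtain ⟨B, hB, k⟩ := ih h₁
      exact ⟨B, hB, fun l m => .pairUn s (k l.left m) (h₂.mono l.right) h₃⟩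
  | pairR v hv E ih =>
    intro A h
    cases h with
    | pairLi s h₁ h₂ h₃ =>
      obtain ⟨rfl, rfl⟩ := s.nil_inv
      obtain ⟨B, hB, k⟩ := ih h₂
      exact ⟨B, hB, fun l m => .pairLi s (h₁.mono l.left) (k l.right m) h₃⟩
    | pairUn s h₁ h₂ h₃ =>
      obtain ⟨rfl, rfl⟩ := s.nil_inv
      obtain ⟨B, hB, k⟩ := ih h₂
      exact ⟨B, hB, fun l m => .pairUn s (h₁.mono l.left) (k l.right m) h₃⟩
  | fst E ih =>
    intro A h
    cases h with
    | fst h₁ h₂ =>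
      obtain ⟨B, hB, k⟩ := ih h₁
      exact ⟨B, hB, fun l m => .fst (k l m) h₂⟩
  | snd E ih =>
    intro A h
    cases h with
    | snd h₁ h₂ =>
      obtain ⟨B, hB, k⟩ := ih h₁
      exact ⟨B, hB, fun l m => .snd (k l m) h₂⟩
  | letPair E e ih =>
    intro A h
    cases h with
    | letPair s h₁ b₁ b₂ h₂ h₃ =>
      obtain ⟨rfl, rfl⟩ := s.nil_inv
      obtain ⟨B, hB, k⟩ := ih h₁
      exact ⟨B, hB, fun l m => .letPair s (k l.left m) b₁ b₂ (h₂.mono l.right) h₃⟩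
  | guardE E ih =>
    intro A h
    cases h with
    | guardE h₁ h₂ =>
      obtain ⟨B, hB, k⟩ := ih h₁
      exact ⟨B, hB, fun l m => .guardE (k l m) h₂⟩
  | conjI E ih =>
    intro A h
    cases h with
    | conjI h₁ h₂ =>
      obtain ⟨B, hB, k⟩ := ih h₁
      exact ⟨B, hB, fun l m => .conjI (k l m) h₂⟩
  | letConj E e ih =>
    intro A h
    cases h with
    | letConj s h₁ b h₂ h₃ =>
      obtain ⟨rfl, rfl⟩ := s.nil_inv
      obtain ⟨B, hB, k⟩ := ih h₁
      exact ⟨B, hB, fun l m => .letConj s (k l.left m) b (h₂.mono l.right) h₃⟩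
  | allE E ih =>
    intro A h
    cases h with
    | allE s h₁ h₂ =>
      obtain ⟨B, hB, k⟩ := ih h₁
      exact ⟨B, hB, fun l m => .allE s (k l m) h₂⟩
  | exI E ih =>
    intro A h
    cases h with
    | exI s h₁ h₂ =>
      obtain ⟨B, hB, k⟩ := ih h₁
      exact ⟨B, hB, fun l m => .exI s (k l m) h₂⟩
  | letEx E e ih =>
    intro A h
    cases h with
    | letEx s h₁ b h₂ h₃ =>
      obtain ⟨rfl, rfl⟩ := s.nil_inv
      obtain ⟨B, hB, k⟩ := ih h₁
      exact ⟨B, hB, fun l m => .letEx s (k l.left m) b (h₂.mono l.right) h₃⟩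

/-! ### Acyclicity of the graph of threads and channels -/

/-- The bipartite multigraph with an edge between `t` and `c` for each occurrence of `c` in `M t`
has no cycle: a subgraph with `n > 0` vertices has less than `n` edges. -/
def Acyclic (M : ℕ → Multiset ℕ) : Prop :=
  ∀ T C : Finset ℕ, T.Nonempty ∨ C.Nonempty →
    ∑ t ∈ T, (M t).countP (· ∈ C) + 1 ≤ T.card + C.card

theorem Acyclic.mono {M M' : ℕ → Multiset ℕ} (h : Acyclic M) (hM : ∀ t, M' t ≤ M t) :
    Acyclic M' := by
  intro T C hTC
  have := Finset.sum_le_sum fun t (_ : t ∈ T) => Multiset.countP_le_of_le (· ∈ C) (hM t)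
  have := h T C hTC
  omega

theorem Acyclic.one_edge {M : ℕ → Multiset ℕ} (h : Acyclic M) (t c : ℕ) :
    (M t).countP (· = c) ≤ 1 := by
  have := h {t} {c} (.inl ⟨t, by simp⟩)
  simpa using this

/-- A vertex of degree one lies on no cycle: a subgraph containing `t` has one vertex and at most
one edge more than the same subgraph without `t`. -/
theorem Acyclic.leafThread {M M' : ℕ → Multiset ℕ} (h : Acyclic M) {t c : ℕ}
    (ht : M' t = {c}) (hu : ∀ u, u ≠ t → M' u = M u) : Acyclic M' := by
  intro T C hTC
  by_cases hT : t ∈ T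
  · have e : ∑ u ∈ T.erase t, (M' u).countP (· ∈ C) = ∑ u ∈ T.erase t, (M u).countP (· ∈ C) :=
      Finset.sum_congr rfl fun u hu' => by rw [hu u (Finset.ne_of_mem_erase hu')]
    have s := Finset.add_sum_erase T (fun u => (M' u).countP (· ∈ C)) hT
    have k := Finset.card_erase_add_one hT
    have l : (M' t).countP (· ∈ C) ≤ 1 := by
      rw [ht]; exact (Multiset.countP_le_card _ _).trans (by simp)
    by_cases hn : (T.erase t).Nonempty ∨ C.Nonempty
    · have := h _ _ hn
      omega
    -- Without `t` nothing is left, so the hypothesis does not apply; but a graph without channels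
    -- has no edges.
    · rw [not_or, Finset.not_nonempty_iff_eq_empty, Finset.not_nonempty_iff_eq_empty] at hn
      have := Finset.card_pos.2 ⟨t, hT⟩
      have e₀ : ∀ m : Multiset ℕ, m.countP (· ∈ C) = 0 := fun m => by
        rw [Multiset.countP_eq_zero, hn.2]; simp
      simp only [e₀, Finset.sum_const_zero]
      omega
  · rw [Finset.sum_congr rfl fun u hu' => by rw [hu u fun e => hT (e ▸ hu')]]
    exact h T C hTC

/-- The dual of `Acyclic.leafThread`: the new channel `c` has the single edge to `t`. -/
theorem Acyclic.leafChannel {M M' : ℕ → Multiset ℕ} (h : Acyclic M) {t c : ℕ}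
    (hc : ∀ u, c ∉ M u) (ht : M' t = M t + {c}) (hu : ∀ u, u ≠ t → M' u = M u) :
    Acyclic M' := by
  intro T C hTC
  -- The case without threads is separate because removing `c` from `C` could leave an empty
  -- subgraph.
  rcases T.eq_empty_or_nonempty with rfl | hT
  · have := Finset.card_pos.2 (hTC.resolve_left (by simp))
    simp only [Finset.sum_empty, Finset.card_empty]
    omega
  have e : ∀ u, (M u).countP (· ∈ C) = (M u).countP (· ∈ C.erase c) := fun u =>
    Multiset.countP_congr rfl fun x hx => by
      have : x ≠ c := fun e => hc u (e ▸ hx)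
      simp [this]
  have l : ∑ u ∈ T, (M' u).countP (· ∈ C) ≤
      ∑ u ∈ T, ((M u).countP (· ∈ C.erase c) + if u = t then (if c ∈ C then 1 else 0) else 0) := by
    refine Finset.sum_le_sum fun u _ => ?_
    by_cases hut : u = t
    · subst hut
      rw [ht, Multiset.countP_add, e, if_pos rfl]
      gcongr
      by_cases hcC : c ∈ C <;> simp [hcC, Multiset.countP_eq_zero]
      exact (Multiset.countP_le_card _ _).trans (by simp)
    · rw [hu u hut, e, if_neg hut, add_zero]
  rw [Finset.sum_add_distrib, Finset.sum_ite_eq'] at l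
  have := h T (C.erase c) (.inl hT)
  by_cases hcC : c ∈ C
  · have := Finset.card_erase_add_one hcC
    simp only [if_pos hcC] at l
    have : (if t ∈ T then 1 else 0) ≤ 1 := by split_ifs <;> omega
    omega
  · simp only [if_neg hcC, ite_self] at l
    have := Finset.card_erase_le (s := C) (a := c)
    omega

/-- The edges `V` move from `t₁` to `t₂`, both adjacent to `c`. A cycle using moved edges at `t₂`
could be rerouted through `t₂ – c – t₁` in the old graph. In terms of counting, only a subgraph that
contains `t₂` but not `t₁` can gain edges. -/
theorem Acyclic.move {M M' : ℕ → Multiset ℕ} (h : Acyclic M) {t₁ t₂ c : ℕ} {X V : Multiset ℕ}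
    (hne : t₁ ≠ t₂) (h₁ : M t₁ = X + V) (hX : c ∈ X) (h₂ : c ∈ M t₂) (h₁' : M' t₁ = X)
    (h₂' : M' t₂ = M t₂ + V) (hu : ∀ u, u ≠ t₁ → u ≠ t₂ → M' u = M u) : Acyclic M' := by
  intro T C hTC
  by_cases hT₂ : t₂ ∈ T
  swap
  · refine le_trans (Nat.add_le_add_right (Finset.sum_le_sum fun u hu' => ?_) 1) (h T C hTC)
    by_cases e : u = t₁
    · rw [e, h₁, h₁', Multiset.countP_add]
      exact Nat.le_add_right _ _
    · rw [hu u e fun e => hT₂ (e ▸ hu')]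
  have s := Finset.add_sum_erase T (fun u => (M u).countP (· ∈ C)) hT₂
  have s' := Finset.add_sum_erase T (fun u => (M' u).countP (· ∈ C)) hT₂
  simp only [h₂', Multiset.countP_add] at s s'
  by_cases hT₁ : t₁ ∈ T
  · have hT₁' : t₁ ∈ T.erase t₂ := Finset.mem_erase.2 ⟨hne, hT₁⟩
    have r := Finset.add_sum_erase _ (fun u => (M u).countP (· ∈ C)) hT₁'
    have r' := Finset.add_sum_erase _ (fun u => (M' u).countP (· ∈ C)) hT₁'
    simp only [h₁, h₁', Multiset.countP_add] at r r'
    have e : ∑ u ∈ (T.erase t₂).erase t₁, (M' u).countP (· ∈ C) =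
        ∑ u ∈ (T.erase t₂).erase t₁, (M u).countP (· ∈ C) :=
      Finset.sum_congr rfl fun u hu' => by
        simp only [Finset.mem_erase] at hu'
        rw [hu u hu'.1 hu'.2.1]
    have := h T C hTC
    omega
  · have e : ∑ u ∈ T.erase t₂, (M' u).countP (· ∈ C) = ∑ u ∈ T.erase t₂, (M u).countP (· ∈ C) :=
      Finset.sum_congr rfl fun u hu' => by
        simp only [Finset.mem_erase] at hu'
        rw [hu u (fun e => hT₁ (e ▸ hu'.2)) hu'.1]
    -- The old graph is tested on the subgraph enlarged by `t₁` and `c`. The edge `t₁ – c` from `X`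
    -- pays for the vertex `t₁`, and if `c` is new the edge `t₂ – c` pays for it.
    have k := h (insert t₁ T) (insert c C) (.inl (Finset.insert_nonempty _ _))
    rw [Finset.sum_insert hT₁, Finset.card_insert_of_notMem hT₁, h₁, Multiset.countP_add] at k
    have mono : ∀ m : Multiset ℕ, m.countP (· ∈ C) ≤ m.countP (· ∈ insert c C) := fun m => by
      rw [Multiset.countP_eq_card_filter, Multiset.countP_eq_card_filter]
      exact Multiset.card_le_card (Multiset.monotone_filter_right _ fun x hx =>
        Finset.mem_insert_of_mem hx)
    have kX : 1 ≤ X.countP (· ∈ insert c C) :=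
      Multiset.countP_pos.2 ⟨c, hX, Finset.mem_insert_self _ _⟩
    have kV := mono V
    by_cases hcC : c ∈ C
    · rw [Finset.insert_eq_of_mem hcC] at k kX kV
      omega
    · rw [Finset.card_insert_of_notMem hcC] at k
      have s'' := Finset.add_sum_erase T (fun u => (M u).countP (· ∈ insert c C)) hT₂
      have k₂ : (M t₂).countP (· ∈ C) + 1 ≤ (M t₂).countP (· ∈ insert c C) := by
        obtain ⟨Y, hY⟩ := Multiset.exists_cons_of_mem h₂
        rw [hY, Multiset.countP_cons_of_neg _ hcC,
          Multiset.countP_cons_of_pos _ (Finset.mem_insert_self _ _)]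
        exact Nat.add_le_add_right (mono Y) 1
      have := Finset.sum_le_sum fun u (_ : u ∈ T.erase t₂) => mono (M u)
      omega

/-- Identifying `c₁` and `c₂` amounts to contracting the path `c₁ – t – c₂`: a cycle through the
merged vertex would come from an old cycle, or from a path between `c₁` and `c₂` that `t` closes to
a cycle. -/
theorem Acyclic.merge {M M' : ℕ → Multiset ℕ} (h : Acyclic M) {t c₁ c₂ c : ℕ} {X : Multiset ℕ}
    {φ : ℕ → ℕ} (hφ : ∀ x, φ x = if x = c₁ ∨ x = c₂ then c else x) (hc : ∀ u, c ∉ M u)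
    (ht : M t = X + {c₁} + {c₂}) (ht' : M' t = X.map φ + {c})
    (hu : ∀ u, u ≠ t → M' u = (M u).map φ) : Acyclic M' := by
  -- An edge into `C` after renaming comes from an edge into `D` before; freshness of `c` is used,
  -- since `c` itself is never the source.
  have key : ∀ {m : Multiset ℕ} {C D : Finset ℕ}, c ∉ m → (∀ x, x ≠ c → φ x ∈ C → x ∈ D) →
      (m.map φ).countP (· ∈ C) ≤ m.countP (· ∈ D) := by
    intro m C D hm hD
    rw [Multiset.countP_map, Multiset.countP_eq_card_filter]
    refine Multiset.card_le_card ?_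
    rw [Multiset.le_filter]
    refine ⟨Multiset.filter_le _ _, fun x hx => ?_⟩
    rw [Multiset.mem_filter] at hx
    exact hD x (fun e => hm (e ▸ hx.1)) hx.2
  have hX : c ∉ X := fun k => hc t (by rw [ht]; simp [k])
  intro T C hTC
  by_cases hcC : c ∈ C
  swap
  · refine le_trans (Nat.add_le_add_right (Finset.sum_le_sum fun u hu' => ?_) 1) (h T C hTC)
    have hD : ∀ x, x ≠ c → φ x ∈ C → x ∈ C := by
      intro x _ hx
      rw [hφ] at hx
      split_ifs at hx
      exacts [(hcC hx).elim, hx]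
    by_cases e : u = t
    · rw [e, ht, ht', Multiset.countP_add, add_assoc, Multiset.countP_add]
      have : Multiset.countP (· ∈ C) {c} = 0 := by
        rw [Multiset.countP_eq_zero]; simpa using hcC
      have := key hX hD
      omega
    · rw [hu u e]
      exact key (hc u) hD
  · set D := insert c₁ (insert c₂ (C.erase c)) with hDdef
    have hD : ∀ x, x ≠ c → φ x ∈ C → x ∈ D := by
      intro x hxc hx
      rw [hφ] at hx
      simp only [hDdef, Finset.mem_insert, Finset.mem_erase]
      split_ifs at hx with k
      · tauto
      · tauto
    have card : D.card ≤ C.card + 1 := by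
      have : D.card ≤ _ := Finset.card_insert_le c₁ (insert c₂ (C.erase c))
      have := Finset.card_insert_le c₂ (C.erase c)
      have := Finset.card_erase_add_one hcC
      omega
    -- The subgraph is pulled back to `D`, with `t` added. Splitting `c` costs at most one vertex.
    -- If `t` was present, two edges at `t` replace one; if not, `t` costs one more vertex and
    -- brings both edges.
    have k := h (insert t T) D (.inl (Finset.insert_nonempty _ _))
    have s := Finset.add_sum_erase (insert t T) (fun u => (M u).countP (· ∈ D))
      (Finset.mem_insert_self _ _)
    have k₁ : Multiset.countP (· ∈ D) {c₁} = 1 := by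
      rw [← Multiset.cons_zero, Multiset.countP_cons_of_pos _ (by simp [hDdef])]; simp
    have k₂ : Multiset.countP (· ∈ D) {c₂} = 1 := by
      rw [← Multiset.cons_zero, Multiset.countP_cons_of_pos _ (by simp [hDdef])]; simp
    have k₃ : Multiset.countP (· ∈ C) {c} = 1 := by
      rw [← Multiset.cons_zero, Multiset.countP_cons_of_pos _ hcC]; simp
    have l := key hX hD
    simp only [ht, Multiset.countP_add, k₁, k₂] at s
    have r : ∑ u ∈ T.erase t, (M' u).countP (· ∈ C) ≤
        ∑ u ∈ (insert t T).erase t, (M u).countP (· ∈ D) := by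
      have : (insert t T).erase t = T.erase t := by ext; simp
      rw [this]
      refine Finset.sum_le_sum fun u hu' => ?_
      rw [hu u (Finset.ne_of_mem_erase hu')]
      exact key (hc u) hD
    by_cases hT : t ∈ T
    · have s' := Finset.add_sum_erase T (fun u => (M' u).countP (· ∈ C)) hT
      simp only [ht', Multiset.countP_add, k₃] at s'
      rw [Finset.insert_eq_of_mem hT] at k s r
      omega
    · rw [Finset.erase_eq_of_notMem hT] at r
      rw [Finset.card_insert_of_notMem hT] at k
      omega

/-- A new thread is started that receives the edges `V` of `t` and an edge to `c`. -/
theorem Acyclic.fork {M M' : ℕ → Multiset ℕ} (h : Acyclic M) {t t' c : ℕ} {X V : Multiset ℕ}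
    (hne : t ≠ t') (ht : M t = X + V) (hX : c ∈ X) (h₁ : M' t = X)
    (h₂ : M' t' = V + {c}) (hu : ∀ u, u ≠ t → u ≠ t' → M' u = M u) : Acyclic M' := by
  -- The new thread first hangs on `c` as a leaf, and the edges `V` are then moved to it through
  -- `c`.
  have k := h.leafThread (M' := Function.update M t' {c}) (t := t') (c := c) (by simp)
    fun u hu => by simp [hu]
  refine k.move (X := X) (V := V) (c := c) hne ?_ hX ?_ h₁ ?_ ?_
  · simp [hne, ht]
  · simp
  · simp [h₂, add_comm]
  · intro u h₁ h₂
    simp [h₂, hu u h₁ h₂]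

/-- As `Acyclic.fork`, with a new channel `c`. -/
theorem Acyclic.forkNew {M M' : ℕ → Multiset ℕ} (h : Acyclic M) {t t' c : ℕ} {X V : Multiset ℕ}
    (hne : t ≠ t') (hc : ∀ u, c ∉ M u) (ht : M t = X + V)
    (h₁ : M' t = X + {c}) (h₂ : M' t' = V + {c}) (hu : ∀ u, u ≠ t → u ≠ t' → M' u = M u) :
    Acyclic M' := by
  -- The new channel is first a leaf at `t`; then the situation is that of `Acyclic.fork` with `c`
  -- already held by `t`.
  have k := h.leafChannel (M' := Function.update M t (M t + {c})) (t := t) hc (by simp)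
    fun u hu => by simp [hu]
  refine k.fork (X := X + {c}) (V := V) (c := c) hne ?_ (by simp) h₁ h₂ ?_
  · simp only [Function.update_self, ht]; abel
  · intro u h₁ h₂
    simp [h₁, hu u h₁ h₂]

/-! ### The run-time invariant of pools -/

/-- The channels of the endpoints in a thread. -/
def Pool.chans (Q : Pool) (t : ℕ) : Multiset ℕ :=
  ((Q.get t).elim 0 Tm.resources).map Endpoint.ch

def Pool.RunTyped (S : RSig) (Q : Pool) : Prop :=
  ∀ t e, Q.get t = some e → ∃ A : STm [] .vtype, LType S [] e A

theorem Pool.get_set (Q : Pool) (t : ℕ) (e : Tm) (u : ℕ) :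
    (Q.set t e).get u = if u = t then some e else Q.get u := rfl

theorem Pool.chans_of_get {Q : Pool} {t : ℕ} {e : Tm} (h : Q.get t = some e) :
    Q.chans t = e.resources.map Endpoint.ch := by
  simp [Pool.chans, h]

theorem Pool.chans_of_fill {Q : Pool} {t : ℕ} {E : ECtx} {e : Tm}
    (h : Q.get t = some (E.fill e)) :
    Q.chans t = E.resources.map Endpoint.ch + e.resources.map Endpoint.ch := by
  rw [Pool.chans_of_get h, ECtx.fill_resources, Multiset.map_add]

theorem Pool.chans_set_self (Q : Pool) (t : ℕ) (e : Tm) :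
    (Q.set t e).chans t = e.resources.map Endpoint.ch :=
  Pool.chans_of_get (by simp [Pool.get_set])

theorem Pool.chans_set_ne (Q : Pool) {t u : ℕ} (e : Tm) (h : u ≠ t) :
    (Q.set t e).chans u = Q.chans u := by
  simp [Pool.chans, Pool.get_set, h]

theorem Pool.mem_resources {Q : Pool} {x : Endpoint} :
    x ∈ Q.resources ↔ ∃ t e, Q.get t = some e ∧ x ∈ e.resources := by
  rw [Pool.resources, Multiset.mem_sum]
  constructor
  · rintro ⟨t, ht, hx⟩
    cases h : Q.get t with
    | none => simp [h] at hx
    | some e => exact ⟨t, e, h, by simpa [h] using hx⟩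
  · rintro ⟨t, e, h, hx⟩
    exact ⟨t, (Q.mem_dom t).2 (by simp [h]), by simpa [h] using hx⟩

theorem Pool.Fresh.not_mem_chans {Q : Pool} {c : ℕ} (h : Q.Fresh c) (t : ℕ) :
    c ∉ Q.chans t := by
  intro hc
  obtain ⟨x, hx, rfl⟩ := Multiset.mem_map.1 hc
  cases k : Q.get t with
  | none => simp [k] at hx
  | some e => exact h x (Pool.mem_resources.2 ⟨t, e, k, by simpa [k] using hx⟩) rfl

theorem Pool.RunTyped.set {S : RSig} {Q : Pool} {t : ℕ} {e : Tm} {A : STm [] .vtype}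
    (h : Q.RunTyped S) (he : LType S [] e A) : (Q.set t e).RunTyped S := by
  intro u e' k
  rw [Pool.get_set] at k
  split_ifs at k
  · cases k
    exact ⟨A, he⟩
  · exact h u e' k

theorem Pool.RunTyped.fresh {S : RSig} {Q : Pool} {c : ℕ} (h : Q.RunTyped S) (hc : Q.Fresh c)
    (s : Option ChState) : Q.RunTyped (Function.update S c s) := by
  intro t e k
  obtain ⟨A, hA⟩ := h t e k
  exact ⟨A, hA.mono (.of_eq fun x hx => by
    simp [hc x (Pool.mem_resources.2 ⟨t, e, k, hx⟩)])⟩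

/-- Reduction within a thread. -/
theorem Pool.RunTyped.fill {S : RSig} {Q : Pool} {t : ℕ} {E : ECtx} {e : Tm}
    (h : Q.RunTyped S) (k : Q.get t = some (E.fill e)) :
    ∃ B : STm [] .vtype, LType S [] e B ∧
      ∀ e', LType S [] e' B → (Q.set t (E.fill e')).RunTyped S := by
  obtain ⟨A, hA⟩ := h t _ k
  obtain ⟨B, hB, l⟩ := hA.fill_inv
  exact ⟨B, hB, fun e' he' => h.set (l (.refl _ _) he')⟩

theorem Pool.acyclic_fill {Q : Pool} {t : ℕ} {E : ECtx} {e e' : Tm} (h : Acyclic Q.chans)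
    (k : Q.get t = some (E.fill e)) (he : e'.resources ≤ e.resources) :
    Acyclic (Q.set t (E.fill e')).chans := by
  refine h.mono fun u => ?_
  by_cases hu : u = t
  · subst hu
    rw [Pool.chans_set_self, ECtx.fill_resources, Multiset.map_add, Pool.chans_of_fill k]
    exact add_le_add le_rfl (Multiset.map_le_map he)
  · rw [Pool.chans_set_ne _ _ hu]

theorem EpTy.chan_inv {s : Option ChState} {rs : STm [] .set} {p : STm [] .stype}
    (h : EpTy s (.chan rs p)) : ∃ q, s = some (.live q) ∧ Cv q p := by
  cases h with
  | chan s h =>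
    have := h.chan_inv
    rw [STm.ofClosed_nil] at this
    exact ⟨_, rfl, this⟩
  | all s h => exact h.false_of_hd
  | ex s h => exact h.false_of_hd

theorem LType.ep_chan_inv {S : RSig} {c : ℕ} {R : Set ℤ} {rs : STm [] .set}
    {p : STm [] .stype} (h : LType S [] (.ep c R) (.chan rs p)) :
    ∃ q, S c = some (.live q) ∧ Cv q p := by
  cases h with
  | res _ h => exact h.chan_inv

/-- The role set `R` of the endpoint and the index `rs` of its type are unrelated. This freedom
absorbs the role sets that `fork` and `split` choose at run time. -/
theorem LType.ep_chan {S : RSig} {c : ℕ} {R : Set ℤ} {rs : STm [] .set}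
    {p q : STm [] .stype} (h : S c = some (.live q)) (k : Cv q p) :
    LType S [] (.ep c R) (.chan rs p) := by
  refine .res noLinear_nil ?_
  rw [h]
  exact .chan rs (by rw [STm.ofClosed_nil]; exact k.map .chan)

theorem EpTy.live_mono {p q : STm [] .stype} (h : Cv p q) {D : List Srt} {B : STm D .vtype}
    (k : EpTy (some (.live p)) B) : EpTy (some (.live q)) B := by
  cases k with
  | chan s k => exact .chan s ((h.ofClosed.map .chan).symm.trans k)

/-! ### Preservation of the invariant by the steps of one thread -/

/-- The invariant: the pool has a run-time typing and an acyclic graph. -/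
def Pool.Sound (Q : Pool) : Prop := (∃ S, Q.RunTyped S) ∧ Acyclic Q.chans

theorem Pool.Sound.reduce {Q : Pool} (h : Q.Sound) {t : ℕ} {E : ECtx} {e e' : Tm}
    (k : Q.get t = some (E.fill e))
    (he : ∀ {S : RSig} {B : STm [] .vtype}, LType S [] e B →
      LType S [] e' B ∧ e'.resources ≤ e.resources) : (Q.set t (E.fill e')).Sound := by
  obtain ⟨⟨S, hS⟩, ha⟩ := h
  obtain ⟨B, hB, l⟩ := hS.fill k
  exact ⟨⟨S, l e' (he hB).1⟩, Pool.acyclic_fill ha k (he hB).2⟩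

theorem Pool.Sound.erase {Q : Pool} (h : Q.Sound) (t : ℕ) : (Q.erase t).Sound := by
  obtain ⟨⟨S, hS⟩, ha⟩ := h
  refine ⟨⟨S, fun u e k => ?_⟩, ha.mono fun u => ?_⟩
  · simp only [Pool.erase] at k
    split_ifs at k
    exact hS u e k
  · by_cases hu : u = t <;> simp [Pool.chans, Pool.erase, hu]

theorem Pool.ne_of_not_mem {Q : Pool} {t t' : ℕ} {e : Tm} (h : Q.get t = some e)
    (h' : t' ∉ Q.dom) : t ≠ t' := by
  rintro rfl
  exact h' ((Q.mem_dom t).2 (by simp [h]))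

/-- The graph is treated as if a fictitious fresh channel joined parent and child, as in a `fork`;
deleting its edges afterwards keeps the forest. -/
theorem Pool.Sound.spawn {Q : Pool} (h : Q.Sound) {t t' : ℕ} {E : ECtx} {e : Tm}
    (k : Q.get t = some (E.fill (.api1 .spawn (.lam e)))) (ht' : t' ∉ Q.dom) :
    ((Q.set t (E.fill .unit)).set t' (e.inst1 .unit)).Sound := by
  obtain ⟨⟨S, hS⟩, ha⟩ := h
  have hne := Pool.ne_of_not_mem k ht'
  obtain ⟨B, hB, l⟩ := hS.fill k
  cases hB with
  | api1 h₀ h₁ h₂ =>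
    cases h₀
    obtain ⟨a, b⟩ := h₁.lolli_lam .unit (.unit noLinear_nil (.refl _))
    refine ⟨⟨S, (l _ (.unit noLinear_nil h₂)).set a⟩, ?_⟩
    have hfr : ∃ c, ∀ u, c ∉ Q.chans u := by
      obtain ⟨c, hc⟩ := Infinite.exists_notMem_finset (Q.resources.map Endpoint.ch).toFinset
      refine ⟨c, Pool.Fresh.not_mem_chans fun x hx e => hc ?_⟩
      rw [Multiset.mem_toFinset, ← e]
      exact Multiset.mem_map_of_mem _ hx
    obtain ⟨c, hc⟩ := hfr
    have h := ha.forkNew (t := t) (t' := t') (c := c) (X := E.resources.map Endpoint.ch)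
      (V := e.resources.map Endpoint.ch) hne hc (Pool.chans_of_fill (E := E) (e := .api1 .spawn (.lam e)) k)
      (M' := Function.update (Function.update Q.chans t (E.resources.map Endpoint.ch + {c})) t'
        (e.resources.map Endpoint.ch + {c})) (by simp [hne]) (by simp)
      fun u h₁ h₂ => by simp [h₁, h₂]
    refine h.mono fun u => ?_
    by_cases hu' : u = t'
    · subst hu'
      rw [Pool.chans_set_self, b]
      simp [Tm.resources]
    by_cases hu : u = t
    · subst hu
      rw [Pool.chans_set_ne _ _ hu', Pool.chans_set_self, ECtx.fill_resources]
      simp [Tm.resources, hne]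
    · rw [Pool.chans_set_ne _ _ hu', Pool.chans_set_ne _ _ hu]
      simp [hu, hu']

theorem Pool.Sound.fork {Q : Pool} (h : Q.Sound) {t t' : ℕ} {E : ECtx} {e : Tm} {c : ℕ}
    {R₁ R₂ : Set ℤ} (k : Q.get t = some (E.fill (.api1 .fork (.lam e)))) (ht' : t' ∉ Q.dom)
    (hc : Q.Fresh c) :
    ((Q.set t (E.fill (.ep c R₂))).set t' (e.inst1 (.ep c R₁))).Sound := by
  obtain ⟨⟨S, hS⟩, ha⟩ := h
  have hne := Pool.ne_of_not_mem k ht'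
  obtain ⟨A, hA⟩ := hS t _ k
  obtain ⟨B, hB, l⟩ := hA.fill_inv
  have hle : ∀ {u e}, Q.get u = some e → ∀ {s} {x : Endpoint}, x ∈ e.resources →
      Function.update S c s x.ch = S x.ch := fun k s x hx => by
    simp [hc x (Pool.mem_resources.2 ⟨_, _, k, hx⟩)]
  cases hB with
  | api1 h₀ h₁ h₂ =>
    cases h₀ with
    | @fork s s' p =>
      -- The new channel receives the session type found in the typing of the call. Since `c` is
      -- fresh, no existing term notices the update.
      have hp : Function.update S c (some (.live p)) c = some (.live p) := by simp
      have h₁' := h₁.mono (S' := Function.update S c (some (.live p))) (.of_eq fun x hx =>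
        hle k (by rw [ECtx.fill_resources]; exact Multiset.mem_add.2 (.inr hx)))
      obtain ⟨a, b⟩ := h₁'.lolli_lam (.res _) (.ep_chan (R := R₁) hp (.refl _))
      refine ⟨⟨_, ((hS.fresh hc (some (.live p))).set (l (.of_eq fun x hx =>
        hle k (by rw [ECtx.fill_resources]; exact Multiset.mem_add.2 (.inl hx)))
        ((LType.ep_chan (R := R₂) hp (.refl _)).conv h₂))).set a⟩, ?_⟩
      refine ha.forkNew (t := t) (t' := t') (c := c) (X := E.resources.map Endpoint.ch)
        (V := e.resources.map Endpoint.ch) hne hc.not_mem_chans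
        (Pool.chans_of_fill (E := E) (e := .api1 .fork (.lam e)) k) ?_ ?_
        fun u hu hu' => ?_
      · rw [Pool.chans_set_ne _ _ hne, Pool.chans_set_self, ECtx.fill_resources]
        simp [Tm.resources]
      · rw [Pool.chans_set_self, b]
        simp [Tm.resources]
      · rw [Pool.chans_set_ne _ _ hu', Pool.chans_set_ne _ _ hu]

theorem Pool.Sound.split {Q : Pool} (h : Q.Sound) {t t' : ℕ} {E : ECtx} {e : Tm} {c : ℕ}
    {R R₁ R₂ : Set ℤ} (k : Q.get t = some (E.fill (.api2 .split (.ep c R) (.lam e))))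
    (ht' : t' ∉ Q.dom) :
    ((Q.set t (E.fill (.ep c R₂))).set t' (e.inst1 (.ep c R₁))).Sound := by
  obtain ⟨⟨S, hS⟩, ha⟩ := h
  have hne := Pool.ne_of_not_mem k ht'
  obtain ⟨B, hB, l⟩ := hS.fill k
  cases hB with
  | api2 h₀ s h₁ h₂ h₃ =>
    obtain ⟨rfl, rfl⟩ := s.nil_inv
    cases h₀ with
    | split =>
      obtain ⟨q, hq, hqp⟩ := h₁.ep_chan_inv
      obtain ⟨a, b⟩ := h₂.lolli_lam (.res _) (.ep_chan (R := R₁) hq hqp)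
      refine ⟨⟨S, (l _ ((LType.ep_chan hq hqp).conv h₃)).set a⟩, ?_⟩
      -- The edge to `c` that the parent keeps is part of `X`; the child receives the edges of the
      -- closure and an edge of its own to `c`.
      refine ha.fork (t := t) (t' := t') (c := c) (X := E.resources.map Endpoint.ch + {c})
        (V := e.resources.map Endpoint.ch) hne ?_ (by simp) ?_ ?_ fun u hu hu' => ?_
      · rw [Pool.chans_of_fill k]
        simp [Tm.resources, add_assoc]
      · rw [Pool.chans_set_ne _ _ hne, Pool.chans_set_self, ECtx.fill_resources]
        simp [Tm.resources]
      · rw [Pool.chans_set_self, b]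
        simp [Tm.resources]
      · rw [Pool.chans_set_ne _ _ hu', Pool.chans_set_ne _ _ hu]

theorem Pool.Sound.cut {Q : Pool} (h : Q.Sound) {t : ℕ} {E : ECtx} {c₁ c₂ c : ℕ}
    {R₁ R₂ R : Set ℤ} (k : Q.get t = some (E.fill (.api2 .cut (.ep c₁ R₁) (.ep c₂ R₂))))
    (hc : Q.Fresh c) : ((Q.set t (E.fill (.ep c R))).renameCh c₁ c₂ c).Sound := by
  obtain ⟨⟨S, hS⟩, ha⟩ := h
  have hM := Pool.chans_of_fill k
  have hc₁ : c₁ ≠ c := fun e => hc.not_mem_chans t (by rw [hM]; simp [Tm.resources, e])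
  have hc₂ : c₂ ≠ c := fun e => hc.not_mem_chans t (by rw [hM]; simp [Tm.resources, e])
  obtain ⟨A, hA⟩ := hS t _ k
  obtain ⟨B, hB, l⟩ := hA.fill_inv
  cases hB with
  | api2 h₀ s h₁ h₂ h₃ =>
    obtain ⟨rfl, rfl⟩ := s.nil_inv
    cases h₀ with
    | @cut _ _ _ p =>
      obtain ⟨q₁, hq₁, hp₁⟩ := h₁.ep_chan_inv
      obtain ⟨q₂, hq₂, hp₂⟩ := h₂.ep_chan_inv
      -- The session types of `c₁` and `c₂` are both convertible to the type `p` of the call, so `p`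
      -- serves for the merged channel and every renamed endpoint keeps its types.
      refine ⟨⟨Function.update S c (some (.live p)), ?_⟩, ?_⟩
      · set S' := Function.update S c (some (.live p))
        have hS' : ∀ d, d ≠ c → S' d = S d := fun d hd => by simp [S', hd]
        have hren : ∀ (x : Endpoint) {D : List Srt} {B : STm D .vtype}, EpTy (S' x.ch) B →
            EpTy (S' (x.renameCh c₁ c₂ c).ch) B := by
          intro x D B hB
          simp only [Endpoint.renameCh]
          split_ifs with hx
          · simp only [S', Function.update_self]
            rcases hx with hx | hx
            · rw [hx, hS' _ hc₁, hq₁] at hB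
              exact hB.live_mono hp₁
            · rw [hx, hS' _ hc₂, hq₂] at hB
              exact hB.live_mono hp₂
          · exact hB
        have hset : (Q.set t (E.fill (.ep c R))).RunTyped S' := by
          refine (hS.fresh hc _).set (l (.of_eq fun x hx => hS' _ (hc x ?_))
            ((LType.ep_chan (q := p) (by simp) (.refl _)).conv h₃))
          exact Pool.mem_resources.2
            ⟨t, _, k, by rw [ECtx.fill_resources]; exact Multiset.mem_add.2 (.inl hx)⟩
        intro u e he
        obtain ⟨e, he', rfl⟩ := Option.map_eq_some_iff.1 he
        obtain ⟨A, hA⟩ := hset u e he'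
        exact ⟨A, hA.renameCh fun x _ {D B} => hren x⟩
      · refine ha.merge (t := t) (c₁ := c₁) (c₂ := c₂) (c := c)
          (X := E.resources.map Endpoint.ch) (φ := fun x => if x = c₁ ∨ x = c₂ then c else x)
          (fun _ => rfl) hc.not_mem_chans ?_ ?_ fun u hu => ?_
        · rw [hM]
          simp [Tm.resources, add_assoc]
        · simp [Pool.chans, Pool.renameCh, Pool.get_set, Tm.renameCh_resources,
            ECtx.fill_resources, Tm.resources, Endpoint.renameCh, Function.comp_def]
        · simp only [Pool.chans, Pool.renameCh, Pool.get_set, if_neg hu]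
          cases Q.get u <;> simp [Tm.renameCh_resources, Endpoint.renameCh, Function.comp_def]

/-- The run-time type of `cut` is symmetric in its arguments, as the role set of the result is
unconstrained. -/
theorem Pool.Sound.poolEquiv {Q Q' : Pool} (h : Q.Sound) (k : PoolEquiv Q Q') : Q'.Sound := by
  cases k with
  | cut hv₁ hv₂ k =>
    refine h.reduce k fun hB => ⟨?_, (add_comm _ _).le⟩
    cases hB with
    | api2 h₀ s h₁ h₂ h₃ =>
      obtain ⟨rfl, rfl⟩ := s.nil_inv
      cases h₀
      exact .api2 (.cut (s'' := _)) .nil h₂ h₁ h₃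

/-! #### Synchronisation -/

/-- The number of endpoints of a channel is its degree in the graph. -/
theorem Pool.card_endpoints (Q : Pool) (c : ℕ) :
    (Q.endpoints c).card = ∑ t ∈ Q.dom, (Q.chans t).countP (· = c) := by
  rw [Pool.endpoints, ← Multiset.countP_eq_card_filter, Pool.resources,
    ← Multiset.coe_countPAddMonoidHom, map_sum]
  refine Finset.sum_congr rfl fun t _ => ?_
  rw [Multiset.coe_countPAddMonoidHom, Pool.chans, Multiset.countP_map,
    Multiset.countP_eq_card_filter]

theorem Sync.get_dom {Q Q' : Pool} {c : ℕ} {T : Finset ℕ} {R : ℕ → Set ℤ} {a b : ℕ → Tm}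
    (h : Sync Q Q' c T R a b) : T ⊆ Q.dom := fun t ht => by
  obtain ⟨E, k, -⟩ := h.2.1 t ht
  exact (Q.mem_dom t).2 (by simp [k])

theorem Sync.chans {Q Q' : Pool} {c : ℕ} {T : Finset ℕ} {R : ℕ → Set ℤ} {a b : ℕ → Tm}
    (h : Sync Q Q' c T R a b) {t : ℕ} (ht : t ∈ T) : ∃ N,
      Q.chans t = N + (a t).resources.map Endpoint.ch ∧
        Q'.chans t = N + (b t).resources.map Endpoint.ch := by
  obtain ⟨E, k, k'⟩ := h.2.1 t ht
  exact ⟨_, Pool.chans_of_fill k, Pool.chans_of_fill k'⟩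

/-- The channel has exactly as many endpoints as `T` has threads, and each thread of `T` already
holds one. A further thread with an endpoint of `c` would exceed the total. -/
theorem Sync.not_mem_chans {Q Q' : Pool} {c : ℕ} {T : Finset ℕ} {R : ℕ → Set ℤ} {a b : ℕ → Tm}
    (h : Sync Q Q' c T R a b) (ha : ∀ t ∈ T, ⟨c, R t⟩ ∈ (a t).resources) {t : ℕ} (ht : t ∉ T) :
    c ∉ Q.chans t := by
  intro hc
  have hd : t ∈ Q.dom := by
    rw [Q.mem_dom]
    intro e
    simp [Pool.chans, e] at hc
  have hcard := Q.card_endpoints c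
  rw [h.1, Multiset.card_map, Finset.card_val] at hcard
  have h₁ : ∀ u ∈ insert t T, 1 ≤ (Q.chans u).countP (· = c) := by
    intro u hu
    refine Multiset.countP_pos.2 ⟨c, ?_, rfl⟩
    rcases Finset.mem_insert.1 hu with rfl | hu
    · exact hc
    · obtain ⟨N, hN, -⟩ := h.chans hu
      rw [hN]
      exact Multiset.mem_add.2 (.inr (Multiset.mem_map_of_mem Endpoint.ch (ha u hu)))
  have h₂ := Finset.sum_le_sum h₁
  have h₃ := Finset.sum_le_sum_of_subset (f := fun u => (Q.chans u).countP (· = c))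
    (Finset.insert_subset hd h.get_dom)
  rw [Finset.sum_const, Finset.card_insert_of_notMem ht, smul_eq_mul] at h₂
  omega

/-- Two endpoints of one channel in the same thread would form a cycle of length two. Consequently
the evaluation context around a call on `c` does not mention `c`. -/
theorem Acyclic.not_mem_of_add {M : ℕ → Multiset ℕ} (h : Acyclic M) {t c : ℕ}
    {N L : Multiset ℕ} (hM : M t = N + L) (hL : c ∈ L) : c ∉ N := by
  intro hN
  have := h.one_edge t c
  rw [hM, Multiset.countP_add] at this
  have : 0 < N.countP (· = c) := Multiset.countP_pos.2 ⟨c, hN, rfl⟩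
  have : 0 < L.countP (· = c) := Multiset.countP_pos.2 ⟨c, hL, rfl⟩
  omega

/-- The signature may change at `c` because `c` is visible only in the synchronising subterms: the
contexts around them avoid it by acyclicity, and the other threads avoid it by the count of
endpoints. -/
theorem Sync.runTyped {S S' : RSig} {Q Q' : Pool} {c : ℕ} {T : Finset ℕ} {R : ℕ → Set ℤ}
    {a b : ℕ → Tm} (h : Sync Q Q' c T R a b) (hac : Acyclic Q.chans) (hQ : Q.RunTyped S)
    (hS : ∀ d, d ≠ c → S' d = S d) (ha : ∀ t ∈ T, ⟨c, R t⟩ ∈ (a t).resources)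
    (hab : ∀ t ∈ T, ∀ B : STm [] .vtype, LType S [] (a t) B → LType S' [] (b t) B) :
    Q'.RunTyped S' := by
  intro t e he
  by_cases ht : t ∈ T
  · obtain ⟨E, k, k'⟩ := h.2.1 t ht
    rw [he] at k'
    cases k'
    obtain ⟨A, hA⟩ := hQ t _ k
    obtain ⟨B, hB, l⟩ := hA.fill_inv
    refine ⟨A, l (.of_eq fun x hx => hS _ fun hc => ?_) (hab t ht B hB)⟩
    refine hac.not_mem_of_add (Pool.chans_of_fill k)
      (Multiset.mem_map_of_mem Endpoint.ch (ha t ht)) ?_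
    exact Multiset.mem_map.2 ⟨x, hx, hc⟩
  · rw [h.2.2 t ht] at he
    obtain ⟨A, hA⟩ := hQ t e he
    refine ⟨A, hA.mono (.of_eq fun x hx => hS _ fun hc => h.not_mem_chans ha ht ?_)⟩
    rw [Pool.chans_of_get he]
    exact Multiset.mem_map.2 ⟨x, hx, hc⟩

/-- Covers every synchronisation in which no thread gains an endpoint; the point-to-point message is
the exception. -/
theorem Sync.acyclic {Q Q' : Pool} {c : ℕ} {T : Finset ℕ} {R : ℕ → Set ℤ}
    {a b : ℕ → Tm} (h : Sync Q Q' c T R a b) (hac : Acyclic Q.chans)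
    (hab : ∀ t ∈ T, (b t).resources ≤ (a t).resources) : Acyclic Q'.chans := by
  refine hac.mono fun t => ?_
  by_cases ht : t ∈ T
  · obtain ⟨N, h₁, h₂⟩ := h.chans ht
    rw [h₁, h₂]
    exact add_le_add le_rfl (Multiset.map_le_map (hab t ht))
  · simp only [Pool.chans, h.2.2 t ht, le_refl]

/-- The type of the subterm at which a thread synchronises. -/
theorem Sync.typed {S : RSig} {Q Q' : Pool} {c : ℕ} {T : Finset ℕ} {R : ℕ → Set ℤ}
    {a b : ℕ → Tm} (h : Sync Q Q' c T R a b) (hQ : Q.RunTyped S) {t : ℕ} (ht : t ∈ T) :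
    ∃ B : STm [] .vtype, LType S [] (a t) B := by
  obtain ⟨E, k, -⟩ := h.2.1 t ht
  obtain ⟨B, hB, -⟩ := hQ.fill k
  exact ⟨B, hB⟩

theorem LType.bsend_inv {S : RSig} {c : ℕ} {R : Set ℤ} {v : Tm} {B : STm [] .vtype}
    (h : LType S [] (.api2 .bsend (.ep c R) v) B) : ∃ q s r t p, S c = some (.live q) ∧
      Cv q (.bmsg r t p) ∧ LType S [] v (.lin t) ∧ Cv (.chan s p) B := by
  cases h with
  | api2 h₀ s h₁ h₂ h =>
    obtain ⟨rfl, rfl⟩ := s.nil_inv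
    cases h₀ with
    | bsend =>
      obtain ⟨q, hq, k⟩ := h₁.ep_chan_inv
      exact ⟨q, _, _, _, _, hq, k, h₂, h⟩

theorem LType.brecv_inv {S : RSig} {c : ℕ} {R : Set ℤ} {B : STm [] .vtype}
    (h : LType S [] (.api1 .brecv (.ep c R)) B) : ∃ q s r t p, S c = some (.live q) ∧
      Cv q (.bmsg r t p) ∧ Cv (.tensor (.chan s p) (.lin t)) B := by
  cases h with
  | api1 h₀ h₁ h =>
    cases h₀ with
    | brecv =>
      obtain ⟨q, hq, k⟩ := h₁.ep_chan_inv
      exact ⟨q, _, _, _, _, hq, k, h⟩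

theorem LType.send_inv {S : RSig} {c : ℕ} {R : Set ℤ} {v : Tm} {B : STm [] .vtype}
    (h : LType S [] (.api2 .send (.ep c R) v) B) : ∃ q s r₁ r₂ A p, S c = some (.live q) ∧
      Cv q (.msg r₁ r₂ A p) ∧ LType S [] v A ∧ Cv (.chan s p) B := by
  cases h with
  | api2 h₀ s h₁ h₂ h =>
    obtain ⟨rfl, rfl⟩ := s.nil_inv
    cases h₀ with
    | send =>
      obtain ⟨q, hq, k⟩ := h₁.ep_chan_inv
      exact ⟨q, _, _, _, _, _, hq, k, h₂, h⟩

theorem LType.recv_inv {S : RSig} {c : ℕ} {R : Set ℤ} {B : STm [] .vtype}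
    (h : LType S [] (.api1 .recv (.ep c R)) B) : ∃ q s r₁ r₂ A p, S c = some (.live q) ∧
      Cv q (.msg r₁ r₂ A p) ∧ Cv (.tensor (.chan s p) A) B := by
  cases h with
  | api1 h₀ h₁ h =>
    cases h₀ with
    | recv =>
      obtain ⟨q, hq, k⟩ := h₁.ep_chan_inv
      exact ⟨q, _, _, _, _, _, hq, k, h⟩

theorem LType.skip_inv {S : RSig} {c : ℕ} {R : Set ℤ} {B : STm [] .vtype}
    (h : LType S [] (.api1 .skip (.ep c R)) B) : ∃ q s r₁ r₂ A p, S c = some (.live q) ∧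
      Cv q (.msg r₁ r₂ A p) ∧ Cv (.chan s p) B := by
  cases h with
  | api1 h₀ h₁ h =>
    cases h₀ with
    | skip =>
      obtain ⟨q, hq, k⟩ := h₁.ep_chan_inv
      exact ⟨q, _, _, _, _, _, hq, k, h⟩

theorem LType.unify_inv {S : RSig} {c : ℕ} {R : Set ℤ} {B : STm [] .vtype}
    (h : LType S [] (.api1 .unify (.ep c R)) B) : ∃ q s r a, ∃ f : STm [] (.arr a .stype),
      S c = some (.live q) ∧ Cv q (.quan r f) ∧ Cv (.all (STm.chanAt s f)) B := by
  cases h with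
  | api1 h₀ h₁ h =>
    cases h₀ with
    | unify =>
      obtain ⟨q, hq, k⟩ := h₁.ep_chan_inv
      exact ⟨q, _, _, _, _, hq, k, h⟩

theorem LType.exify_inv {S : RSig} {c : ℕ} {R : Set ℤ} {B : STm [] .vtype}
    (h : LType S [] (.api1 .exify (.ep c R)) B) : ∃ q s r a, ∃ f : STm [] (.arr a .stype),
      S c = some (.live q) ∧ Cv q (.quan r f) ∧ Cv (.ex (STm.chanAt s f)) B := by
  cases h with
  | api1 h₀ h₁ h =>
    cases h₀ with
    | exify =>
      obtain ⟨q, hq, k⟩ := h₁.ep_chan_inv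
      exact ⟨q, _, _, _, _, hq, k, h⟩

theorem LType.close_inv {S : RSig} {e : Tm} {B : STm [] .vtype}
    (h : LType S [] (.api1 .close e) B) : Cv .one B := by
  cases h with
  | api1 h₀ _ h => cases h₀; exact h

theorem LType.wait_inv {S : RSig} {e : Tm} {B : STm [] .vtype}
    (h : LType S [] (.api1 .wait e) B) : Cv .one B := by
  cases h with
  | api1 h₀ _ h => cases h₀; exact h

theorem Cv.chanAt {D : List Srt} {a : Srt} {s : STm D .set} {f f' : STm D (.arr a .stype)}
    (h : Cv f f') : Cv (s.chanAt f) (s.chanAt f') :=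
  ((h.rename _).map (F := fun g => .app g (.var .z)) fun k => .app k (.refl _)).map .chan

/-- The sort of a quantifier is hidden in `quan`; it must be identified before the bodies of two
participants can be compared. -/
theorem Cv.quan_inv_sort {D : List Srt} {a a' : Srt} {r r' : STm D .int}
    {f : STm D (.arr a .stype)} {f' : STm D (.arr a' .stype)}
    (h : Cv (.quan r f) (.quan r' f')) : a = a' := by
  obtain ⟨w, h, h'⟩ := h
  obtain ⟨_, _, rfl, _⟩ := h.quan_inv
  obtain ⟨_, _, e, _⟩ := h'.quan_inv
  cases e
  rfl

section

variable {Q Q' : Pool} {c : ℕ} {T : Finset ℕ} {R : ℕ → Set ℤ}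

theorem Pool.Sound.bmsg (h : Q.Sound) {t₁ : ℕ} {v : Tm} (ht₁ : t₁ ∈ T) (hv : IsValue v)
    (k : Sync Q Q' c T R
      (fun t => if t = t₁ then .api2 .bsend (.ep c (R t)) v else .api1 .brecv (.ep c (R t)))
      (fun t => if t = t₁ then .ep c (R t) else .pair (.ep c (R t)) v)) : Q'.Sound := by
  obtain ⟨⟨S, hS⟩, ha⟩ := h
  obtain ⟨B₁, hB₁⟩ := k.typed hS ht₁
  rw [if_pos rfl] at hB₁
  obtain ⟨q, s, r, τ, p, hq, hc, hvt, -⟩ := hB₁.bsend_inv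
  -- The broadcast value has non-linear type. Having no endpoints, it can be copied to all receivers
  -- without adding edges and is unaffected by the new state of `c`.
  have hr := hvt.value_resources hv (.lin _)
  have hS' : Function.update S c (some (.live p)) c = some (.live p) := by simp
  refine ⟨⟨Function.update S c (some (.live p)), k.runTyped ha hS (fun d hd => by simp [hd])
    (fun t _ => ?_) (fun t _ B hB => ?_)⟩, k.acyclic ha fun t _ => ?_⟩
  · split_ifs <;> simp [Tm.resources]
  · split_ifs at hB ⊢ with htt
    · obtain ⟨q', s', r', τ', p', hq', hc', -, hB⟩ := hB.bsend_inv
      cases hq.symm.trans hq'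
      exact (LType.ep_chan hS' (hc.symm.trans hc').bmsg_inv.2).conv hB
    · obtain ⟨q', s', r', τ', p', hq', hc', hB⟩ := hB.brecv_inv
      cases hq.symm.trans hq'
      obtain ⟨l₁, l₂⟩ := (hc.symm.trans hc').bmsg_inv
      refine .pairLi .nil (.ep_chan hS' l₂) ((hvt.mono ?_).conv (l₁.map .lin)) hB
      rw [hr]
      intro x hx
      simp at hx
  · split_ifs <;> simp [Tm.resources, hr]

theorem Pool.Sound.endS (h : Q.Sound) {t₁ : ℕ}
    (k : Sync Q Q' c T R
      (fun t => if t = t₁ then .api1 .close (.ep c (R t)) else .api1 .wait (.ep c (R t)))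
      (fun _ => .unit)) : Q'.Sound := by
  obtain ⟨⟨S, hS⟩, ha⟩ := h
  refine ⟨⟨S, k.runTyped ha hS (fun d hd => rfl)
    (fun t _ => ?_) (fun t _ B hB => ?_)⟩, k.acyclic ha fun t _ => ?_⟩
  · split_ifs <;> simp [Tm.resources]
  · split_ifs at hB ⊢
    exacts [.unit noLinear_nil hB.close_inv, .unit noLinear_nil hB.wait_inv]
  · simp [Tm.resources]

theorem Pool.Sound.quan (h : Q.Sound) {t₁ : ℕ} (ht₁ : t₁ ∈ T)
    (k : Sync Q Q' c T R
      (fun t => if t = t₁ then .api1 .unify (.ep c (R t)) else .api1 .exify (.ep c (R t)))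
      (fun t => .ep c (R t))) : Q'.Sound := by
  obtain ⟨⟨S, hS⟩, ha⟩ := h
  obtain ⟨B₁, hB₁⟩ := k.typed hS ht₁
  rw [if_pos rfl] at hB₁
  obtain ⟨q, s, r, a, f, hq, hc, -⟩ := hB₁.unify_inv
  -- The channel enters the state in which its endpoints may have either a universal or an
  -- existential type. The type still exposed by each context decides which of the two is used.
  have hS' : Function.update S c (some (.quantified f)) c = some (.quantified f) := by simp
  refine ⟨⟨Function.update S c (some (.quantified f)), k.runTyped ha hS
    (fun d hd => by simp [hd]) (fun t _ => ?_) (fun t _ B hB => ?_)⟩,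
    k.acyclic ha fun t _ => ?_⟩
  · split_ifs <;> simp [Tm.resources]
  · refine .res noLinear_nil ?_
    rw [hS']
    split_ifs at hB with htt
    · obtain ⟨q', s', r', a', f', hq', hc', hB⟩ := hB.unify_inv
      cases hq.symm.trans hq'
      cases (hc.symm.trans hc').quan_inv_sort
      refine .all s' (.trans ?_ hB)
      rw [STm.ofClosed_nil]
      exact (hc.symm.trans hc').quan_inv.chanAt.map .all
    · obtain ⟨q', s', r', a', f', hq', hc', hB⟩ := hB.exify_inv
      cases hq.symm.trans hq'
      cases (hc.symm.trans hc').quan_inv_sort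
      refine .ex s' (.trans ?_ hB)
      rw [STm.ofClosed_nil]
      exact (hc.symm.trans hc').quan_inv.chanAt.map .ex
  · split_ifs <;> simp [Tm.resources]

theorem Pool.Sound.skip (h : Q.Sound) (hT : T.Nonempty)
    (k : Sync Q Q' c T R (fun t => .api1 .skip (.ep c (R t))) (fun t => .ep c (R t))) :
    Q'.Sound := by
  obtain ⟨⟨S, hS⟩, ha⟩ := h
  obtain ⟨t₁, ht₁⟩ := hT
  obtain ⟨B₁, hB₁⟩ := k.typed hS ht₁
  obtain ⟨q, s, r₁, r₂, A, p, hq, hc, -⟩ := hB₁.skip_inv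
  have hS' : Function.update S c (some (.live p)) c = some (.live p) := by simp
  refine ⟨⟨Function.update S c (some (.live p)), k.runTyped ha hS (fun d hd => by simp [hd])
    (fun t _ => ?_) (fun t _ B hB => ?_)⟩, k.acyclic ha fun t _ => ?_⟩
  · simp [Tm.resources]
  · obtain ⟨q', s', r₁', r₂', A', p', hq', hc', hB⟩ := hB.skip_inv
    cases hq.symm.trans hq'
    exact (LType.ep_chan hS' (hc.symm.trans hc').msg_inv.2).conv hB
  · simp [Tm.resources]

/-- The message may contain endpoints, so edges travel from `t₁` to `t₂`. Both threads are adjacent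
to `c`, which is the situation of `Acyclic.move`. -/
theorem Pool.Sound.msg (h : Q.Sound) {t₁ t₂ : ℕ} {v : Tm} (ht₁ : t₁ ∈ T) (ht₂ : t₂ ∈ T)
    (hne : t₁ ≠ t₂)
    (k : Sync Q Q' c T R
      (fun t => if t = t₁ then .api2 .send (.ep c (R t)) v
        else if t = t₂ then .api1 .recv (.ep c (R t)) else .api1 .skip (.ep c (R t)))
      (fun t => if t = t₂ then .pair (.ep c (R t)) v else .ep c (R t))) : Q'.Sound := by
  obtain ⟨⟨S, hS⟩, ha⟩ := h
  obtain ⟨B₁, hB₁⟩ := k.typed hS ht₁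
  rw [if_pos rfl] at hB₁
  obtain ⟨q, s, r₁, r₂, A, p, hq, hc, hvt, -⟩ := hB₁.send_inv
  have hS' : Function.update S c (some (.live p)) c = some (.live p) := by simp
  obtain ⟨N, hN, hN'⟩ := k.chans ht₁
  simp only [if_pos, if_neg hne, Tm.resources, Multiset.map_add, Multiset.map_singleton]
    at hN hN'
  rw [← add_assoc] at hN
  -- A channel cannot be sent along itself, since the sender would then hold two of its endpoints.
  -- Hence `v` keeps its type when the state of `c` changes.
  have hvc : c ∉ v.resources.map Endpoint.ch := by
    have : Q.chans t₁ = (N + v.resources.map Endpoint.ch) + {c} := by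
      rw [hN, add_right_comm]
    intro hc
    exact ha.not_mem_of_add this (by simp) (Multiset.mem_add.2 (.inr hc))
  refine ⟨⟨Function.update S c (some (.live p)), k.runTyped ha hS (fun d hd => by simp [hd])
    (fun t _ => ?_) (fun t _ B hB => ?_)⟩, ?_⟩
  · split_ifs <;> simp [Tm.resources]
  · by_cases h₁ : t = t₁
    · rw [if_pos h₁] at hB
      rw [if_neg fun h₂ => hne (h₁.symm.trans h₂)]
      obtain ⟨q', s', r₁', r₂', A', p', hq', hc', -, hB⟩ := hB.send_inv
      cases hq.symm.trans hq'
      exact (LType.ep_chan hS' (hc.symm.trans hc').msg_inv.2).conv hB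
    rw [if_neg h₁] at hB
    split_ifs at hB ⊢ with h₂
    · obtain ⟨q', s', r₁', r₂', A', p', hq', hc', hB⟩ := hB.recv_inv
      cases hq.symm.trans hq'
      obtain ⟨l₁, l₂⟩ := (hc.symm.trans hc').msg_inv
      refine .pairLi .nil (.ep_chan hS' l₂) ((hvt.mono (.of_eq fun x hx => ?_)).conv l₁) hB
      have : x.ch ≠ c := fun e => hvc (Multiset.mem_map.2 ⟨x, hx, e⟩)
      simp [this]
    · obtain ⟨q', s', r₁', r₂', A', p', hq', hc', hB⟩ := hB.skip_inv
      cases hq.symm.trans hq'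
      exact (LType.ep_chan hS' (hc.symm.trans hc').msg_inv.2).conv hB
  · obtain ⟨L, hL, hL'⟩ := k.chans ht₂
    simp only [if_pos, if_neg hne.symm, Tm.resources, Multiset.map_add, Multiset.map_singleton]
      at hL hL'
    refine ha.move (c := c) hne hN (by simp) (by rw [hL]; simp) hN' (by rw [hL', hL, add_assoc])
      fun t h₁ h₂ => ?_
    by_cases ht : t ∈ T
    · obtain ⟨K, hK, hK'⟩ := k.chans ht
      simp only [if_neg h₁, if_neg h₂] at hK hK'
      exact hK'.trans hK.symm
    · simp only [Pool.chans, k.2.2 t ht]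

theorem Pool.Sound.step {U : Set ℤ} (h : Q.Sound) (k : Step U Q Q') : Q'.Sound := by
  cases k with
  | lift k hr =>
    cases hr with
    | ctx E hc => exact h.reduce k fun hB => ⟨(hB.contract hc).1, (hB.contract hc).2.le⟩
  | gc => exact h.erase _
  | spawn k ht' => exact h.spawn k ht'
  | fork k ht' hc => exact h.fork k ht' hc
  | cut k hc => exact h.cut k hc
  | elim k =>
    refine h.reduce k fun hB => ⟨?_, by simp [Tm.resources]⟩
    cases hB with
    | api1 h₀ _ h => cases h₀; exact .unit noLinear_nil h
  | split k ht' => exact h.split k ht'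
  | bmsg ht hv k => exact h.bmsg ht hv k
  | endS _ k => exact h.endS k
  | quan ht k => exact h.quan ht k
  | msg h₁ h₂ hne _ k => exact h.msg h₁ h₂ hne k
  | skip hT k => exact h.skip hT k

theorem Pool.Sound.evaluates {U : Set ℤ} (h : Q.Sound) (k : Evaluates U Q Q') : Q'.Sound := by
  induction k with
  | refl => exact h
  | tail _ k ih =>
    rcases k with k | k
    exacts [ih.step k, ih.poolEquiv k]

theorem PoolTyped.sound {U : Set ℤ} {S : Sig} {A : STm [] .vtype} (h : PoolTyped U S Q A)
    (hr : Q.resources = 0) : Q.Sound := by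
  refine ⟨⟨S.run, fun t e k => ?_⟩, ?_⟩
  · rcases Nat.eq_zero_or_pos t with rfl | ht
    · obtain ⟨e', k', he⟩ := h.1
      cases k.symm.trans k'
      exact ⟨A, he.run⟩
    · exact ⟨_, (h.2 t e ht k).run⟩
  · have hz : ∀ t, Q.chans t = 0 := by
      intro t
      refine Multiset.eq_zero_of_forall_notMem fun c hc => ?_
      obtain ⟨x, hx, -⟩ := Multiset.mem_map.1 hc
      cases k : Q.get t with
      | none => simp [k] at hx
      | some e =>
        have : x ∈ Q.resources := Pool.mem_resources.2 ⟨t, e, k, by simpa [k] using hx⟩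
        simp [hr] at this
    -- Without edges the inequality only says that the subgraph has a vertex.
    intro T C hTC
    simp only [hz, Multiset.countP_zero, Finset.sum_const_zero]
    rcases hTC with hT | hC
    · have := hT.card_pos; omega
    · have := hC.card_pos; omega

end

/-! ### A model of the statics in which types are interpreted by their outermost constructor -/

/-- Interpretation of session types. -/
inductive STag
  | endS (r : ℤ)
  | bmsg (r : ℤ)
  | msg (r₁ r₂ : ℤ)
  | quan (r : ℤ)

/-- Interpretation of types. -/
inductive Tag
  | intT (n : ℤ)
  | unit
  | prod
  | fn
  | chan (R : Set ℤ) (p : STag)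
  | tensor
  | lolli
  | guard
  | conj
  | all
  | ex

/-- The model of a sort, with its projection to the standard interpretation. -/
@[reducible] def Srt.mdl : (a : Srt) → (T : Type) × (T → a.denote)
  | .int => ⟨ℤ, id⟩
  | .bool => ⟨Prop, id⟩
  | .set => ⟨Set ℤ, id⟩
  | .stype => ⟨STag, fun _ => ⟨⟩⟩
  | .ty _ => ⟨Tag, fun _ => ⟨⟩⟩
  -- A function of the model carries a standard function over which it lies. Without this, a
  -- function from types to indices could distinguish tags, and index equalities valid in the
  -- standard interpretation would fail in the model.
  | .arr a b => ⟨{p : (a.mdl.1 → b.mdl.1) × (a.denote → b.denote) //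
      ∀ x, b.mdl.2 (p.1 x) = p.2 (a.mdl.2 x)}, fun p => p.1.2⟩

abbrev MEnv (D : List Srt) : Type := ∀ a, Var D a → a.mdl.1

def MEnv.cons {D : List Srt} {b : Srt} (x : b.mdl.1) (ρ : MEnv D) : MEnv (b :: D)
  | _, .z => x
  | _, .s y => ρ _ y

def MEnv.base {D : List Srt} (ρ : MEnv D) : Env D := fun a x => a.mdl.2 (ρ a x)

def MEnv.nil : MEnv [] := fun _ x => nomatch x

theorem MEnv.base_cons {D : List Srt} {b : Srt} (x : b.mdl.1) (ρ : MEnv D) :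
    (MEnv.cons x ρ).base = Env.cons (b.mdl.2 x) ρ.base := by
  funext a y; cases y <;> rfl

/-- The value and its agreement with the standard interpretation are defined together, because
abstraction needs the agreement of its body to form an element of the function sort. `lin` is
transparent, so the permutations of `lin` in `Conv` hold by computation. -/
def STm.interp : {D : List Srt} → {a : Srt} → (t : STm D a) → (ρ : MEnv D) →
    {x : a.mdl.1 // a.mdl.2 x = t.eval ρ.base}
  | _, _, .var x, ρ => ⟨ρ _ x, rfl⟩
  | _, _, .lam t, ρ => ⟨⟨(fun x => (t.interp (ρ.cons x)).1, fun y => t.eval (Env.cons y ρ.base)),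
      fun x => by rw [(t.interp (ρ.cons x)).2, MEnv.base_cons]⟩, rfl⟩
  | _, _, .app t u, ρ => ⟨(t.interp ρ).1.1.1 (u.interp ρ).1, by
      rw [(t.interp ρ).1.2, (u.interp ρ).2]
      exact congrFun (t.interp ρ).2 _⟩
  | _, _, .intLit n, ρ => ⟨n, rfl⟩
  | _, _, .arith o t u, ρ => ⟨(STm.arith o t u).eval ρ.base, rfl⟩
  | _, _, .tt, _ => ⟨True, rfl⟩
  | _, _, .not t, ρ => ⟨(STm.not t).eval ρ.base, rfl⟩
  | _, _, .and t u, ρ => ⟨(STm.and t u).eval ρ.base, rfl⟩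
  | _, _, .or t u, ρ => ⟨(STm.or t u).eval ρ.base, rfl⟩
  | _, _, .eqInt t u, ρ => ⟨(STm.eqInt t u).eval ρ.base, rfl⟩
  | _, _, .leInt t u, ρ => ⟨(STm.leInt t u).eval ρ.base, rfl⟩
  | _, _, .eqSet t u, ρ => ⟨(STm.eqSet t u).eval ρ.base, rfl⟩
  | _, _, .mem t u, ρ => ⟨(STm.mem t u).eval ρ.base, rfl⟩
  | _, _, .setLit R, _ => ⟨R, rfl⟩
  | _, _, .single t, ρ => ⟨(STm.single t).eval ρ.base, rfl⟩
  | _, _, .union t u, ρ => ⟨(STm.union t u).eval ρ.base, rfl⟩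
  | _, _, .inter t u, ρ => ⟨(STm.inter t u).eval ρ.base, rfl⟩
  | _, _, .diff t u, ρ => ⟨(STm.diff t u).eval ρ.base, rfl⟩
  | _, _, .endS r, ρ => ⟨STag.endS (r.eval ρ.base), rfl⟩
  | _, _, .bmsg r _ _, ρ => ⟨STag.bmsg (r.eval ρ.base), rfl⟩
  | _, _, .msg r₁ r₂ _ _, ρ => ⟨STag.msg (r₁.eval ρ.base) (r₂.eval ρ.base), rfl⟩
  | _, _, .quan r _, ρ => ⟨STag.quan (r.eval ρ.base), rfl⟩
  | _, _, .intT s, ρ => ⟨Tag.intT (s.eval ρ.base), rfl⟩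
  | _, _, .unit, _ => ⟨Tag.unit, rfl⟩
  | _, _, .prod _ _, _ => ⟨Tag.prod, rfl⟩
  | _, _, .fn _ _, _ => ⟨Tag.fn, rfl⟩
  | _, _, .lin t, ρ => ⟨(t.interp ρ).1, rfl⟩
  | _, _, .chan s p, ρ => ⟨Tag.chan (s.eval ρ.base) (p.interp ρ).1, rfl⟩
  | _, _, .tensor _ _, _ => ⟨Tag.tensor, rfl⟩
  | _, _, .lolli _ _, _ => ⟨Tag.lolli, rfl⟩
  | _, _, .guard _ _, _ => ⟨Tag.guard, rfl⟩
  | _, _, .conj _ _, _ => ⟨Tag.conj, rfl⟩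
  | _, _, .all _, _ => ⟨Tag.all, rfl⟩
  | _, _, .ex _, _ => ⟨Tag.ex, rfl⟩

/-! ### Soundness of conversion in the model -/

theorem Env.cons_up {D D' : List Srt} (f : Ren D D') {b : Srt} (x : b.denote) (ρ : Env D') :
    (fun a y => Env.cons x ρ a (f.up b a y)) = Env.cons x fun a y => ρ a (f a y) := by
  funext a y; cases y <;> rfl

theorem STm.eval_rename {D : List Srt} {a : Srt} (t : STm D a) :
    ∀ {D' : List Srt} (f : Ren D D') (ρ : Env D'),
      (t.rename f).eval ρ = t.eval fun a x => ρ a (f a x) := by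
  induction t <;> intros <;> simp only [STm.rename, STm.eval, Env.cons_up, *]

theorem Env.cons_sub_up {D D' : List Srt} (f : Sub D D') {b : Srt} (x : b.denote) (ρ : Env D') :
    (fun a y => (f.up b a y).eval (Env.cons x ρ)) = Env.cons x fun a y => (f a y).eval ρ := by
  funext a y
  cases y with
  | z => rfl
  | s y => exact (f _ y).eval_rename _ _

theorem STm.eval_subst {D : List Srt} {a : Srt} (t : STm D a) :
    ∀ {D' : List Srt} (f : Sub D D') (ρ : Env D'),
      (t.subst f).eval ρ = t.eval fun a x => (f a x).eval ρ := by
  induction t <;> intros <;> simp only [STm.subst, STm.eval, Env.cons_sub_up, *]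

theorem MEnv.cons_up {D D' : List Srt} (f : Ren D D') {b : Srt} (x : b.mdl.1) (ρ : MEnv D') :
    (fun a y => MEnv.cons x ρ a (f.up b a y)) = MEnv.cons x fun a y => ρ a (f a y) := by
  funext a y; cases y <;> rfl

theorem STm.interp_rename {D : List Srt} {a : Srt} (t : STm D a) :
    ∀ {D' : List Srt} (f : Ren D D') (ρ : MEnv D'),
      ((t.rename f).interp ρ).1 = (t.interp fun a x => ρ a (f a x)).1 := by
  induction t <;> intro D' f ρ
  case lam t ih =>
    refine Subtype.ext (Prod.ext (funext fun x => ?_) (funext fun y => ?_))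
    · exact (ih _ _).trans (by rw [MEnv.cons_up]; rfl)
    · exact (STm.eval_rename _ _ _).trans (by rw [Env.cons_up]; rfl)
  all_goals first
    | rfl
    | (simp only [STm.rename, STm.interp, STm.eval, STm.eval_rename, *]; done)
    | (simp only [STm.rename, STm.interp, STm.eval, STm.eval_rename, *]; rfl)

theorem MEnv.cons_sub_up {D D' : List Srt} (f : Sub D D') {b : Srt} (x : b.mdl.1)
    (ρ : MEnv D') : (fun a y => ((f.up b a y).interp (MEnv.cons x ρ)).1) =
      MEnv.cons x fun a y => ((f a y).interp ρ).1 := by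
  funext a y
  cases y with
  | z => rfl
  | s y => exact (f _ y).interp_rename _ _

theorem MEnv.base_interp {D D' : List Srt} (f : Sub D D') (ρ : MEnv D') :
    MEnv.base (fun a x => ((f a x).interp ρ).1) = fun a x => (f a x).eval ρ.base := by
  funext a x
  exact ((f a x).interp ρ).2

theorem STm.interp_subst {D : List Srt} {a : Srt} (t : STm D a) :
    ∀ {D' : List Srt} (f : Sub D D') (ρ : MEnv D'),
      ((t.subst f).interp ρ).1 = (t.interp fun a x => ((f a x).interp ρ).1).1 := by
  induction t <;> intro D' f ρ
  case lam t ih =>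
    refine Subtype.ext (Prod.ext (funext fun x => ?_) (funext fun y => ?_))
    · exact (ih _ _).trans (by rw [MEnv.cons_sub_up]; rfl)
    · exact (STm.eval_subst _ _ _).trans (by rw [Env.cons_sub_up, ← MEnv.base_interp]; rfl)
  all_goals first
    | rfl
    | simp only [STm.subst, STm.interp, STm.eval, STm.eval_subst, MEnv.base_interp, *]

theorem Sat.wk {D : List Srt} {P : List (STm D .bool)} {ρ : Env D} (h : Sat P ρ) {a : Srt}
    (x : a.denote) : Sat (P.map (STm.wk a)) (Env.cons x ρ) := by
  intro q hq
  obtain ⟨q', hq', rfl⟩ := List.mem_map.1 hq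
  rw [STm.wk, STm.eval_rename]
  exact h q' hq'

theorem STm.eval_inst {D : List Srt} {a b : Srt} (t : STm (b :: D) a) (s : STm D b)
    (ρ : Env D) : (t.inst s).eval ρ = t.eval (Env.cons (s.eval ρ) ρ) := by
  rw [STm.inst, STm.eval_subst]
  congr 1
  funext a x; cases x <;> rfl

theorem STm.interp_inst {D : List Srt} {a b : Srt} (t : STm (b :: D) a) (s : STm D b)
    (ρ : MEnv D) : ((t.inst s).interp ρ).1 = (t.interp (MEnv.cons (s.interp ρ).1 ρ)).1 := by
  have h : (fun a x => ((Sub.one s a x).interp ρ).1) = MEnv.cons (s.interp ρ).1 ρ := by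
    funext a x; cases x <;> rfl
  rw [STm.inst, STm.interp_subst, h]

theorem Conv.eval {D : List Srt} {P : List (STm D .bool)} {a : Srt} {t u : STm D a}
    (h : Conv P t u) : ∀ {ρ : Env D}, Sat P ρ → t.eval ρ = u.eval ρ := by
  induction h with
  | refl => intros; rfl
  | symm _ ih => exact fun h => (ih h).symm
  | trans _ _ ih ih' => exact fun h => (ih h).trans (ih' h)
  | beta t s => exact fun {ρ} _ => (t.eval_inst s ρ).symm
  | index _ k => exact fun h => k _ h
  | lam _ ih => exact fun h => funext fun x => ih (h.wk x)
  | app _ _ ih ih' => exact fun h => by simp only [STm.eval, ih h, ih' h]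
  | _ => intros; rfl

/-- Convertible types have the same outermost constructor and, for `chan`, the same role set and the
same roles in the first action of the session. This is the precision that `Cv` gives up. -/
theorem Conv.interp {D : List Srt} {P : List (STm D .bool)} {a : Srt} {t u : STm D a}
    (h : Conv P t u) : ∀ {ρ : MEnv D}, Sat P ρ.base → (t.interp ρ).1 = (u.interp ρ).1 := by
  induction h with
  | refl => intros; rfl
  | symm _ ih => exact fun h => (ih h).symm
  | trans _ _ ih ih' => exact fun h => (ih h).trans (ih' h)
  | beta t s => exact fun {ρ} _ => (t.interp_inst s ρ).symm
  -- At an index sort the projection to the standard interpretation is the identity, so the standard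
  -- equation is the required one.
  | @index D P a t u hi k =>
    intro ρ h
    have h := k _ h
    rw [← (t.interp ρ).2, ← (u.interp ρ).2] at h
    cases hi <;> exact h
  | lam k ih =>
    intro ρ h
    refine Subtype.ext (Prod.ext (funext fun x => ?_) (funext fun y => k.eval (h.wk y)))
    exact ih (by rw [MEnv.base_cons]; exact h.wk _)
  | app _ _ ih ih' => exact fun h => by simp only [STm.interp, ih h, ih' h]
  | endS k => exact fun h => by simp only [STm.interp, k.eval h]
  | bmsg k => exact fun h => by simp only [STm.interp, k.eval h]
  | msg k k' => exact fun h => by simp only [STm.interp, k.eval h, k'.eval h]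
  | quan k => exact fun h => by simp only [STm.interp, k.eval h]
  | intT k => exact fun h => by simp only [STm.interp, k.eval h]
  | lin _ ih => exact fun h => by simp only [STm.interp, ih h]
  | chan k _ _ ih => exact fun h => by simp only [STm.interp, k.eval h, ih h]
  | _ => intros; rfl

/-- The outermost constructor of a type. -/
def STm.tag {D : List Srt} (A : STm D .vtype) (ρ : MEnv D) : Tag := (A.interp ρ).1

/-- The outermost constructor of a closed session type. -/
def STm.stag (p : STm [] .stype) : STag := (p.interp MEnv.nil).1

theorem STm.interp_ofClosed {D : List Srt} (p : STm [] .stype) (ρ : MEnv D) :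
    (p.ofClosed.interp ρ).1 = p.stag := by
  rw [STm.ofClosed, STm.interp_rename, STm.stag]
  congr 2
  funext a x; cases x

/-! ### Progress of terms -/

/-- Canonical forms. -/
inductive ValOf (S : Sig) : Tm → Tag → Prop
  | res {c : ℕ} {R : Set ℤ} {p : STm [] .stype} :
      S c = some p → ValOf S (.ep c R) (.chan R p.stag)
  | lit (n : ℤ) : ValOf S (.lit n) (.intT n)
  | unit : ValOf S .unit .unit
  | lolli (e : Tm) : ValOf S (.lam e) .lolli
  | fn (e : Tm) : ValOf S (.lam e) .fn
  | tensor (v₁ v₂ : Tm) : ValOf S (.pair v₁ v₂) .tensor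
  | prod (v₁ v₂ : Tm) : ValOf S (.pair v₁ v₂) .prod
  | guard (v : Tm) : ValOf S (.guardI v) .guard
  | conj (v : Tm) : ValOf S (.conjI v) .conj
  | all (v : Tm) : ValOf S (.allI v) .all
  | ex (v : Tm) : ValOf S (.exI v) .ex

section

variable {U : Set ℤ} {S : Sig}

/-- Each introduction rule fixes the tag of its type and conversion preserves it, so the tag
determines the form of a closed value. For an endpoint the tag also carries its actual role set and
the tag of its session type in the signature. -/
theorem HasType.valOf {D : List Srt} {P : List (STm D .bool)} {G : Ctx D} {e : Tm}
    {A : STm D .vtype} (h : HasType U S P G e A) :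
    ∀ {ρ : MEnv D}, Sat P ρ.base → G = [] → IsValue e → ValOf S e (A.tag ρ) := by
  induction h with
  | conv _ k ih =>
    intro ρ hρ hG hv
    rw [STm.tag, ← k.interp hρ]
    exact ih hρ hG hv
  | varUn h => rintro ρ hρ rfl; simp at h
  | varLi h => rintro ρ hρ rfl; simp at h
  | res h =>
    intro ρ _ _ _
    simp only [STm.tag, STm.interp, STm.interp_ofClosed]
    exact .res h
  | lit => intros; exact .lit _
  | unit => intros; exact .unit
  | lamLi => intros; exact .lolli _
  | lamUn => intros; exact .fn _
  | pairLi => intros; exact .tensor _ _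
  | pairUn => intros; exact .prod _ _
  | guardI => intros; exact .guard _
  | conjI => intros; exact .conj _
  | allI => intros; exact .all _
  | exI => intros; exact .ex _
  | _ => intro ρ hρ hG hv; cases hv

/-- Redexes that reduce without other threads. -/
inductive Redex (U : Set ℤ) : Tm → Prop
  | contract {e e' : Tm} : Contract e e' → Redex U e
  | spawn (e : Tm) : Redex U (.api1 .spawn (.lam e))
  | fork (e : Tm) {R₁ R₂ : Set ℤ} :
      Disjoint R₁ R₂ → R₁ ∪ R₂ = U → Redex U (.api1 .fork (.lam e))
  | cut (c₁ c₂ : ℕ) (R₁ R₂ : Set ℤ) : Redex U (.api2 .cut (.ep c₁ R₁) (.ep c₂ R₂))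
  | elim (c : ℕ) : Redex U (.api1 .elim (.ep c ∅))
  | split (c : ℕ) (e : Tm) {R₁ R₂ : Set ℤ} :
      Disjoint R₁ R₂ → Redex U (.api2 .split (.ep c (R₁ ∪ R₂)) (.lam e))

/-- Partial redexes on an endpoint of a channel with a given kind of session type. -/
inductive Waits (U : Set ℤ) (c : ℕ) (R : Set ℤ) : STag → Tm → Prop
  | bsend {r : ℤ} {v : Tm} : r ∈ R → IsValue v →
      Waits U c R (.bmsg r) (.api2 .bsend (.ep c R) v)
  | brecv {r : ℤ} : r ∈ U → r ∉ R → Waits U c R (.bmsg r) (.api1 .brecv (.ep c R))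
  | send {r₁ r₂ : ℤ} {v : Tm} : r₁ ∈ R → r₂ ∈ U → r₂ ∉ R → IsValue v →
      Waits U c R (.msg r₁ r₂) (.api2 .send (.ep c R) v)
  | recv {r₁ r₂ : ℤ} : r₁ ∈ U → r₁ ∉ R → r₂ ∈ R →
      Waits U c R (.msg r₁ r₂) (.api1 .recv (.ep c R))
  | skip {r₁ r₂ : ℤ} : (r₁ ∈ R ∧ r₂ ∈ R) ∨ ((r₁ ∈ U ∧ r₁ ∉ R) ∧ r₂ ∈ U ∧ r₂ ∉ R) →
      Waits U c R (.msg r₁ r₂) (.api1 .skip (.ep c R))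
  | close {r : ℤ} : r ∈ R → Waits U c R (.endS r) (.api1 .close (.ep c R))
  | wait {r : ℤ} : r ∈ U → r ∉ R → Waits U c R (.endS r) (.api1 .wait (.ep c R))
  | unify {r : ℤ} : r ∈ R → Waits U c R (.quan r) (.api1 .unify (.ep c R))
  | exify {r : ℤ} : r ∈ U → r ∉ R → Waits U c R (.quan r) (.api1 .exify (.ep c R))

/-- The term is of the form `E[e]` with a redex or a partial redex `e`. -/
def Active (U : Set ℤ) (S : Sig) (e : Tm) : Prop :=
  ∃ (E : ECtx) (r : Tm), e = E.fill r ∧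
    (Redex U r ∨ ∃ c R p, S c = some p ∧ Waits U c R p.stag r)

theorem Redex.active {e : Tm} (h : Redex U e) : Active U S e := ⟨.hole, e, rfl, .inl h⟩

theorem Waits.active {e : Tm} {c : ℕ} {R : Set ℤ} {p : STm [] .stype} (hp : S c = some p)
    {T : STag} (hT : T = p.stag) (h : Waits U c R T e) : Active U S e :=
  ⟨.hole, e, rfl, .inr ⟨c, R, p, hp, hT ▸ h⟩⟩

theorem ValOf.chan_inv {v : Tm} {R : Set ℤ} {T : STag} (h : ValOf S v (.chan R T)) :
    ∃ c p, v = .ep c R ∧ S c = some p ∧ T = p.stag := by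
  cases h with
  | res h => exact ⟨_, _, rfl, h, rfl⟩

theorem Active.frame {e : Tm} (h : Active U S e) {F : Tm → Tm} {K : ECtx → ECtx}
    (hF : ∀ E r, (K E).fill r = F (E.fill r)) : Active U S (F e) := by
  obtain ⟨E, r, rfl, h⟩ := h
  exact ⟨K E, r, (hF E r).symm, h⟩

theorem active_api1 {f : Api1} {e : Tm} (h : IsValue e ∨ Active U S e)
    (k : IsValue e → Active U S (.api1 f e)) : Active U S (.api1 f e) :=
  h.elim k fun h => h.frame (K := .api1 f) fun _ _ => rfl

theorem active_api2 {f : Api2} {e₁ e₂ : Tm} (h₁ : IsValue e₁ ∨ Active U S e₁)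
    (h₂ : IsValue e₂ ∨ Active U S e₂)
    (k : IsValue e₁ → IsValue e₂ → Active U S (.api2 f e₁ e₂)) :
    Active U S (.api2 f e₁ e₂) := by
  rcases h₁ with h₁ | h₁
  · rcases h₂ with h₂ | h₂
    · exact k h₁ h₂
    · exact h₂.frame (K := .api2R f e₁ h₁) (F := .api2 f e₁) fun _ _ => rfl
  · exact h₁.frame (K := fun E => .api2L f E e₂) (F := fun e => .api2 f e e₂) fun _ _ => rfl

theorem active_app {e₁ e₂ : Tm} (h₁ : IsValue e₁ ∨ Active U S e₁)
    (h₂ : IsValue e₂ ∨ Active U S e₂)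
    (k : IsValue e₁ → ∃ e, e₁ = .lam e) : Active U S (.app e₁ e₂) := by
  rcases h₁ with h₁ | h₁
  · rcases h₂ with h₂ | h₂
    · obtain ⟨e, rfl⟩ := k h₁
      exact (Redex.contract (.beta h₂)).active
    · exact h₂.frame (K := .appR e₁ h₁) (F := .app e₁) fun _ _ => rfl
  · exact h₁.frame (K := fun E => .appL E e₂) (F := fun e => .app e e₂) fun _ _ => rfl

theorem active_pair {e₁ e₂ : Tm} (h₁ : IsValue e₁ ∨ Active U S e₁)
    (h₂ : IsValue e₂ ∨ Active U S e₂) : IsValue (.pair e₁ e₂) ∨ Active U S (.pair e₁ e₂) := by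
  rcases h₁ with h₁ | h₁
  · rcases h₂ with h₂ | h₂
    · exact .inl (.pair h₁ h₂)
    · exact .inr (h₂.frame (K := .pairR e₁ h₁) (F := .pair e₁) fun _ _ => rfl)
  · exact .inr (h₁.frame (K := fun E => .pairL E e₂) (F := fun e => .pair e e₂)
      fun _ _ => rfl)

/-- A well-typed closed term is a value or has a redex or a partial redex. -/
theorem HasType.progress {D : List Srt} {P : List (STm D .bool)} {G : Ctx D} {e : Tm}
    {A : STm D .vtype} (h : HasType U S P G e A) :
    ∀ {ρ : MEnv D}, Sat P ρ.base → G = [] → IsValue e ∨ Active U S e := by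
  induction h with
  | conv _ _ ih => exact fun hρ hG => ih hρ hG
  | varUn | varLi => exact fun _ _ => .inl (.var _)
  | res => exact fun _ _ => .inl (.res _)
  | lit => exact fun _ _ => .inl (.lit _)
  | unit => exact fun _ _ => .inl .unit
  | lamLi | lamUn => exact fun _ _ => .inl (.lam _)
  | guardI hv => exact fun _ _ => .inl (.guardI hv)
  | allI hv => exact fun _ _ => .inl (.allI hv)
  | appLi s t₁ _ ih₁ ih₂ =>
    rintro ρ hρ rfl
    obtain ⟨rfl, rfl⟩ := s.nil_inv
    refine .inr (active_app (ih₁ hρ rfl) (ih₂ hρ rfl) fun hv => ?_)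
    have : ValOf S _ .lolli := t₁.valOf hρ rfl hv
    cases this
    exact ⟨_, rfl⟩
  | appUn s t₁ _ ih₁ ih₂ =>
    rintro ρ hρ rfl
    obtain ⟨rfl, rfl⟩ := s.nil_inv
    refine .inr (active_app (ih₁ hρ rfl) (ih₂ hρ rfl) fun hv => ?_)
    have : ValOf S _ .fn := t₁.valOf hρ rfl hv
    cases this
    exact ⟨_, rfl⟩
  | pairLi s _ _ ih₁ ih₂ | pairUn s _ _ ih₁ ih₂ =>
    rintro ρ hρ rfl
    obtain ⟨rfl, rfl⟩ := s.nil_inv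
    exact active_pair (ih₁ hρ rfl) (ih₂ hρ rfl)
  | fst t ih =>
    rintro ρ hρ rfl
    rcases ih hρ rfl with hv | h
    · have : ValOf S _ .prod := t.valOf hρ rfl hv
      cases this
      cases hv with
      | pair h₁ h₂ => exact .inr (Redex.contract (.fst h₁ h₂)).active
    · exact .inr (h.frame (K := .fst) fun _ _ => rfl)
  | snd t ih =>
    rintro ρ hρ rfl
    rcases ih hρ rfl with hv | h
    · have : ValOf S _ .prod := t.valOf hρ rfl hv
      cases this
      cases hv with
      | pair h₁ h₂ => exact .inr (Redex.contract (.snd h₁ h₂)).active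
    · exact .inr (h.frame (K := .snd) fun _ _ => rfl)
  | @letPair _ _ _ _ _ _ _ _ e₂ _ _ _ s t _ _ _ ih =>
    rintro ρ hρ rfl
    obtain ⟨rfl, rfl⟩ := s.nil_inv
    rcases ih hρ rfl with hv | h
    · have : ValOf S _ .tensor := t.valOf hρ rfl hv
      cases this
      cases hv with
      | pair h₁ h₂ => exact .inr (Redex.contract (.letPair h₁ h₂)).active
    · exact .inr (h.frame (K := fun E => .letPair E e₂) (F := fun e => .letPair e e₂)
        fun _ _ => rfl)
  | guardE t _ ih =>
    rintro ρ hρ rfl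
    rcases ih hρ rfl with hv | h
    · have : ValOf S _ .guard := t.valOf hρ rfl hv
      cases this
      cases hv with
      | guardI h => exact .inr (Redex.contract (.guard h)).active
    · exact .inr (h.frame (K := .guardE) fun _ _ => rfl)
  | conjI t _ ih =>
    rintro ρ hρ rfl
    rcases ih hρ rfl with hv | h
    · exact .inl (.conjI hv)
    · exact .inr (h.frame (K := .conjI) fun _ _ => rfl)
  | @letConj _ _ _ _ _ _ _ e₂ _ _ _ s t _ _ ih =>
    rintro ρ hρ rfl
    obtain ⟨rfl, rfl⟩ := s.nil_inv
    rcases ih hρ rfl with hv | h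
    · have : ValOf S _ .conj := t.valOf hρ rfl hv
      cases this
      cases hv with
      | conjI h => exact .inr (Redex.contract (.letConj h)).active
    · exact .inr (h.frame (K := fun E => .letConj E e₂) (F := fun e => .letConj e e₂)
        fun _ _ => rfl)
  | allE s t ih =>
    rintro ρ hρ rfl
    rcases ih hρ rfl with hv | h
    · have : ValOf S _ .all := t.valOf hρ rfl hv
      cases this
      cases hv with
      | allI h => exact .inr (Redex.contract (.all h)).active
    · exact .inr (h.frame (K := .allE) fun _ _ => rfl)
  | exI s t ih =>
    rintro ρ hρ rfl
    rcases ih hρ rfl with hv | h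
    · exact .inl (.exI hv)
    · exact .inr (h.frame (K := .exI) fun _ _ => rfl)
  | @letEx _ _ _ _ _ _ e₂ _ _ _ _ s t _ _ ih =>
    rintro ρ hρ rfl
    obtain ⟨rfl, rfl⟩ := s.nil_inv
    rcases ih hρ rfl with hv | h
    · have : ValOf S _ .ex := t.valOf hρ rfl hv
      cases this
      cases hv with
      | exI h => exact .inr (Redex.contract (.letEx h)).active
    · exact .inr (h.frame (K := fun E => .letEx E e₂) (F := fun e => .letEx e e₂)
        fun _ _ => rfl)
  | arith o s t₁ t₂ hd ih₁ ih₂ =>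
    rintro ρ hρ rfl
    obtain ⟨rfl, rfl⟩ := s.nil_inv
    refine .inr (active_api2 (ih₁ hρ rfl) (ih₂ hρ rfl) fun hv₁ hv₂ => ?_)
    have k₁ : ValOf S _ (.intT _) := t₁.valOf hρ rfl hv₁
    have k₂ : ValOf S _ (.intT _) := t₂.valOf hρ rfl hv₂
    cases k₁
    cases k₂
    -- The divisor is the value of its index under `ρ`, and the entailed constraint says that this
    -- value is not zero.
    exact (Redex.contract (.arith fun h => hd h _ hρ)).active
  | spawn t ih =>
    rintro ρ hρ rfl
    refine .inr (active_api1 (ih hρ rfl) fun hv => ?_)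
    have k : ValOf S _ .lolli := t.valOf hρ rfl hv
    cases k
    exact (Redex.spawn _).active
  | fork he t ih =>
    rintro ρ hρ rfl
    refine .inr (active_api1 (ih hρ rfl) fun hv => ?_)
    have k : ValOf S _ .lolli := t.valOf hρ rfl hv
    cases k
    -- The role sets chosen for the step are the values of `s₁` and `s₂`; the entailed constraint
    -- says that they partition `U`.
    obtain ⟨h₁, h₂⟩ := he _ hρ
    exact (Redex.fork _ (Set.disjoint_iff_inter_eq_empty.2 h₁) h₂).active
  | cut s _ t₁ t₂ ih₁ ih₂ =>
    rintro ρ hρ rfl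
    obtain ⟨rfl, rfl⟩ := s.nil_inv
    refine .inr (active_api2 (ih₁ hρ rfl) (ih₂ hρ rfl) fun hv₁ hv₂ => ?_)
    have k₁ : ValOf S _ (.chan _ _) := t₁.valOf hρ rfl hv₁
    have k₂ : ValOf S _ (.chan _ _) := t₂.valOf hρ rfl hv₂
    obtain ⟨c₁, p₁, rfl, -, -⟩ := k₁.chan_inv
    obtain ⟨c₂, p₂, rfl, -, -⟩ := k₂.chan_inv
    exact (Redex.cut _ _ _ _).active
  | elim t ih =>
    rintro ρ hρ rfl
    refine .inr (active_api1 (ih hρ rfl) fun hv => ?_)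
    have k : ValOf S _ (.chan ∅ _) := t.valOf hρ rfl hv
    obtain ⟨c, p, rfl, -, -⟩ := k.chan_inv
    exact (Redex.elim _).active
  | split s he t₁ t₂ ih₁ ih₂ =>
    rintro ρ hρ rfl
    obtain ⟨rfl, rfl⟩ := s.nil_inv
    refine .inr (active_api2 (ih₁ hρ rfl) (ih₂ hρ rfl) fun hv₁ hv₂ => ?_)
    -- The role set of the endpoint is the value of `s₁ ∪ s₂`, hence literally a union of the form
    -- that the step for `split` requires.
    have k₁ : ValOf S _ (.chan (_ ∪ _) _) := t₁.valOf hρ rfl hv₁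
    have k₂ : ValOf S _ .lolli := t₂.valOf hρ rfl hv₂
    obtain ⟨c, p, rfl, -, -⟩ := k₁.chan_inv
    cases k₂
    exact (Redex.split _ _ (Set.disjoint_iff_inter_eq_empty.2 (he _ hρ))).active
  | bsend s he t₁ _ ih₁ ih₂ =>
    rintro ρ hρ rfl
    obtain ⟨rfl, rfl⟩ := s.nil_inv
    refine .inr (active_api2 (ih₁ hρ rfl) (ih₂ hρ rfl) fun hv₁ hv₂ => ?_)
    have k₁ : ValOf S _ (.chan _ (.bmsg _)) := t₁.valOf hρ rfl hv₁
    obtain ⟨c, p, rfl, hp, hT⟩ := k₁.chan_inv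
    exact (Waits.bsend (he _ hρ) hv₂).active hp hT
  | brecv he t ih =>
    rintro ρ hρ rfl
    refine .inr (active_api1 (ih hρ rfl) fun hv => ?_)
    have k : ValOf S _ (.chan _ (.bmsg _)) := t.valOf hρ rfl hv
    obtain ⟨c, p, rfl, hp, hT⟩ := k.chan_inv
    obtain ⟨h₁, h₂⟩ := he _ hρ
    exact (Waits.brecv h₁ h₂).active hp hT
  | send s he t₁ _ ih₁ ih₂ =>
    rintro ρ hρ rfl
    obtain ⟨rfl, rfl⟩ := s.nil_inv
    refine .inr (active_api2 (ih₁ hρ rfl) (ih₂ hρ rfl) fun hv₁ hv₂ => ?_)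
    have k₁ : ValOf S _ (.chan _ (.msg _ _)) := t₁.valOf hρ rfl hv₁
    obtain ⟨c, p, rfl, hp, hT⟩ := k₁.chan_inv
    obtain ⟨h₁, h₂, h₃⟩ := he _ hρ
    exact (Waits.send h₁ h₂ h₃ hv₂).active hp hT
  | recv he t ih =>
    rintro ρ hρ rfl
    refine .inr (active_api1 (ih hρ rfl) fun hv => ?_)
    have k : ValOf S _ (.chan _ (.msg _ _)) := t.valOf hρ rfl hv
    obtain ⟨c, p, rfl, hp, hT⟩ := k.chan_inv
    obtain ⟨⟨h₁, h₂⟩, h₃⟩ := he _ hρ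
    exact (Waits.recv h₁ h₂ h₃).active hp hT
  | skip he t ih =>
    rintro ρ hρ rfl
    refine .inr (active_api1 (ih hρ rfl) fun hv => ?_)
    have k : ValOf S _ (.chan _ (.msg _ _)) := t.valOf hρ rfl hv
    obtain ⟨c, p, rfl, hp, hT⟩ := k.chan_inv
    exact (Waits.skip (he _ hρ)).active hp hT
  | close he t ih =>
    rintro ρ hρ rfl
    refine .inr (active_api1 (ih hρ rfl) fun hv => ?_)
    have k : ValOf S _ (.chan _ (.endS _)) := t.valOf hρ rfl hv
    obtain ⟨c, p, rfl, hp, hT⟩ := k.chan_inv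
    exact (Waits.close (he _ hρ)).active hp hT
  | wait he t ih =>
    rintro ρ hρ rfl
    refine .inr (active_api1 (ih hρ rfl) fun hv => ?_)
    have k : ValOf S _ (.chan _ (.endS _)) := t.valOf hρ rfl hv
    obtain ⟨c, p, rfl, hp, hT⟩ := k.chan_inv
    obtain ⟨h₁, h₂⟩ := he _ hρ
    exact (Waits.wait h₁ h₂).active hp hT
  | unify he t ih =>
    rintro ρ hρ rfl
    refine .inr (active_api1 (ih hρ rfl) fun hv => ?_)
    have k : ValOf S _ (.chan _ (.quan _)) := t.valOf hρ rfl hv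
    obtain ⟨c, p, rfl, hp, hT⟩ := k.chan_inv
    exact (Waits.unify (he _ hρ)).active hp hT
  | exify he t ih =>
    rintro ρ hρ rfl
    refine .inr (active_api1 (ih hρ rfl) fun hv => ?_)
    have k : ValOf S _ (.chan _ (.quan _)) := t.valOf hρ rfl hv
    obtain ⟨c, p, rfl, hp, hT⟩ := k.chan_inv
    obtain ⟨h₁, h₂⟩ := he _ hρ
    exact (Waits.exify h₁ h₂).active hp hT

end

/-! ### Progress of pools -/

theorem Pool.exists_fresh (Q : Pool) : ∃ c, Q.Fresh c := by
  obtain ⟨c, hc⟩ := Infinite.exists_notMem_finset (Q.resources.map Endpoint.ch).toFinset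
  refine ⟨c, fun x hx e => hc ?_⟩
  rw [Multiset.mem_toFinset, ← e]
  exact Multiset.mem_map_of_mem _ hx

theorem Redex.step {U : Set ℤ} {Q : Pool} {t : ℕ} {E : ECtx} {e : Tm} (h : Redex U e)
    (k : Q.get t = some (E.fill e)) : ∃ Q', Step U Q Q' := by
  obtain ⟨t', ht'⟩ := Infinite.exists_notMem_finset Q.dom
  obtain ⟨c, hc⟩ := Q.exists_fresh
  cases h with
  | contract h => exact ⟨_, .lift k (.ctx E h)⟩
  | spawn => exact ⟨_, .spawn k ht'⟩
  | fork _ h h' => exact ⟨_, .fork k ht' hc h h'⟩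
  | cut => exact ⟨_, .cut k hc⟩
  | elim => exact ⟨_, .elim k⟩
  | split _ _ h => exact ⟨_, .split k ht' h⟩

theorem Waits.mem_resources {U : Set ℤ} {c : ℕ} {R : Set ℤ} {T : STag} {e : Tm}
    (h : Waits U c R T e) : ⟨c, R⟩ ∈ e.resources := by
  cases h <;> simp [Tm.resources]

/-! #### Consistent channels -/

/-- A consistent multiset is built by adding all endpoints of a channel in one block, and later
blocks belong to other channels. The existence of an endpoint is needed because nothing is known
about an absent channel. -/
theorem Consistent.rolePartition {U : Set ℤ} {M : Multiset Endpoint} (h : Consistent U M)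
    {c : ℕ} : (∃ x ∈ M, x.ch = c) →
      RolePartition U ((M.filter fun x => x.ch = c).map Endpoint.roles) := by
  induction h with
  | empty => simp
  | @add M d S hM hd hS ih =>
    intro hx
    rw [Multiset.filter_add]
    by_cases hc : d = c
    · subst hc
      rw [Multiset.filter_eq_nil.2 hd, zero_add, Multiset.filter_eq_self.2 (by simp),
        Multiset.map_map]
      simpa [Function.comp_def] using hS
    · rw [Multiset.filter_eq_nil (s := S.map _) |>.2 (by simp [hc]), add_zero]
      obtain ⟨x, hx, rfl⟩ := hx
      rcases Multiset.mem_add.1 hx with hx | hx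
      · exact ih ⟨x, hx, rfl⟩
      · obtain ⟨R, -, rfl⟩ := Multiset.mem_map.1 hx
        exact absurd rfl hc

theorem RolePartition.disjoint {U : Set ℤ} {T : Finset ℕ} {R : ℕ → Set ℤ}
    (h : RolePartition U (T.val.map R)) {t u : ℕ} (ht : t ∈ T) (hu : u ∈ T) (hne : t ≠ u) :
    Disjoint (R t) (R u) := by
  have h := h.1
  have : Std.Symm fun t u => Disjoint (R t) (R u) := ⟨fun _ _ k => k.symm⟩
  have : Std.Symm (Disjoint (α := Set ℤ)) := ⟨fun _ _ k => k.symm⟩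
  rw [← Finset.coe_toList, Multiset.map_coe, Multiset.pairwise_coe_iff_pairwise,
    List.pairwise_map] at h
  exact h.forall (Finset.mem_toList.2 ht) (Finset.mem_toList.2 hu) hne

theorem RolePartition.existsUnique {U : Set ℤ} {T : Finset ℕ} {R : ℕ → Set ℤ}
    (h : RolePartition U (T.val.map R)) {r : ℤ} (hr : r ∈ U) :
    ∃ t ∈ T, r ∈ R t ∧ ∀ u ∈ T, r ∈ R u → u = t := by
  have hr' := hr
  rw [← h.2] at hr'
  obtain ⟨_, hR, hr'⟩ := hr'
  obtain ⟨t, ht, rfl⟩ := Multiset.mem_map.1 hR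
  exact ⟨t, ht, hr', fun u hu hru => by
    by_contra hne
    exact Set.disjoint_left.1 (h.disjoint hu ht hne) hru hr'⟩

theorem RolePartition.subset {U : Set ℤ} {T : Finset ℕ} {R : ℕ → Set ℤ}
    (h : RolePartition U (T.val.map R)) {t : ℕ} (ht : t ∈ T) : R t ⊆ U := fun r hr => by
  rw [← h.2]
  exact ⟨R t, Multiset.mem_map_of_mem R ht, hr⟩

/-! #### A channel at whose endpoints all threads wait -/

/-- The pool with the terms of the threads in `T` replaced. -/
def Pool.update (Q : Pool) (T : Finset ℕ) (g : ℕ → Tm) : Pool where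
  get := fun t => if t ∈ T then some (g t) else Q.get t
  dom := T ∪ Q.dom
  mem_dom := by
    intro t
    by_cases h : t ∈ T <;> simp [h, Q.mem_dom]

theorem Sync.update {Q : Pool} {c : ℕ} {T : Finset ℕ} {R : ℕ → Set ℤ} {E : ℕ → ECtx}
    {a : ℕ → Tm} (b : ℕ → Tm) (h : Q.endpoints c = T.val.map fun t => ⟨c, R t⟩)
    (ha : ∀ t ∈ T, Q.get t = some ((E t).fill (a t))) :
    Sync Q (Q.update T fun t => (E t).fill (b t)) c T R a b :=
  ⟨h, fun t ht => ⟨E t, ha t ht, by simp [Pool.update, ht]⟩, fun t ht => by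
    simp [Pool.update, ht]⟩

/-- All waiting calls refer to the same first action `τ`. A role of `U` belongs to exactly one of
the role sets, so the conditions in `Waits` leave each thread a single possible call, determined by
whether it owns the roles of `τ`. -/
theorem Step.of_waits {U : Set ℤ} {Q : Pool} {c : ℕ} {T : Finset ℕ} {R : ℕ → Set ℤ}
    {E : ℕ → ECtx} {e : ℕ → Tm} {τ : STag} (hT : T.Nonempty)
    (h : Q.endpoints c = T.val.map fun t => ⟨c, R t⟩) (hp : RolePartition U (T.val.map R))
    (hE : ∀ t ∈ T, Q.get t = some ((E t).fill (e t))) (hw : ∀ t ∈ T, Waits U c (R t) τ (e t)) :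
    ∃ Q', Step U Q Q' := by
  have hsync : ∀ a b : ℕ → Tm, (∀ t ∈ T, e t = a t) → ∃ Q', Sync Q Q' c T R a b :=
    fun a b hab => ⟨_, Sync.update (E := E) b h fun t ht => by rw [hE t ht, hab t ht]⟩
  obtain ⟨t₀, ht₀⟩ := hT
  cases τ with
  | bmsg r =>
    -- Any one participant shows this: either it owns the role, or its call requires the role to lie
    -- in the complement within `U`.
    have hr : r ∈ U := by
      have hx := hw t₀ ht₀
      generalize e t₀ = x at hx
      cases hx with
      | bsend h => exact hp.subset ht₀ h
      | brecv h => exact h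
    obtain ⟨t₁, ht₁, hr₁, hu⟩ := hp.existsUnique hr
    have : ∃ v, IsValue v ∧ e t₁ = .api2 .bsend (.ep c (R t₁)) v := by
      have hx := hw t₁ ht₁
      generalize e t₁ = x at hx ⊢
      cases hx with
      | bsend _ hv => exact ⟨_, hv, rfl⟩
      | brecv _ h => exact absurd hr₁ h
    obtain ⟨v, hv, he⟩ := this
    obtain ⟨Q', k⟩ := hsync
      (fun t => if t = t₁ then .api2 .bsend (.ep c (R t)) v else .api1 .brecv (.ep c (R t)))
      (fun t => if t = t₁ then .ep c (R t) else .pair (.ep c (R t)) v) fun t ht => by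
        split_ifs with htt
        · rw [htt, he]
        · have hx := hw t ht
          generalize e t = x at hx ⊢
          cases hx with
          | bsend h => exact absurd (hu t ht h) htt
          | brecv => rfl
    exact ⟨Q', .bmsg ht₁ hv k⟩
  | endS r =>
    have hr : r ∈ U := by
      have hx := hw t₀ ht₀
      generalize e t₀ = x at hx
      cases hx with
      | close h => exact hp.subset ht₀ h
      | wait h => exact h
    obtain ⟨t₁, ht₁, hr₁, hu⟩ := hp.existsUnique hr
    obtain ⟨Q', k⟩ := hsync
      (fun t => if t = t₁ then .api1 .close (.ep c (R t)) else .api1 .wait (.ep c (R t)))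
      (fun _ => .unit) fun t ht => by
        have hx := hw t ht
        generalize e t = x at hx ⊢
        cases hx with
        | close h => simp [hu t ht h]
        | wait _ h =>
          rw [if_neg]
          rintro rfl
          exact h hr₁
    exact ⟨Q', .endS ht₁ k⟩
  | quan r =>
    have hr : r ∈ U := by
      have hx := hw t₀ ht₀
      generalize e t₀ = x at hx
      cases hx with
      | unify h => exact hp.subset ht₀ h
      | exify h => exact h
    obtain ⟨t₁, ht₁, hr₁, hu⟩ := hp.existsUnique hr
    obtain ⟨Q', k⟩ := hsync
      (fun t => if t = t₁ then .api1 .unify (.ep c (R t)) else .api1 .exify (.ep c (R t)))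
      (fun t => .ep c (R t)) fun t ht => by
        have hx := hw t ht
        generalize e t = x at hx ⊢
        cases hx with
        | unify h => simp [hu t ht h]
        | exify _ h =>
          rw [if_neg]
          rintro rfl
          exact h hr₁
    exact ⟨Q', .quan ht₁ k⟩
  | msg r₁ r₂ =>
    have hr : r₁ ∈ U ∧ r₂ ∈ U := by
      have hx := hw t₀ ht₀
      generalize e t₀ = x at hx
      cases hx with
      | send h₁ h₂ => exact ⟨hp.subset ht₀ h₁, h₂⟩
      | recv h₁ _ h₂ => exact ⟨h₁, hp.subset ht₀ h₂⟩
      | skip h =>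
        rcases h with ⟨h₁, h₂⟩ | ⟨h₁, h₂⟩
        · exact ⟨hp.subset ht₀ h₁, hp.subset ht₀ h₂⟩
        · exact ⟨h₁.1, h₂.1⟩
    obtain ⟨t₁, ht₁, hr₁, hu₁⟩ := hp.existsUnique hr.1
    obtain ⟨t₂, ht₂, hr₂, hu₂⟩ := hp.existsUnique hr.2
    -- If one endpoint owns both the sending and the receiving role, nobody can call `send` or
    -- `recv`, and all threads skip.
    by_cases hne : t₁ = t₂
    · subst hne
      obtain ⟨Q', k⟩ := hsync (fun t => .api1 .skip (.ep c (R t))) (fun t => .ep c (R t))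
        fun t ht => by
          have hx := hw t ht
          generalize e t = x at hx ⊢
          cases hx with
          | skip => rfl
          | send h₁ _ h₂ => exact absurd hr₂ (hu₁ t ht h₁ ▸ h₂)
          | recv _ h₁ h₂ => exact absurd hr₁ (hu₂ t ht h₂ ▸ h₁)
      exact ⟨Q', .skip ⟨t₁, ht₁⟩ k⟩
    · have : ∃ v, IsValue v ∧ e t₁ = .api2 .send (.ep c (R t₁)) v := by
        have hx := hw t₁ ht₁
        generalize e t₁ = x at hx ⊢
        cases hx with
        | send _ _ _ hv => exact ⟨_, hv, rfl⟩
        | recv _ h => exact absurd hr₁ h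
        | skip h =>
          rcases h with ⟨-, h⟩ | ⟨h, -⟩
          · exact absurd (hu₂ t₁ ht₁ h) hne
          · exact absurd hr₁ h.2
      obtain ⟨v, hv, he⟩ := this
      obtain ⟨Q', k⟩ := hsync
        (fun t => if t = t₁ then .api2 .send (.ep c (R t)) v
          else if t = t₂ then .api1 .recv (.ep c (R t)) else .api1 .skip (.ep c (R t)))
        (fun t => if t = t₂ then .pair (.ep c (R t)) v else .ep c (R t)) fun t ht => by
          split_ifs with h₁ h₂
          · rw [h₁, he]
          · subst h₂
            have hx := hw t ht
            generalize e t = x at hx ⊢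
            cases hx with
            | send _ _ h => exact absurd hr₂ h
            | recv => rfl
            | skip h =>
              rcases h with ⟨h, -⟩ | ⟨-, h⟩
              · exact absurd (hu₁ t ht h) h₁
              · exact absurd hr₂ h.2
          · have hx := hw t ht
            generalize e t = x at hx ⊢
            cases hx with
            | send h => exact absurd (hu₁ t ht h) h₁
            | recv _ _ h => exact absurd (hu₂ t ht h) h₂
            | skip => rfl
      exact ⟨Q', .msg ht₁ ht₂ hne hv k⟩

theorem Multiset.countP_mem_eq_sum (C : Finset ℕ) (m : Multiset ℕ) :
    m.countP (· ∈ C) = ∑ c ∈ C, m.countP (· = c) := by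
  induction m using Multiset.induction with
  | empty => simp
  | cons a m ih => simp [Multiset.countP_cons, ih, Finset.sum_add_distrib]

/-- If each thread of `B` waits on a channel of its own, then all endpoints in `B` of one of
these channels are waited on. -/
theorem Acyclic.exists_channel {M : ℕ → Multiset ℕ} (h : Acyclic M) {B : Finset ℕ}
    (hB : B.Nonempty) (f : ℕ → ℕ) : ∃ t₀ ∈ B,
      ∑ t ∈ B, (M t).countP (· = f t₀) ≤ (B.filter fun t => f t = f t₀).card := by
  by_contra! hlt
  have h₁ : ∀ c ∈ B.image f,
      (B.filter fun t => f t = c).card + 1 ≤ ∑ t ∈ B, (M t).countP (· = c) := by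
    intro c hc
    obtain ⟨t, ht, rfl⟩ := Finset.mem_image.1 hc
    exact hlt t ht
  have h₂ := Finset.sum_le_sum h₁
  -- Summing the fibres of `f` gives at least `|B| + |f(B)|` edges between `B` and its image, as
  -- many as there are vertices, which a forest forbids.
  rw [Finset.sum_add_distrib, Finset.sum_const, smul_eq_mul, mul_one,
    ← Finset.card_eq_sum_card_image, Finset.sum_comm] at h₂
  have h₃ := h B (B.image f) (.inl hB)
  simp only [Multiset.countP_mem_eq_sum] at h₃
  omega

/-- The endpoints waited on are contained in those of the channel, and `Acyclic.exists_channel`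
bounds the number of the latter by the number of waiting threads, so the two multisets agree.
Threads outside `B` hold no endpoints and do not affect the count. -/
theorem Pool.exists_complete_channel {Q : Pool} (h : Acyclic Q.chans) {B : Finset ℕ}
    (hB : B.Nonempty) {f : ℕ → ℕ} {R : ℕ → Set ℤ} {e : ℕ → Tm}
    (he : ∀ t ∈ B, Q.get t = some (e t)) (hR : ∀ t ∈ B, ⟨f t, R t⟩ ∈ (e t).resources)
    (hQ : ∀ t ∈ Q.dom, t ∉ B → Q.chans t = 0) :
    ∃ t₀ ∈ B, Q.endpoints (f t₀) =
      (B.filter fun t => f t = f t₀).val.map fun t => ⟨f t₀, R t⟩ := by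
  obtain ⟨t₀, ht₀, hle⟩ := h.exists_channel hB f
  have hBd : B ⊆ Q.dom := fun t ht => (Q.mem_dom t).2 (by simp [he t ht])
  refine ⟨t₀, ht₀, (Multiset.eq_of_le_of_card_le ?_ ?_).symm⟩
  · rw [Pool.endpoints, Multiset.le_filter]
    refine ⟨?_, fun x hx => by obtain ⟨t, -, rfl⟩ := Multiset.mem_map.1 hx; rfl⟩
    -- The multiset is written as a sum of singletons in order to compare it with `Q.resources`
    -- thread by thread.
    rw [← Multiset.sum_map_singleton (Multiset.map _ _), Multiset.map_map]
    refine (Finset.sum_le_sum (g := fun t => (Q.get t).elim 0 Tm.resources)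
      fun t ht => ?_).trans (Finset.sum_le_sum_of_subset ?_)
    · obtain ⟨ht, hf⟩ := Finset.mem_filter.1 ht
      rw [Function.comp_apply, ← hf, he t ht]
      exact Multiset.singleton_le.2 (hR t ht)
    · exact (Finset.filter_subset _ _).trans hBd
  · rw [Q.card_endpoints, Multiset.card_map, Finset.card_val,
      ← Finset.sum_subset hBd fun t ht ht' => by simp [hQ t ht ht']]
    exact hle

theorem Pool.eq_single {Q : Pool} {t : ℕ} {e : Tm} (h : Q.get t = some e)
    (hQ : ∀ u ∈ Q.dom, u = t) : Q = Pool.single t e := by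
  refine Pool.ext (funext fun u => ?_) (Finset.ext fun u => ?_)
  · by_cases hu : u = t
    · simp [Pool.single, Pool.set, hu, h]
    · have : u ∉ Q.dom := fun k => hu (hQ u k)
      rw [Q.mem_dom, not_not] at this
      simp [Pool.single, Pool.set, Pool.empty, hu, this]
  · simp only [Pool.single, Pool.set, Pool.empty, Finset.mem_insert, Finset.notMem_empty,
      or_false]
    refine ⟨hQ u, ?_⟩
    rintro rfl
    simp [Q.mem_dom, h]

theorem HasType.value_or_active {U : Set ℤ} {S : Sig} {e : Tm} {A : STm [] .vtype}
    (h : HasType U S [] [] e A) : IsValue e ∨ Active U S e :=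
  h.progress (ρ := MEnv.nil) (fun _ h => by simp at h) rfl

theorem HasType.eq_unit {U : Set ℤ} {S : Sig} {e : Tm} (h : HasType U S (D := []) [] [] e .one)
    (hv : IsValue e) : e = .unit := by
  have k : ValOf S e .unit := h.valOf (ρ := MEnv.nil) (fun _ h => by simp at h) rfl hv
  cases k
  rfl

/-- In a pool without steps every non-value thread waits on an endpoint, since any other redex would
reduce on its own. Acyclicity supplies a channel on which all endpoints are waited on, and
consistency makes it synchronise. -/
theorem PoolTyped.progress {U : Set ℤ} {S : Sig} {Q : Pool} {A : STm [] .vtype}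
    (hQ : PoolTyped U S Q A) (hac : Acyclic Q.chans) (hcons : Consistent U Q.resources)
    (hmain : ∀ v, Q.get 0 = some v → IsValue v → v.resources = 0) :
    (∃ v, IsValue v ∧ Q = Pool.single 0 v) ∨ ∃ Q', Step U Q Q' := by
  by_contra! hcon
  obtain ⟨hval, hstep⟩ := hcon
  obtain ⟨⟨e₀, he₀, ht₀⟩, htu⟩ := hQ
  have htyped : ∀ t e, Q.get t = some e → ∃ B, HasType U S (D := []) [] [] e B := by
    intro t e he
    rcases Nat.eq_zero_or_pos t with rfl | ht
    · rw [he₀] at he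
      cases he
      exact ⟨A, ht₀⟩
    · exact ⟨_, htu t e ht he⟩
  have hwait : ∀ t e, Q.get t = some e → ¬ IsValue e → ∃ x : ECtx × Tm × ℕ × Set ℤ,
      Q.get t = some (x.1.fill x.2.1) ∧
        ∃ p, S x.2.2.1 = some p ∧ Waits U x.2.2.1 x.2.2.2 p.stag x.2.1 := by
    intro t e he hv
    obtain ⟨B, hB⟩ := htyped t e he
    rcases hB.value_or_active with k | ⟨E, r, rfl, k | ⟨c, R, p, hp, hw⟩⟩
    · exact absurd k hv
    · obtain ⟨Q', k⟩ := k.step he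
      exact absurd k (hstep Q')
    · exact ⟨⟨E, r, c, R⟩, he, p, hp, hw⟩
  -- A value in any other thread is the unit value, and the thread would be removed.
  have hvalue : ∀ t e, Q.get t = some e → IsValue e → t = 0 := by
    intro t e he hv
    by_contra ht
    have ht := Nat.pos_of_ne_zero ht
    obtain rfl := (htu t e ht he).eq_unit hv
    exact hstep _ (.gc ht he)
  classical
  set B := Q.dom.filter fun t => ∃ e, Q.get t = some e ∧ ¬ IsValue e with hB
  have hnB : ∀ t ∈ Q.dom, t ∉ B → t = 0 ∧ ∃ e, Q.get t = some e ∧ IsValue e := by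
    intro t ht htB
    obtain ⟨e, he⟩ := Option.ne_none_iff_exists'.1 ((Q.mem_dom t).1 ht)
    have hv : IsValue e := by
      by_contra hv
      exact htB (Finset.mem_filter.2 ⟨ht, e, he, hv⟩)
    exact ⟨hvalue t e he hv, e, he, hv⟩
  -- If nobody waits, only the main thread is left and it is a value, which is the first alternative
  -- of the theorem.
  rcases B.eq_empty_or_nonempty with hB₀ | hBne
  · have h₀ : 0 ∈ Q.dom := (Q.mem_dom 0).2 (by simp [he₀])
    obtain ⟨-, v, hv, hv'⟩ := hnB 0 h₀ (by simp [hB₀])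
    exact hval v hv' (Pool.eq_single hv fun u hu => (hnB u hu (by simp [hB₀])).1)
  have hx : ∀ t, ∃ x : ECtx × Tm × ℕ × Set ℤ, t ∈ B → Q.get t = some (x.1.fill x.2.1) ∧
      ∃ p, S x.2.2.1 = some p ∧ Waits U x.2.2.1 x.2.2.2 p.stag x.2.1 := by
    intro t
    by_cases ht : t ∈ B
    · obtain ⟨-, e, he, hv⟩ := Finset.mem_filter.1 ht
      obtain ⟨x, hx⟩ := hwait t e he hv
      exact ⟨x, fun _ => hx⟩
    -- An irrelevant default for threads outside `B`, so that the choice function is total.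
    · exact ⟨⟨.hole, .unit, 0, ∅⟩, fun h => absurd h ht⟩
  choose x hx using hx
  obtain ⟨t₀, ht₀, hend⟩ := Pool.exists_complete_channel hac hBne
    (f := fun t => (x t).2.2.1) (R := fun t => (x t).2.2.2) (fun t ht => (hx t ht).1)
    (fun t ht => by
      obtain ⟨-, p, -, hw⟩ := hx t ht
      rw [ECtx.fill_resources]
      exact Multiset.mem_add.2 (.inr hw.mem_resources))
    (fun t ht htB => by
      obtain ⟨rfl, e, he, hv⟩ := hnB t ht htB
      rw [Pool.chans_of_get he, hmain e he hv, Multiset.map_zero])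
  have hne : t₀ ∈ B.filter fun t => (x t).2.2.1 = (x t₀).2.2.1 :=
    Finset.mem_filter.2 ⟨ht₀, rfl⟩
  have hpart := hcons.rolePartition (c := (x t₀).2.2.1) ⟨⟨(x t₀).2.2.1, (x t₀).2.2.2⟩, by
    have : ⟨(x t₀).2.2.1, (x t₀).2.2.2⟩ ∈ Q.endpoints (x t₀).2.2.1 := by
      rw [hend]
      exact Multiset.mem_map_of_mem _ hne
    exact (Multiset.mem_filter.1 this).1, rfl⟩
  obtain ⟨p, hp, -⟩ := (hx t₀ ht₀).2
  have hend' := hend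
  rw [Pool.endpoints] at hend'
  rw [hend', Multiset.map_map] at hpart
  obtain ⟨Q', k⟩ := Step.of_waits (τ := p.stag) ⟨t₀, hne⟩ hend hpart
    (fun t ht => (hx t (Finset.mem_filter.1 ht).1).1) fun t ht => by
      obtain ⟨htB, hc⟩ := Finset.mem_filter.1 ht
      obtain ⟨-, p', hp', hw⟩ := hx t htB
      -- The signature assigns one session type to the channel, so all its waiting threads agree on
      -- the tag `p.stag`.
      simp only [hc, hp, Option.some.injEq] at hp'
      rw [hc, ← hp'] at hw
      exact hw
  exact hstep Q' k

end MPST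

/-- Only the acyclicity of the reached pool is taken from its history. The run-time typing served to
carry acyclicity through the evaluation, and its signature need not be related to `S`. -/
theorem mainTheorem1 (U : Set ℤ) (S₀ S : MPST.Sig) (A₀ A : MPST.STm [] MPST.Srt.vtype)
    (Q₀ Q : MPST.Pool)
    (hQ₀ : MPST.PoolTyped U S₀ Q₀ A₀) (hinit : Q₀.resources = 0)
    (heval : MPST.Evaluates U Q₀ Q)
    (hQ : MPST.PoolTyped U S Q A) (hcons : MPST.Consistent U Q.resources)
    (hmain : ∀ v, Q.get 0 = some v → MPST.IsValue v → v.resources = 0) :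
    (∃ v, MPST.IsValue v ∧ Q = MPST.Pool.single 0 v) ∨ ∃ Q', MPST.Step U Q Q' :=
  hQ.progress ((hQ₀.sound hinit).evaluates heval).2 hcons hmain
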